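/- Let $(M,\rho,\mu)$ be an unbounded metric space with a Borel measure $\mu$ such that $0<\mu(M)<\infty$. Balls $B=B(z,s)$, $s>0$, carry a centre $c_B=z$ and a radius $r_B=s$; $2B=B(z,2s)$; and $\mathcal B_b$ is the family of all balls of radius at most $b$. Assume: (LD) for every $b>0$ there is a constant $D_b$ with $\mu(2B)\le D_b\,\mu(B)$ for all $B\in\mathcal B_b$; (AM) $R_0\ge 0$ and $\beta\in(1/2,1)$ are such that for all $x,y\in M$ with $\rho(x,y)>R_0$ there is $z\in M$ with $\rho(x,z)<\beta\rho(x,y)$ and $\rho(y,z)<\beta\rho(x,y)$; (I$^c$) there are a ball $B_0$ and constants $\kappa_0,C_0>0$ such that $\mu(\{x\in A:\rho(x,A^c)\le\kappa\})\ge C_0\,\kappa\,\mu(A)$ for every open set $A\subset M\setminus\overline{B_0}$ and every $\kappa\in(0,\kappa_0]$. For $r\in(1,\infty]$ and $c>0$, a $(1,r)$-atom at scale $c$ is either the constant function $1/\mu(M)$ or a function $a\in L^1(\mu)$ that is supported in a ball $B\in\mathcal B_c$ with $\int_B a\,d\mu=0$ and $\bigl(\mu(B)^{-1}\int_B|a|^r\,d\mu\bigr)^{1/r}\le\mu(B)^{-1}$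 (for $r=\infty$: $\|a\|_\infty\le\mu(B)^{-1}$). Let $H^{1}(\mu)=H^{1,r}_c(\mu)$ be the space of all $g\in L^1(\mu)$ of the form $g=\sum_j\lambda_ja_j$ with such atoms $a_j$ and $\sum_j|\lambda_j|<\infty$, normed by the infimum of $\sum_j|\lambda_j|$ over all such decompositions. For $q\in[1,\infty)$ let $BMO(\mu)=BMO^q_c(\mu)$ be the space of all $f\in L^1(\mu)$ for which $$\|f\|_{BMO}=\|f\|_1+\sup_{B\in\mathcal B_c}\Bigl(\frac1{\mu(B)}\int_B|f-f_B|^q\,d\mu\Bigr)^{1/q}<\infty ,\qquad f_B=\frac1{\mu(B)}\int_B f\,d\mu .$$ Here $c>R_0/(1-\beta)$, $r$ and $q$ are arbitrary. Let $b>R_0/(1-\beta)$. Then there is a constant $C>0$, which does not depend on $\mathcal T$ and $k$, such that the following holds for every bounded linear operator $\mathcal T$ on $L^2(\mu)$ with kernel $k$, i.e. such that $k:M\times M\to\mathbb C$ is locally integrable off the diagonal and, for every $f\in L^2(\mu)$, $\mathcal Tf(x)=\int_M k(x,y)f(y)\,d\mu(y)$ (an absolutely convergent integral) for almost every $x\notin\operatorname{supp}f$.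 Put $$\upsilon_k=\sup_{B\in\mathcal B_b}\ \sup_{x,x'\in B}\int_{(2B)^c}|k(x,y)-k(x',y)|\,d\mu(y),\qquad \nu_k=\sup_{B\in\mathcal B_b}\ \sup_{y,y'\in B}\int_{(2B)^c}|k(x,y)-k(x,y')|\,d\mu(x).$$ (i) If $\nu_k<\infty$, then $\mathcal T$ extends to a bounded operator on $L^p(\mu)$ for all $p\in(1,2]$ and from $H^1(\mu)$ to $L^1(\mu)$, and $\|\mathcal T\|_{H^1(\mu)\to L^1(\mu)}\le C\bigl(\nu_k+\|\mathcal T\|_{L^2(\mu)\to L^2(\mu)}\bigr)$. (ii) If $\upsilon_k<\infty$, then $\mathcal T$ extends to a bounded operator on $L^p(\mu)$ for all $p\in[2,\infty)$ and from $L^\infty(\mu)$ to $BMO(\mu)$, and $\|\mathcal T\|_{L^\infty(\mu)\to BMO(\mu)}\le C\bigl(\upsilon_k+\|\mathcal T\|_{L^2(\mu)\to L^2(\mu)}\bigr)$. (iii) If $\mathcal T$ is self-adjoint on $L^2(\mu)$ and $\nu_k<\infty$, then $\mathcal T$ extends to a bounded operator on $L^p(\mu)$ for all $p\in(1,\infty)$,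 from $H^1(\mu)$ to $L^1(\mu)$ and from $L^\infty(\mu)$ to $BMO(\mu)$. -/

import Mathlib

open MeasureTheory Set Metric
open scoped ENNReal NNReal

noncomputable section

namespace MetricHardy

/-! ### Geometric assumptions

A ball of `M` is an open ball `ball z s` together with its centre `z` and its radius `s > 0`. -/

/-- Local doubling: for every scale `b > 0` the measure is doubling on the balls of radius at most
`b`, with a constant that may depend on `b`. -/
def LocallyDoubling {M : Type*} [MetricSpace M] [MeasurableSpace M] (μ : Measure M) : Prop :=
  ∀ b : ℝ, 0 < b → ∃ D : ℝ≥0, ∀ (z : M) (s : ℝ), 0 < s → s ≤ b →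
    μ (ball z (2 * s)) ≤ D * μ (ball z s)

/-- The approximate midpoint property with constants `R₀` and `β`. -/
def ApproximateMidpoint (M : Type*) [MetricSpace M] (R₀ β : ℝ) : Prop :=
  0 ≤ R₀ ∧ 1 / 2 < β ∧ β < 1 ∧
    ∀ x y : M, R₀ < dist x y → ∃ z : M, dist x z < β * dist x y ∧ dist y z < β * dist x y

/-- The part of `A` at distance at most `κ` from the complement of `A`. -/
def innerBoundary {M : Type*} [MetricSpace M] (A : Set M) (κ : ℝ) : Set M :=
  {x | x ∈ A ∧ infDist x Aᶜ ≤ κ}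

/-- The complementary isoperimetric property. -/
def ComplementaryIsoperimetric {M : Type*} [MetricSpace M] [MeasurableSpace M]
    (μ : Measure M) : Prop :=
  ∃ (z₀ : M) (s₀ κ₀ C : ℝ), 0 < s₀ ∧ 0 < κ₀ ∧ 0 < C ∧
    ∀ A : Set M, IsOpen A → A ⊆ (closure (ball z₀ s₀))ᶜ →
      ∀ κ : ℝ, 0 < κ → κ ≤ κ₀ →
        ENNReal.ofReal (C * κ) * μ A ≤ μ (innerBoundary A κ)

/-! ### The atomic Hardy space -/

section Hardy

variable {M : Type*} [MetricSpace M] [MeasurableSpace M] (μ : Measure M)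

/-- `a` is a `(1, r)`-atom supported in the ball `ball z s`. The size condition is stated with the
normalised measure `μ(B)⁻¹ μ|_B` of `B = ball z s`; it reads
`(μ(B)⁻¹ ∫_B |a|^r)^{1/r} ≤ μ(B)⁻¹` for `r < ∞` and `‖a‖_∞ ≤ μ(B)⁻¹` for `r = ∞`. -/
def IsStandardAtom (r : ℝ≥0∞) (z : M) (s : ℝ) (a : Lp ℂ 1 μ) : Prop :=
  (∀ᵐ x ∂μ, x ∉ ball z s → a x = 0) ∧
  eLpNorm a r ((μ (ball z s))⁻¹ • μ.restrict (ball z s)) ≤ (μ (ball z s))⁻¹ ∧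
  ∫ x in ball z s, a x ∂μ = 0

/-- The atoms at scale `c`: the standard atoms supported in balls of radius at most `c`, and the
exceptional atom, the constant function `1 / μ(M)`. -/
def IsAtomAtScale (r : ℝ≥0∞) (c : ℝ) (a : Lp ℂ 1 μ) : Prop :=
  (∃ (z : M) (s : ℝ), 0 < s ∧ s ≤ c ∧ IsStandardAtom μ r z s a) ∨
  (∀ᵐ x ∂μ, a x = ((μ.real univ)⁻¹ : ℝ))

/-- `g = ∑ lam j • a j` is an atomic decomposition of `g` with summable coefficients; the series
converges in `L¹`. -/
def IsAtomicDecomposition (r : ℝ≥0∞) (c : ℝ) (g : Lp ℂ 1 μ)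
    (lam : ℕ → ℂ) (a : ℕ → Lp ℂ 1 μ) : Prop :=
  (∀ j, IsAtomAtScale μ r c (a j)) ∧ (Summable fun j => ‖lam j‖) ∧
    HasSum (fun j => lam j • a j) g

/-- The exceptional atom as an element of `L¹`. -/
theorem exists_atom [IsFiniteMeasure μ] (r : ℝ≥0∞) (c : ℝ) :
    ∃ a : Lp ℂ 1 μ, IsAtomAtScale μ r c a :=
  ⟨(memLp_const (((μ.real univ)⁻¹ : ℝ) : ℂ)).toLp _, Or.inr (MemLp.coeFn_toLp _)⟩

/-- The Hardy space `H_c^{1,r}(μ)`, a linear subspace of `L¹(μ)`. -/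
def hardySpace [IsFiniteMeasure μ] (r : ℝ≥0∞) (c : ℝ) : Submodule ℂ (Lp ℂ 1 μ) where
  carrier := {g | ∃ lam a, IsAtomicDecomposition μ r c g lam a}
  zero_mem' := by
    obtain ⟨a, ha⟩ := exists_atom μ r c
    exact ⟨fun _ => 0, fun _ => a, fun _ => ha, by simp,
      by simp⟩
  add_mem' := by
    rintro f g ⟨l₁, a₁, h₁, s₁, t₁⟩ ⟨l₂, a₂, h₂, s₂, t₂⟩
    let e : ℕ ≃ ℕ ⊕ ℕ := Equiv.natSumNatEquivNat.symm
    refine ⟨fun n => Sum.elim l₁ l₂ (e n), fun n => Sum.elim a₁ a₂ (e n), fun n => ?_, ?_, ?_⟩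
    · show IsAtomAtScale μ r c (Sum.elim a₁ a₂ (e n))
      rcases e n with i | i
      · exact h₁ i
      · exact h₂ i
    · exact (e.summable_iff (f := fun x => ‖Sum.elim l₁ l₂ x‖)).2
        (Summable.sum (f := fun x => ‖Sum.elim l₁ l₂ x‖) s₁ s₂)
    · exact (e.hasSum_iff (f := fun x => Sum.elim l₁ l₂ x • Sum.elim a₁ a₂ x)).2
        (HasSum.sum (f := fun x => Sum.elim l₁ l₂ x • Sum.elim a₁ a₂ x) t₁ t₂)
  smul_mem' := by
    rintro t g ⟨l, a, h, s, u⟩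
    refine ⟨fun j => t * l j, a, h, ?_, ?_⟩
    · simpa [norm_mul] using s.mul_left ‖t‖
    · simpa [mul_smul] using u.const_smul t

/-- The norm of `H_c^{1,r}(μ)`: the infimum of `∑ |lam j|` over all atomic decompositions. -/
def hardyNorm (r : ℝ≥0∞) (c : ℝ) (g : Lp ℂ 1 μ) : ℝ :=
  sInf {t | ∃ lam a, IsAtomicDecomposition μ r c g lam a ∧ t = ∑' j, ‖lam j‖}

/-! ### Bounded mean oscillation -/

/-- `N_c^q(f)`: the supremum over the balls `B` of radius at most `c` of
`(μ(B)⁻¹ ∫_B |f - f_B|^q)^{1/q}`, where `f_B` is the average of `f` over `B`. -/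
def meanOscillation (q : ℝ≥0∞) (c : ℝ) (f : M → ℂ) : ℝ≥0∞ :=
  ⨆ (z : M) (s : ℝ) (_ : 0 < s ∧ s ≤ c),
    eLpNorm (fun x => f x - ⨍ y in ball z s, f y ∂μ) q
      ((μ (ball z s))⁻¹ • μ.restrict (ball z s))

/-- The norm `‖f‖₁ + N_c^q(f)` of `BMO_c^q(μ)`, infinite if `N_c^q(f)` is. -/
def bmoNorm (q : ℝ≥0∞) (c : ℝ) (f : M → ℂ) : ℝ≥0∞ :=
  eLpNorm f 1 μ + meanOscillation μ q c f

/-- Membership in `BMO_c^q(μ)`. -/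
def MemBMO (q : ℝ≥0∞) (c : ℝ) (f : M → ℂ) : Prop :=
  MemLp f 1 μ ∧ meanOscillation μ q c f < ∞

end Hardy

/-! ### Operators and kernels -/

section Operators

variable {M : Type*} [MetricSpace M] [MeasurableSpace M] {μ : Measure M}

/-- `k` is a kernel of the operator `T` on `L²(μ)`: it is locally integrable off the diagonal, and
`T f (x) = ∫ k(x, y) f(y) dμ(y)` for almost every `x` outside the support of `f`. (For a finite
measure every `f` has a support of finite measure.) -/
def IsKernelOf (T : Lp ℂ 2 μ →L[ℂ] Lp ℂ 2 μ) (k : M → M → ℂ) : Prop :=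
  LocallyIntegrableOn (fun w : M × M => k w.1 w.2) {w | w.1 ≠ w.2} (μ.prod μ) ∧
  ∀ (f : M → ℂ) (hf : MemLp f 2 μ), ∀ᵐ x ∂μ, x ∉ tsupport f →
    Integrable (fun y => k x y * f y) μ ∧ T (hf.toLp f) x = ∫ y, k x y * f y ∂μ

variable (μ) in
/-- `υ_k` at scale `b`: regularity in the first variable. -/
def upsilonConst (b : ℝ) (k : M → M → ℂ) : ℝ≥0∞ :=
  ⨆ (z : M) (s : ℝ) (_ : 0 < s ∧ s ≤ b) (x ∈ ball z s) (x' ∈ ball z s),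
    ∫⁻ y in (ball z (2 * s))ᶜ, ‖k x y - k x' y‖ₑ ∂μ

variable (μ) in
/-- `ν_k` at scale `b`: regularity in the second variable. -/
def nuConst (b : ℝ) (k : M → M → ℂ) : ℝ≥0∞ :=
  ⨆ (z : M) (s : ℝ) (_ : 0 < s ∧ s ≤ b) (y ∈ ball z s) (y' ∈ ball z s),
    ∫⁻ x in (ball z (2 * s))ᶜ, ‖k x y - k x y'‖ₑ ∂μ

/-- `T` extends to a bounded operator on `L^p(μ)`: a bounded operator on `L^p(μ)` agrees with `T` on
`L²(μ) ∩ L^p(μ)`. -/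
def ExtendsToLp (T : Lp ℂ 2 μ →L[ℂ] Lp ℂ 2 μ) (p : ℝ≥0∞) [Fact (1 ≤ p)] : Prop :=
  ∃ S : Lp ℂ p μ →L[ℂ] Lp ℂ p μ,
    ∀ (f : M → ℂ) (h₂ : MemLp f 2 μ) (hp : MemLp f p μ),
      S (hp.toLp f) =ᵐ[μ] T (h₂.toLp f)

/-- `T` extends to a bounded operator from `H_c^{1,r}(μ)` to `L¹(μ)` of norm at most `A`: a linear
operator with this bound agrees with `T` on `H_c^{1,r}(μ) ∩ L²(μ)`. -/
def ExtendsHardyToL1 [IsFiniteMeasure μ] (T : Lp ℂ 2 μ →L[ℂ] Lp ℂ 2 μ)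
    (r : ℝ≥0∞) (c A : ℝ) : Prop :=
  ∃ S : hardySpace μ r c →ₗ[ℂ] Lp ℂ 1 μ,
    (∀ g, ‖S g‖ ≤ A * hardyNorm μ r c (g : Lp ℂ 1 μ)) ∧
    ∀ (g : hardySpace μ r c) (h₂ : MemLp (g : Lp ℂ 1 μ) 2 μ),
      S g =ᵐ[μ] T (h₂.toLp _)

/-- `T` is bounded from `L^∞(μ)` to `BMO_c^q(μ)` with norm at most `A`. (For a finite measure
`L^∞(μ)` is contained in `L²(μ)`, so that `T` is already defined on it.) -/
def BoundedLinftyToBMO (T : Lp ℂ 2 μ →L[ℂ] Lp ℂ 2 μ) (q : ℝ≥0∞) (c A : ℝ) : Prop :=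
  ∀ (f : M → ℂ) (h₂ : MemLp f 2 μ), MemLp f ∞ μ →
    MemBMO μ q c (T (h₂.toLp f)) ∧
    bmoNorm μ q c (T (h₂.toLp f)) ≤ ENNReal.ofReal A * eLpNorm f ∞ μ

end Operators

end MetricHardy

end

/-! The measure doubles only locally, so all maximal functions run over balls of bounded radius. The
core is a Fefferman-Stein inequality at a fixed scale, `exists_lintegral_rpow_le_sharpFn`: for
bounded `g`, the integral of `|g|^p` is controlled by that of the `p`-th power of the local sharp
function, plus `(∫ |g|)^p`. Let `A` be the set where the local maximal function of `g` exceeds `t`.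
Near the complement of `A` the usual good-lambda argument works (`relative_distributional`), since
the Whitney balls there are small. Points deeper than `κ` in `A` escape it. The isoperimetric
property repairs this: if `A` has small measure, the deep part is at most a fixed fraction `(1 +
θ)⁻¹ < 1` of `A` (`exists_measure_innerPart_le`), and its contribution is absorbed. By the weak type
(1,1) bound `A` is small unless `t` is at most a multiple of `∫ |g|`; those levels give the
lower-order term.

Hence an operator bounded on `L²` and from `L^∞` to `BMO` is bounded on `L^q` for `2 ≤ q < ∞`
(`exists_eLpNorm_le_of_oscBounded`). The kernel enters only through `OffDiagonalOsc`: the image of a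
bounded function vanishing on `2B` is nearly constant on `B`. Finiteness of `υ_k` gives this for
`T`; finiteness of `ν_k` gives it for the adjoint, by testing against functions of mean zero
supported in `B`. Together with the `L²` bound it yields mean oscillation bounds at scale `b`, and
approximate midpoints carry them to any scale `c` (`OscLe.exists_scale`).

Part (ii) is then direct and part (i) is its dual. A uniform bound on atoms does not by itself
define an operator on infinite atomic sums. The image of `g` in `H¹` is therefore characterised by
duality, as the `h` in `L¹` for which the pairings of `g` with truncations of `T* f` converge to the
pairing of `h` with `f`, for all bounded `f` (`IsWeakImage`). Such an `h` is unique and passes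
through atomic series, so the operator is well defined, linear and bounded, and agrees with `T` on
`L²`. In part (iii) the adjoint is `T` itself, and both halves apply. -/

set_option linter.unusedSectionVars false

namespace MetricHardy

open Filter Topology ComplexConjugate ContinuousLinearMap

variable {M : Type*} [MetricSpace M] [MeasurableSpace M] [BorelSpace M] {μ : Measure M}

/-! ### Doubling and covering -/

/-- `μ` is doubling with constant `D` on the balls of radius at most `R`. -/
def DoublingUpTo (μ : Measure M) (R : ℝ) (D : ℝ≥0) : Prop :=
  1 ≤ D ∧ ∀ (z : M) (s : ℝ), 0 < s → s ≤ R → μ (ball z (2 * s)) ≤ D * μ (ball z s)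


theorem LocallyDoubling.exists_doublingUpTo (h : LocallyDoubling μ) {R : ℝ} (hR : 0 < R) :
    ∃ D, DoublingUpTo μ R D := by
  obtain ⟨D, hD⟩ := h R hR
  refine ⟨max D 1, le_max_right _ _, fun z s hs hsR => (hD z s hs hsR).trans ?_⟩
  gcongr
  exact le_max_left _ _


theorem DoublingUpTo.measure_pow_ball_le {R : ℝ} {D : ℝ≥0} (h : DoublingUpTo μ R D) (n : ℕ) (z : M)
    {s : ℝ} (hs : 0 < s) (hR : 2 ^ n * s ≤ 2 * R) :
    μ (ball z (2 ^ n * s)) ≤ (D : ℝ≥0∞) ^ n * μ (ball z s) := by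
  induction n with
  | zero => simp
  | succ n ih =>
    have h1 : (2 : ℝ) ^ n * s ≤ R := by rw [pow_succ] at hR; linarith
    have h2 : 0 < (2 : ℝ) ^ n * s := by positivity
    have h3 := h.2 z _ h2 h1
    have h4 := ih (by linarith)
    calc μ (ball z (2 ^ (n + 1) * s)) = μ (ball z (2 * (2 ^ n * s))) := by ring_nf
      _ ≤ D * (D ^ n * μ (ball z s)) := by grw [h3, h4]
      _ = _ := by ring


theorem DoublingUpTo.measure_ball_le {R : ℝ} {D : ℝ≥0} (h : DoublingUpTo μ R D) (n : ℕ) {x y : M}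
    {r s : ℝ} (hs : 0 < s) (hR : 2 ^ n * s ≤ 2 * R) (hxy : r + dist x y ≤ 2 ^ n * s) :
    μ (ball x r) ≤ (D : ℝ≥0∞) ^ n * μ (ball y s) :=
  (measure_mono (ball_subset_ball' hxy)).trans (h.measure_pow_ball_le n y hs hR)


/-- Doubling at ever larger scales would spread a null ball to all concentric balls, which exhaust
`M`. -/
theorem LocallyDoubling.measure_ball_pos (h : LocallyDoubling μ) (hμ : 0 < μ univ) (z : M) {s : ℝ}
    (hs : 0 < s) : 0 < μ (ball z s) := by
  by_contra hc
  have h0 : μ (ball z s) = 0 := by simpa using hc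
  have h1 : ∀ n : ℕ, μ (ball z (2 ^ n * s)) = 0 := by
    intro n
    induction n with
    | zero => simpa using h0
    | succ n ih =>
      obtain ⟨D, hD⟩ := h (2 ^ n * s) (by positivity)
      have := hD z (2 ^ n * s) (by positivity) le_rfl
      rw [ih, mul_zero, nonpos_iff_eq_zero] at this
      rw [pow_succ, mul_comm _ (2 : ℝ), mul_assoc]
      exact this
  have h2 : (⋃ n : ℕ, ball z (2 ^ n * s)) = univ := by
    refine eq_univ_of_forall fun x => mem_iUnion.2 ?_
    obtain ⟨n, hn⟩ := pow_unbounded_of_one_lt (dist x z / s) (one_lt_two (α := ℝ))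
    exact ⟨n, by rw [mem_ball]; rwa [div_lt_iff₀ hs] at hn⟩
  have h3 := measure_iUnion_null h1
  rw [h2] at h3
  exact hμ.ne' h3

/-- The Vitali theorem concerns closed balls and factor 5; factor 6 leaves room for open ones. The
family is countable because its members are disjoint and of positive measure in a finite measure
space; no separability is assumed. -/
theorem exists_vitali_covering [IsFiniteMeasure μ]
    (hpos : ∀ (z : M) (s : ℝ), 0 < s → 0 < μ (ball z s)) {ι : Type*} (t : Set ι) (x : ι → M)
    (r : ι → ℝ) (R : ℝ) (hr : ∀ a ∈ t, 0 < r a ∧ r a ≤ R) :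
    ∃ u ⊆ t, u.Countable ∧ (u.PairwiseDisjoint fun a => ball (x a) (r a)) ∧
      ∀ a ∈ t, ∃ b ∈ u, ball (x a) (r a) ⊆ ball (x b) (6 * r b) := by
  obtain ⟨u, hut, hd, hc⟩ := Vitali.exists_disjoint_subfamily_covering_enlargement_closedBall
    t x r R (fun a ha => (hr a ha).2) 5 (by norm_num)
  have hd' : u.PairwiseDisjoint fun a => ball (x a) (r a) :=
    hd.mono fun a => ball_subset_closedBall
  refine ⟨u, hut, ?_, hd', fun a ha => ?_⟩
  · have := Measure.countable_meas_pos_of_disjoint_iUnion (μ := μ)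
      (As := fun a : u => ball (x a) (r a)) (fun a => isOpen_ball.measurableSet)
      (fun a b hab => hd' a.2 b.2 (fun h => hab (Subtype.ext h)))
    have h2 : {a : u | 0 < μ (ball (x a) (r a))} = univ :=
      eq_univ_of_forall fun a => hpos _ _ (hr _ (hut a.2)).1
    rw [h2, countable_univ_iff] at this
    exact this
  · obtain ⟨b, hb, hab⟩ := hc a ha
    refine ⟨b, hb, ball_subset_closedBall.trans (hab.trans (closedBall_subset_ball ?_))⟩
    have := (hr b (hut hb)).1
    linarith

/-- Centres of a Vitali family of balls of radius `ε / 6` form a countable `ε`-net. Separability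
serves Lebesgue differentiation and measurability on the product space. -/
theorem secondCountableTopology_of_measure_ball_pos [IsFiniteMeasure μ]
    (hpos : ∀ (z : M) (s : ℝ), 0 < s → 0 < μ (ball z s)) : SecondCountableTopology M := by
  refine Metric.secondCountable_of_almost_dense_set fun ε hε => ?_
  obtain ⟨u, -, hu, -, hc⟩ := exists_vitali_covering hpos univ (id : M → M) (fun _ => ε / 6) (ε / 6)
    (fun _ _ => ⟨by positivity, le_rfl⟩)
  refine ⟨u, hu, fun x => ?_⟩
  obtain ⟨y, hy, hxy⟩ := hc x (mem_univ _)
  refine ⟨y, hy, ?_⟩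
  have := hxy (mem_ball_self (by positivity))
  rw [mem_ball] at this
  simp only [id] at this
  linarith


theorem LocallyDoubling.isUnifLocDoublingMeasure (h : LocallyDoubling μ) :
    IsUnifLocDoublingMeasure μ := by
  obtain ⟨D, hD⟩ := h.exists_doublingUpTo (R := 2) (by norm_num)
  refine ⟨D ^ 2, ?_⟩
  filter_upwards [Ioo_mem_nhdsGT (zero_lt_one' ℝ)] with ε hε x
  calc μ (closedBall x (2 * ε)) ≤ μ (ball x (2 ^ 2 * ε)) :=
        measure_mono (closedBall_subset_ball (by linarith [hε.1]))
    _ ≤ (D : ℝ≥0∞) ^ 2 * μ (ball x ε) :=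
        hD.measure_pow_ball_le 2 x hε.1 (by linarith [hε.2])
    _ ≤ _ := by
        push_cast
        gcongr
        exact ball_subset_closedBall

/-! ### Suprema over balls and maximal functions -/

/-- The supremum of a functional of balls over the balls of radius at most `ρ` containing `x`. -/
noncomputable def ballSup (ρ : ℝ) (Φ : M → ℝ → ℝ≥0∞) (x : M) : ℝ≥0∞ :=
  ⨆ (z : M) (s : ℝ) (_ : 0 < s ∧ s ≤ ρ ∧ x ∈ ball z s), Φ z s


theorem lt_ballSup_iff {ρ : ℝ} {Φ : M → ℝ → ℝ≥0∞} {x : M} {t : ℝ≥0∞} :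
    t < ballSup ρ Φ x ↔ ∃ z s, (0 < s ∧ s ≤ ρ ∧ x ∈ ball z s) ∧ t < Φ z s := by
  simp [ballSup, lt_iSup_iff]


theorem le_ballSup {ρ : ℝ} {Φ : M → ℝ → ℝ≥0∞} {x z : M} {s : ℝ} (hs : 0 < s) (hsρ : s ≤ ρ)
    (hx : x ∈ ball z s) : Φ z s ≤ ballSup ρ Φ x :=
  le_iSup_of_le z (le_iSup_of_le s (le_iSup_of_le ⟨hs, hsρ, hx⟩ le_rfl))


theorem ballSup_le {ρ : ℝ} {Φ : M → ℝ → ℝ≥0∞} {x : M} {t : ℝ≥0∞}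
    (h : ∀ z s, 0 < s → s ≤ ρ → x ∈ ball z s → Φ z s ≤ t) : ballSup ρ Φ x ≤ t :=
  iSup_le fun z => iSup_le fun s => iSup_le fun hs => h z s hs.1 hs.2.1 hs.2.2


/-- The superlevel set is a union of balls, whatever `Φ` is. Besides measurability, this makes the
isoperimetric property applicable to level sets. -/
theorem isOpen_lt_ballSup (ρ : ℝ) (Φ : M → ℝ → ℝ≥0∞) (t : ℝ≥0∞) :
    IsOpen {x | t < ballSup ρ Φ x} := by
  have : {x | t < ballSup ρ Φ x} =
      ⋃ (z : M) (s : ℝ) (_ : 0 < s ∧ s ≤ ρ ∧ t < Φ z s), ball z s := by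
    ext x
    simp only [mem_ofPred_eq, lt_ballSup_iff, mem_iUnion, exists_prop]
    refine exists_congr fun z => exists_congr fun s => ?_
    tauto
  rw [this]
  exact isOpen_iUnion fun z => isOpen_iUnion fun s => isOpen_iUnion fun _ => isOpen_ball

theorem measurable_ballSup (ρ : ℝ) (Φ : M → ℝ → ℝ≥0∞) : Measurable (ballSup ρ Φ) :=
  measurable_of_Ioi fun t => (isOpen_lt_ballSup ρ Φ t).measurableSet

/-- The average of an `ℝ≥0∞`-valued function over a ball. -/
noncomputable def ballAvg (μ : Measure M) (F : M → ℝ≥0∞) (z : M) (s : ℝ) : ℝ≥0∞ :=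
  (μ (ball z s))⁻¹ * ∫⁻ x in ball z s, F x ∂μ

/-- The uncentred maximal function over the balls of radius at most `ρ`. -/
noncomputable def maximalFn (μ : Measure M) (ρ : ℝ) (F : M → ℝ≥0∞) : M → ℝ≥0∞ :=
  ballSup ρ (ballAvg μ F)


theorem lt_ballAvg_iff [IsFiniteMeasure μ] (hpos : ∀ (z : M) (s : ℝ), 0 < s → 0 < μ (ball z s))
    {F : M → ℝ≥0∞} {z : M} {s : ℝ} (hs : 0 < s) {t : ℝ≥0∞} :
    t < ballAvg μ F z s ↔ t * μ (ball z s) < ∫⁻ x in ball z s, F x ∂μ := by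
  rw [ballAvg, mul_comm, ← div_eq_mul_inv,
    ENNReal.lt_div_iff_mul_lt (Or.inl (hpos z s hs).ne') (Or.inl (measure_ne_top _ _))]

/-- Vitali covering; the enlargement by 6 costs three doublings, the last one from a ball of radius
at most `4 * ρ`. -/
theorem maximalFn_weak_type [IsFiniteMeasure μ]
    (hpos : ∀ (z : M) (s : ℝ), 0 < s → 0 < μ (ball z s)) {R : ℝ} {D : ℝ≥0}
    (hD : DoublingUpTo μ R D) {ρ : ℝ} (hρ : 4 * ρ ≤ R) (F : M → ℝ≥0∞) (t : ℝ≥0∞) :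
    t * μ {x | t < maximalFn μ ρ F x} ≤ (D : ℝ≥0∞) ^ 3 * ∫⁻ x, F x ∂μ := by
  let T : Set (M × ℝ) := {a | 0 < a.2 ∧ a.2 ≤ ρ ∧ t < ballAvg μ F a.1 a.2}
  obtain ⟨u, huT, hu, hd, hc⟩ := exists_vitali_covering hpos T Prod.fst Prod.snd ρ
    (fun a ha => ⟨ha.1, ha.2.1⟩)
  have hsub : {x | t < maximalFn μ ρ F x} ⊆ ⋃ a ∈ u, ball a.1 (6 * a.2) := by
    intro x hx
    obtain ⟨z, s, ⟨hs, hsρ, hxz⟩, hlt⟩ := lt_ballSup_iff.1 hx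
    obtain ⟨b, hb, hab⟩ := hc (z, s) ⟨hs, hsρ, hlt⟩
    exact mem_biUnion hb (hab hxz)
  have := hu.to_subtype
  calc t * μ {x | t < maximalFn μ ρ F x} ≤ t * ∑' a : u, μ (ball a.1.1 (6 * a.1.2)) := by
        gcongr
        exact (measure_mono hsub).trans (measure_biUnion_le μ hu _)
    _ ≤ t * ∑' a : u, (D : ℝ≥0∞) ^ 3 * μ (ball a.1.1 a.1.2) := by
        gcongr with a
        have ha := huT a.2
        exact hD.measure_ball_le 3 ha.1 (by linarith [ha.2.1]) (by rw [dist_self]; linarith [ha.1])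
    _ = (D : ℝ≥0∞) ^ 3 * ∑' a : u, t * μ (ball a.1.1 a.1.2) := by
        rw [ENNReal.tsum_mul_left, ENNReal.tsum_mul_left]; ring
    _ ≤ (D : ℝ≥0∞) ^ 3 * ∑' a : u, ∫⁻ x in ball a.1.1 a.1.2, F x ∂μ := by
        gcongr with a
        have ha := huT a.2
        exact ((lt_ballAvg_iff hpos ha.1).1 ha.2.2).le
    _ = (D : ℝ≥0∞) ^ 3 * ∫⁻ x in ⋃ a ∈ u, ball a.1 a.2, F x ∂μ := by
        rw [lintegral_biUnion hu (fun _ _ => isOpen_ball.measurableSet) hd]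
    _ ≤ _ := by gcongr; exact Measure.restrict_le_self

/-- The mean oscillation of `f` over a ball, as a double average. -/
noncomputable def ballOsc {E : Type*} [ENorm E] [Sub E] (μ : Measure M) (f : M → E) (z : M) (s : ℝ) :
    ℝ≥0∞ :=
  (μ (ball z s))⁻¹ * ((μ (ball z s))⁻¹ * ∫⁻ x in ball z s, ∫⁻ y in ball z s, ‖f x - f y‖ₑ ∂μ ∂μ)

/-- The sharp maximal function over the balls of radius at most `ρ`. -/
noncomputable def sharpFn {E : Type*} [ENorm E] [Sub E] (μ : Measure M) (ρ : ℝ) (f : M → E) :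
    M → ℝ≥0∞ :=
  ballSup ρ (ballOsc μ f)

/-! ### The relative distributional inequality -/

theorem lintegral_lintegral_le_ballOsc [IsFiniteMeasure μ]
    (hpos : ∀ (z : M) (s : ℝ), 0 < s → 0 < μ (ball z s)) {E : Type*} [ENorm E] [Sub E] (g : M → E)
    {A B : Set M} {z : M} {s : ℝ} (hs : 0 < s) (hA : A ⊆ ball z s) (hB : B ⊆ ball z s) :
    ∫⁻ x in A, ∫⁻ y in B, ‖g x - g y‖ₑ ∂μ ∂μ ≤ μ (ball z s) * (μ (ball z s) * ballOsc μ g z s) := by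
  have h0 := (hpos z s hs).ne'
  have h1 := measure_ne_top μ (ball z s)
  rw [ballOsc, ENNReal.mul_inv_cancel_left h0 h1, ENNReal.mul_inv_cancel_left h0 h1]
  exact (lintegral_mono fun x => lintegral_mono_set hB).trans (lintegral_mono_set hA)

theorem enorm_le_ballAvg_add [IsFiniteMeasure μ]
    (hpos : ∀ (z : M) (s : ℝ), 0 < s → 0 < μ (ball z s)) {g : M → ℝ} (hg : Measurable g)
    (u z : M) {s : ℝ} (hs : 0 < s) :
    ‖g u‖ₑ ≤ ballAvg μ (fun v => ‖g v‖ₑ) z s + ballAvg μ (fun v => ‖g u - g v‖ₑ) z s := by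
  have h0 := (hpos z s hs).ne'
  have h1 := measure_ne_top μ (ball z s)
  rw [ballAvg, ballAvg, ← mul_add, ← lintegral_add_left hg.enorm]
  calc ‖g u‖ₑ = (μ (ball z s))⁻¹ * ∫⁻ v in ball z s, ‖g u‖ₑ ∂μ := by
        rw [setLIntegral_const, mul_comm (‖g u‖ₑ), ENNReal.inv_mul_cancel_left h0 h1]
    _ ≤ _ := by
        gcongr with v
        have : g u = g v + (g u - g v) := by abel
        calc ‖g u‖ₑ = ‖g v + (g u - g v)‖ₑ := by rw [← this]
          _ ≤ _ := enorm_add_le _ _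

theorem ballAvg_const_add [IsFiniteMeasure μ]
    (hpos : ∀ (z : M) (s : ℝ), 0 < s → 0 < μ (ball z s)) (c : ℝ≥0∞) (F : M → ℝ≥0∞) (z : M) {s : ℝ}
    (hs : 0 < s) : ballAvg μ (fun u => c + F u) z s = c + ballAvg μ F z s := by
  rw [ballAvg, lintegral_add_left measurable_const, mul_add, setLIntegral_const, mul_comm c,
    ENNReal.inv_mul_cancel_left (hpos z s hs).ne' (measure_ne_top μ _), ballAvg]

theorem ballAvg_mono {F G : M → ℝ≥0∞} (h : ∀ x, F x ≤ G x) (z : M) (s : ℝ) :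
    ballAvg μ F z s ≤ ballAvg μ G z s := by
  rw [ballAvg, ballAvg]
  gcongr with x
  exact h x

/-- Averages over different balls differ by at most a double average of `|g u - g v|`. When both
balls lie in a common ball of comparable measure, that is controlled by the oscillation of `g`
there. -/
theorem ballAvg_enorm_le [IsFiniteMeasure μ]
    (hpos : ∀ (z : M) (s : ℝ), 0 < s → 0 < μ (ball z s)) {g : M → ℝ} (hg : Measurable g)
    (x y : M) {r s : ℝ} (hr : 0 < r) (hs : 0 < s) :
    ballAvg μ (fun v => ‖g v‖ₑ) x r ≤ ballAvg μ (fun v => ‖g v‖ₑ) y s +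
      ballAvg μ (fun u => ballAvg μ (fun v => ‖g u - g v‖ₑ) y s) x r := by
  rw [← ballAvg_const_add hpos _ _ _ hr]
  exact ballAvg_mono (fun u => enorm_le_ballAvg_add hpos hg u y hs) _ _

theorem setLIntegral_ballAvg_sub_le [IsFiniteMeasure μ]
    (hpos : ∀ (z : M) (s : ℝ), 0 < s → 0 < μ (ball z s)) {E : Type*} [ENorm E] [Sub E] (g : M → E)
    {A : Set M} {y z : M} {r s : ℝ} (hr : 0 < r) (hs : 0 < s)
    (hA : A ⊆ ball z s) (hB : ball y r ⊆ ball z s) {D : ℝ≥0∞}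
    (hD : μ (ball z s) ≤ D * μ (ball y r)) :
    ∫⁻ u in A, ballAvg μ (fun v => ‖g u - g v‖ₑ) y r ∂μ ≤
      D * (μ (ball z s) * ballOsc μ g z s) := by
  have h0 := (hpos y r hr).ne'
  have h1 := measure_ne_top μ (ball y r)
  simp only [ballAvg]
  rw [lintegral_const_mul' _ _ (ENNReal.inv_ne_top.2 h0)]
  calc _ ≤ (μ (ball y r))⁻¹ * (μ (ball z s) * (μ (ball z s) * ballOsc μ g z s)) := by
        gcongr
        exact lintegral_lintegral_le_ballOsc hpos g hs hA hB
    _ ≤ (μ (ball y r))⁻¹ * (D * μ (ball y r) * (μ (ball z s) * ballOsc μ g z s)) := by gcongr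
    _ = (μ (ball y r))⁻¹ * (μ (ball y r) * (D * (μ (ball z s) * ballOsc μ g z s))) := by ring
    _ = _ := ENNReal.inv_mul_cancel_left h0 h1

theorem ballAvg_le_maximalFn {F : M → ℝ≥0∞} {ρ : ℝ} {x z : M} {s : ℝ} (hs : 0 < s) (hsρ : s ≤ ρ)
    (hx : x ∈ ball z s) : ballAvg μ F z s ≤ maximalFn μ ρ F x :=
  le_ballSup (Φ := ballAvg μ F) hs hsρ hx

/-- Good-lambda estimate on one Whitney ball, with `y` a nearby point where the maximal function is
at most `t`. Averages over balls centred at `y` are then at most `t`, so an average above `(1 + τ) *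
t` must come from oscillation. The weak type bound for the oscillation `F` measures where this can
happen. -/
theorem relative_distributional_ball [IsFiniteMeasure μ]
    (hpos : ∀ (z : M) (s : ℝ), 0 < s → 0 < μ (ball z s)) {ρ : ℝ} {D : ℝ≥0}
    (hD : DoublingUpTo μ (16 * ρ) D) {g : M → ℝ} (hg : Measurable g) {t : ℝ≥0∞}
    (ht0 : t ≠ 0) (ht : t ≠ ∞) {τ ε : ℝ≥0} (hε : D ^ 9 * ε ≤ τ) {x y : M} {r : ℝ} (hr : 0 < r)
    (hrρ : 2 * r ≤ ρ) (hxy : dist x y < 4 * r)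
    (hy : maximalFn μ ρ (fun v => ‖g v‖ₑ) y ≤ t) :
    τ * μ ({w | (1 + τ) * t < maximalFn μ ρ (fun v => ‖g v‖ₑ) w ∧
      sharpFn μ (16 * ρ) g w ≤ ε * t} ∩ ball x (6 * r)) ≤ D ^ 12 * ε * μ (ball x r) := by
  set F : M → ℝ≥0∞ := fun u => ballAvg μ (fun v => ‖g u - g v‖ₑ) y r with hF
  set Bad := {w | (1 + τ) * t < maximalFn μ ρ (fun v => ‖g v‖ₑ) w ∧
      sharpFn μ (16 * ρ) g w ≤ ε * t} ∩ ball x (6 * r) with hBad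
  -- A single point `w₀` of the bad set certifies that the oscillation over `ball x (16 * r)` is at
  -- most `ε * t`.
  rcases Bad.eq_empty_or_nonempty with hemp | ⟨w₀, hw₀⟩
  · simp [hemp]
  have hyx : dist y x < 4 * r := by rwa [dist_comm]
  have hsub : Bad ⊆ {w | τ * t < maximalFn μ ρ ((ball x (16 * r)).indicator F) w} := by
    rintro w ⟨⟨hw1, hw2⟩, hw3⟩
    rw [mem_ball] at hw3
    obtain ⟨z, s, ⟨hs, hsρ, hwz⟩, hlt⟩ := lt_ballSup_iff.1 hw1
    rw [mem_ball] at hwz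
    have hzx : dist z x ≤ dist w z + dist w x := dist_triangle_left _ _ _
    have hzy : dist z y ≤ dist z x + dist x y := dist_triangle _ _ _
    have hyz : dist y z = dist z y := dist_comm _ _
    have hwz' : dist z w = dist w z := dist_comm _ _
    -- Small balls stay inside `ball x (16 * r)` and are handled by the localised maximal function.
    -- For `r ≤ s` the ball and its translate to `y` both lie in `ball z (12 * s)`, and small
    -- oscillation there contradicts the excess `τ * t`; this is where `D ^ 9 * ε ≤ τ` is needed.
    rcases lt_or_ge s r with hsr | hsr
    · have hsubG : ball z s ⊆ ball x (16 * r) := ball_subset_ball' (by linarith)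
      have h1 := ballAvg_enorm_le hpos hg z y hs hr
      have h2 : ballAvg μ (fun v => ‖g v‖ₑ) y r ≤ t :=
        (ballAvg_le_maximalFn hr (by linarith) (mem_ball_self hr)).trans hy
      have h3 : ballAvg μ ((ball x (16 * r)).indicator F) z s = ballAvg μ F z s := by
        rw [ballAvg, ballAvg]
        congr 1
        exact setLIntegral_congr_fun measurableSet_ball
          (fun u hu => indicator_of_mem (hsubG hu) F)
      refine lt_of_lt_of_le ?_ (ballAvg_le_maximalFn hs hsρ (by rwa [mem_ball]))
      rw [h3]
      have h4 : t + τ * t < t + ballAvg μ F z s := by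
        calc t + τ * t = (1 + τ) * t := by ring
          _ < _ := hlt
          _ ≤ _ := h1
          _ ≤ _ := by gcongr
      exact (ENNReal.add_lt_add_iff_left ht).1 h4
    · exfalso
      have h1 := ballAvg_enorm_le hpos hg z y hs hs
      have h2 : ballAvg μ (fun v => ‖g v‖ₑ) y s ≤ t :=
        (ballAvg_le_maximalFn hs hsρ (mem_ball_self hs)).trans hy
      have hG1 : μ (ball z (12 * s)) ≤ (D : ℝ≥0∞) ^ 4 * μ (ball z s) :=
        hD.measure_ball_le 4 hs (by linarith) (by rw [dist_self]; linarith)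
      have hG2 : μ (ball z (12 * s)) ≤ (D : ℝ≥0∞) ^ 5 * μ (ball y s) :=
        hD.measure_ball_le 5 hs (by linarith) (by linarith)
      have h3 := setLIntegral_ballAvg_sub_le hpos g (A := ball z s) (y := y) (r := s) (s := 12 * s)
        hs (by linarith) (ball_subset_ball (by linarith)) (ball_subset_ball' (by linarith)) hG2
      have h4 : ballOsc μ g z (12 * s) ≤ ε * t :=
        (le_ballSup (Φ := ballOsc μ g) (x := w) (by linarith) (by linarith)
          (by rw [mem_ball]; linarith)).trans hw2
      have h5 : ballAvg μ (fun u => ballAvg μ (fun v => ‖g u - g v‖ₑ) y s) z s ≤ τ * t := by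
        rw [ballAvg]
        calc _ ≤ (μ (ball z s))⁻¹ *
              ((D : ℝ≥0∞) ^ 5 * (D ^ 4 * μ (ball z s) * (ε * t))) := by
              grw [h3, hG1, h4]
          _ = (μ (ball z s))⁻¹ * (μ (ball z s) * ((D ^ 9 * ε) * t)) := by ring
          _ = (D ^ 9 * ε) * t :=
              ENNReal.inv_mul_cancel_left (hpos z s hs).ne' (measure_ne_top μ _)
          _ ≤ τ * t := by gcongr; exact_mod_cast hε
      have h6 : (1 + τ) * t < t + τ * t := hlt.trans_le (h1.trans (by gcongr))
      rw [add_mul, one_mul] at h6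
      exact lt_irrefl _ h6
  have hG1 : μ (ball x (16 * r)) ≤ (D : ℝ≥0∞) ^ 4 * μ (ball x r) :=
    hD.measure_ball_le 4 hr (by linarith) (by rw [dist_self]; linarith)
  have hG2 : μ (ball x (16 * r)) ≤ (D : ℝ≥0∞) ^ 5 * μ (ball y r) :=
    hD.measure_ball_le 5 hr (by linarith) (by linarith)
  have h3 := setLIntegral_ballAvg_sub_le hpos g (A := ball x (16 * r)) (y := y) (r := r)
        (s := 16 * r) hr (by linarith) Subset.rfl (ball_subset_ball' (by linarith)) hG2
  have h4 : ballOsc μ g x (16 * r) ≤ ε * t :=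
    (le_ballSup (Φ := ballOsc μ g) (x := w₀) (by linarith) (by linarith)
      (ball_subset_ball (by linarith) hw₀.2)).trans hw₀.1.2
  have hweak := maximalFn_weak_type hpos hD (ρ := ρ) (by linarith)
    ((ball x (16 * r)).indicator F) (τ * t)
  rw [lintegral_indicator measurableSet_ball] at hweak
  -- The exponent 12 is `3 + 5 + 4`: the weak type bound, the comparison with `ball y r`, and the
  -- comparison with `ball x r`.
  have h5 : t * (τ * μ Bad) ≤ t * (D ^ 12 * ε * μ (ball x r)) := by
    calc t * (τ * μ Bad) = τ * t * μ Bad := by ring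
      _ ≤ τ * t * μ {w | τ * t < maximalFn μ ρ ((ball x (16 * r)).indicator F) w} := by gcongr
      _ ≤ _ := hweak
      _ ≤ D ^ 3 * (D ^ 5 * (D ^ 4 * μ (ball x r) * (ε * t))) := by grw [h3, hG1, h4]
      _ = _ := by ring
  exact (ENNReal.mul_le_mul_iff_right ht0 ht).1 h5

/-- The interior part of a set: the points at distance more than `κ` from the complement. -/
def innerPart (A : Set M) (κ : ℝ) : Set M := {x | κ < infDist x Aᶜ}

theorem isOpen_innerPart (A : Set M) (κ : ℝ) : IsOpen (innerPart A κ) :=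
  isOpen_lt continuous_const (continuous_infDist_pt _)

theorem innerPart_subset (A : Set M) {κ : ℝ} (hκ : 0 ≤ κ) : innerPart A κ ⊆ A := by
  intro x hx
  by_contra h
  have : infDist x Aᶜ = 0 := infDist_zero_of_mem h
  rw [innerPart, mem_ofPred_eq] at hx
  linarith

/-- The strip of depth `κ` is covered by balls whose radius is half the distance to the complement;
the disjoint ones lie inside the level set, so the local estimates add up. Deeper points would need
balls beyond the scale `ρ`, and their measure is left on the right-hand side. -/
theorem relative_distributional [IsFiniteMeasure μ]
    (hpos : ∀ (z : M) (s : ℝ), 0 < s → 0 < μ (ball z s)) {ρ : ℝ} {D : ℝ≥0}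
    (hD : DoublingUpTo μ (16 * ρ) D) {g : M → ℝ} (hg : Measurable g) {t : ℝ≥0∞}
    (ht0 : t ≠ 0) (ht : t ≠ ∞) {τ ε : ℝ≥0} (hε : D ^ 9 * ε ≤ τ) {κ : ℝ} (hκ : κ ≤ ρ)
    (hne : {x | t < maximalFn μ ρ (fun v => ‖g v‖ₑ) x}ᶜ.Nonempty) :
    τ * μ {w | (1 + τ) * t < maximalFn μ ρ (fun v => ‖g v‖ₑ) w} ≤
      D ^ 12 * ε * μ {x | t < maximalFn μ ρ (fun v => ‖g v‖ₑ) x} +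
      τ * μ (innerPart {x | t < maximalFn μ ρ (fun v => ‖g v‖ₑ) x} κ) +
      τ * μ {w | ε * t < sharpFn μ (16 * ρ) g w} := by
  set A := {x | t < maximalFn μ ρ (fun v => ‖g v‖ₑ) x} with hA
  set L := {w | (1 + τ) * t < maximalFn μ ρ (fun v => ‖g v‖ₑ) w ∧
      sharpFn μ (16 * ρ) g w ≤ ε * t} with hL
  have hAo : IsOpen A := isOpen_lt_ballSup _ _ _
  let S := {x | x ∈ A ∧ infDist x Aᶜ ≤ κ}
  have hdpos : ∀ x ∈ A, 0 < infDist x Aᶜ := fun x hx =>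
    (hAo.isClosed_compl.notMem_iff_infDist_pos hne).1 (fun h => h hx)
  obtain ⟨u, huS, hu, hd, hc⟩ := exists_vitali_covering hpos S id (fun x => infDist x Aᶜ / 2) κ
    (fun x hx => ⟨half_pos (hdpos x hx.1), by have := hdpos x hx.1; have := hx.2; linarith⟩)
  have := hu.to_subtype
  have hballs : ∀ x ∈ u, τ * μ (L ∩ ball x (6 * (infDist x Aᶜ / 2))) ≤
      D ^ 12 * ε * μ (ball x (infDist x Aᶜ / 2)) := by
    intro x hx
    have hx' := huS hx
    have hd0 := hdpos x hx'.1
    -- With `r` half the distance, a point of the complement is found within `4 * r`.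
    obtain ⟨y, hy, hxy⟩ := (infDist_lt_iff hne (r := 2 * infDist x Aᶜ)).1 (by linarith)
    refine relative_distributional_ball hpos hD hg ht0 ht hε (y := y) (by linarith)
      (by linarith [hx'.2]) (by linarith) ?_
    simpa [hA] using hy
  have hstrip : τ * μ (L ∩ S) ≤ D ^ 12 * ε * μ A := by
    calc τ * μ (L ∩ S) ≤ τ * ∑' x : u, μ (L ∩ ball x (6 * (infDist x.1 Aᶜ / 2))) := by
          gcongr
          refine (measure_mono ?_).trans (measure_biUnion_le μ hu
            (fun x => L ∩ ball x (6 * (infDist x Aᶜ / 2))))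
          rintro x ⟨hxL, hxS⟩
          obtain ⟨b, hb, hab⟩ := hc x hxS
          exact mem_biUnion hb ⟨hxL, hab (mem_ball_self (half_pos (hdpos x hxS.1)))⟩
      _ = ∑' x : u, τ * μ (L ∩ ball x (6 * (infDist x.1 Aᶜ / 2))) := by
          rw [ENNReal.tsum_mul_left]
      _ ≤ ∑' x : u, D ^ 12 * ε * μ (ball x.1 (infDist x.1 Aᶜ / 2)) := by
          exact ENNReal.tsum_le_tsum fun x => hballs x x.2
      _ = D ^ 12 * ε * μ (⋃ x ∈ u, ball x (infDist x Aᶜ / 2)) := by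
          rw [ENNReal.tsum_mul_left]
          congr 1
          exact (measure_biUnion hu hd (fun _ _ => measurableSet_ball)).symm
      _ ≤ _ := by
          gcongr
          refine iUnion₂_subset fun x hx => ?_
          refine (ball_subset_ball ?_).trans
            (ball_infDist_compl_subset (x := x) (s := A))
          linarith [hdpos x (huS hx).1]
  have hsub : {w | (1 + τ) * t < maximalFn μ ρ (fun v => ‖g v‖ₑ) w} ⊆
      (L ∩ S) ∪ innerPart A κ ∪ {w | ε * t < sharpFn μ (16 * ρ) g w} := by
    intro w hw
    by_cases h1 : ε * t < sharpFn μ (16 * ρ) g w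
    · exact Or.inr h1
    · have hwA : w ∈ A := by
        have hw' : (1 + τ) * t < maximalFn μ ρ (fun v => ‖g v‖ₑ) w := hw
        refine lt_of_le_of_lt ?_ hw'
        calc t = 1 * t := (one_mul t).symm
          _ ≤ (1 + τ) * t := by gcongr; exact le_self_add
      rcases le_or_gt (infDist w Aᶜ) κ with h2 | h2
      · exact Or.inl (Or.inl ⟨⟨hw, not_lt.1 h1⟩, hwA, h2⟩)
      · exact Or.inl (Or.inr h2)
  calc _ ≤ τ * (μ (L ∩ S) + μ (innerPart A κ) + μ {w | ε * t < sharpFn μ (16 * ρ) g w}) := by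
        gcongr
        exact (measure_mono hsub).trans ((measure_union_le _ _).trans
          (by gcongr; exact measure_union_le _ _))
    _ = τ * μ (L ∩ S) + τ * μ (innerPart A κ) +
          τ * μ {w | ε * t < sharpFn μ (16 * ρ) g w} := by ring
    _ ≤ _ := by gcongr

/-! ### Consequences of the isoperimetric property -/

/-- The isoperimetric property concerns only open sets away from `B₀`. A set of small measure
contains no `κ`-ball centred near `B₀`, so its part deeper than `κ` lies far from `B₀`. Removing the
closure of `B₀` does not affect that part, and the property then applies to what remains. -/
theorem exists_measure_innerPart_le [IsFiniteMeasure μ]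
    (hpos : ∀ (z : M) (s : ℝ), 0 < s → 0 < μ (ball z s)) (hLD : LocallyDoubling μ)
    (hI : ComplementaryIsoperimetric μ) {ρ : ℝ} (hρ : 0 < ρ) :
    ∃ κ : ℝ, 0 < κ ∧ κ ≤ ρ ∧ ∃ θ : ℝ≥0, 0 < θ ∧ ∃ m : ℝ≥0, 0 < m ∧ ∀ A : Set M, IsOpen A → μ A < m →
      Aᶜ.Nonempty ∧ (1 + θ) * μ (innerPart A κ) ≤ μ A := by
  obtain ⟨z₀, s₀, κ₀, C, hs₀, hκ₀, hC, hA⟩ := hI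
  set κ := min ρ κ₀ with hκdef
  have hκ : 0 < κ := lt_min hρ hκ₀
  -- Points at distance at least `L` from `z₀` are at distance at least `2 * κ` from the closure of
  -- `B₀`, so removing it keeps their depth above `κ`.
  set L := s₀ + 2 * κ with hL
  obtain ⟨n, hn⟩ := pow_unbounded_of_one_lt ((L + L) / κ) (one_lt_two (α := ℝ))
  rw [div_lt_iff₀ hκ] at hn
  obtain ⟨D, hD⟩ := hLD.exists_doublingUpTo (R := 2 ^ n * κ) (by positivity)
  have hball : ∀ x, dist x z₀ < L → μ (ball z₀ L) ≤ (D : ℝ≥0∞) ^ n * μ (ball x κ) := fun x hx =>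
    hD.measure_ball_le n hκ (by nlinarith [pow_pos (two_pos (α := ℝ)) n])
      (by rw [dist_comm]; linarith)
  have hD0 : (D : ℝ≥0∞) ^ n ≠ 0 := pow_ne_zero _ (by
    have := zero_lt_one.trans_le hD.1
    exact_mod_cast this.ne')
  have hDt : (D : ℝ≥0∞) ^ n ≠ ∞ := ENNReal.pow_ne_top ENNReal.coe_ne_top
  have hm_ne : μ (ball z₀ L) / (D : ℝ≥0∞) ^ n ≠ ∞ := ENNReal.div_ne_top (measure_ne_top _ _) hD0
  have hm0 : μ (ball z₀ L) / (D : ℝ≥0∞) ^ n ≠ 0 :=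
    ENNReal.div_ne_zero.2 ⟨(hpos z₀ L (by positivity)).ne', hDt⟩
  -- The threshold `m` is a lower bound, by doubling, for the measures of all `κ`-balls centred in
  -- `ball z₀ L`.
  refine ⟨κ, hκ, min_le_left _ _, (C * κ).toNNReal, by simpa using mul_pos hC hκ,
    (μ (ball z₀ L) / (D : ℝ≥0∞) ^ n).toNNReal, ENNReal.toNNReal_pos hm0 hm_ne,
    fun A hAo hAm => ?_⟩
  rw [ENNReal.coe_toNNReal hm_ne] at hAm
  have hnot : ∀ x, dist x z₀ < L → ¬ ball x κ ⊆ A := by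
    intro x hx hsub
    have h1 := hball x hx
    have h2 : μ (ball z₀ L) / (D : ℝ≥0∞) ^ n ≤ μ A :=
      (ENNReal.div_le_of_le_mul' h1).trans (measure_mono hsub)
    exact absurd h2 (not_le.2 hAm)
  have hne : Aᶜ.Nonempty := by
    obtain ⟨y, -, hy⟩ := not_subset.1 (hnot z₀ (by simp; positivity))
    exact ⟨y, hy⟩
  refine ⟨hne, ?_⟩
  set A' := A \ closure (ball z₀ s₀) with hA'
  have hA'o : IsOpen A' := hAo.sdiff isClosed_closure
  have hsub : innerPart A κ ⊆ innerPart A' κ := by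
    intro x hx
    rw [innerPart, mem_ofPred_eq] at hx
    have hball1 : ball x (infDist x Aᶜ) ⊆ A := ball_infDist_compl_subset
    have hxL : L ≤ dist x z₀ := by
      by_contra h
      exact hnot x (not_le.1 h) ((ball_subset_ball hx.le).trans hball1)
    have hne' : A'ᶜ.Nonempty := ⟨z₀, fun h => h.2 (subset_closure (mem_ball_self hs₀))⟩
    have h2 : min (infDist x Aᶜ) (2 * κ) ≤ infDist x A'ᶜ := by
      refine (le_infDist hne').2 fun y hy => ?_
      by_contra! hlt
      refine hy ⟨hball1 (mem_ball'.2 (hlt.trans_le (min_le_left _ _))), fun hy2 => ?_⟩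
      have h3 : dist y z₀ ≤ s₀ := closure_ball_subset_closedBall hy2
      have h4 : dist x y < 2 * κ := hlt.trans_le (min_le_right _ _)
      have := dist_triangle x y z₀
      linarith
    exact (lt_min hx (by linarith)).trans_le h2
  have hiso := hA A' hA'o (fun x hx => hx.2) κ hκ (min_le_right _ _)
  have hunion : μ (innerPart A' κ) + μ (innerBoundary A' κ) ≤ μ A' := by
    rw [← measure_union' _ (isOpen_innerPart _ _).measurableSet]
    · exact measure_mono (union_subset (innerPart_subset _ hκ.le) fun x hx => hx.1)
    · exact disjoint_left.2 fun x h1 h2 => absurd h2.2 (not_le.2 h1)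
  have hof : ENNReal.ofReal (C * κ) = ((C * κ).toNNReal : ℝ≥0∞) := rfl
  rw [hof] at hiso
  calc (1 + ((C * κ).toNNReal : ℝ≥0∞)) * μ (innerPart A κ)
      ≤ (1 + ((C * κ).toNNReal : ℝ≥0∞)) * μ (innerPart A' κ) := by gcongr
    _ = μ (innerPart A' κ) + (C * κ).toNNReal * μ (innerPart A' κ) := by ring
    _ ≤ μ (innerPart A' κ) + (C * κ).toNNReal * μ A' := by
        gcongr
        exact innerPart_subset _ hκ.le
    _ ≤ μ (innerPart A' κ) + μ (innerBoundary A' κ) := by gcongr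
    _ ≤ μ A' := hunion
    _ ≤ μ A := measure_mono sdiff_subset

/-! ### The sharp maximal inequality -/

theorem lintegral_rpow_eq_lintegral_meas_lt {F : M → ℝ≥0∞} (hF : Measurable F)
    (hfin : ∀ x, F x ≠ ∞) {p : ℝ} (hp : 0 < p) :
    ∫⁻ x, F x ^ p ∂μ = ENNReal.ofReal p *
      ∫⁻ t in Ioi (0 : ℝ), μ {x | ENNReal.ofReal t < F x} * ENNReal.ofReal (t ^ (p - 1)) := by
  have h := lintegral_rpow_eq_lintegral_meas_lt_mul μ (f := fun x => (F x).toReal)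
    (ae_of_all _ fun _ => ENNReal.toReal_nonneg) hF.ennreal_toReal.aemeasurable hp
  have h1 : ∀ x, ENNReal.ofReal ((F x).toReal ^ p) = F x ^ p := fun x => by
    rw [← ENNReal.ofReal_rpow_of_nonneg ENNReal.toReal_nonneg hp.le, ENNReal.ofReal_toReal (hfin x)]
  simp only [h1] at h
  rw [h]
  congr 1
  refine setLIntegral_congr_fun measurableSet_Ioi fun t ht => ?_
  have h2 : {a | t < (F a).toReal} = {x | ENNReal.ofReal t < F x} := by
    ext x
    exact (ENNReal.ofReal_lt_iff_lt_toReal (le_of_lt ht) (hfin x)).symm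
  simp only [h2]

theorem lintegral_rpow_le_of_meas_lt {F₀ F₁ F₂ F₃ : M → ℝ≥0∞} (hF₀ : Measurable F₀)
    (hF₁ : Measurable F₁) (hF₂ : Measurable F₂) (hF₃ : Measurable F₃) (h₀ : ∀ x, F₀ x ≠ ∞)
    (h₁ : ∀ x, F₁ x ≠ ∞) (h₂ : ∀ x, F₂ x ≠ ∞) (h₃ : ∀ x, F₃ x ≠ ∞) {p : ℝ} (hp : 0 < p)
    (η : ℝ≥0∞) (h : ∀ t : ℝ, 0 < t → μ {x | ENNReal.ofReal t < F₀ x} ≤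
      η * μ {x | ENNReal.ofReal t < F₁ x} + μ {x | ENNReal.ofReal t < F₂ x} +
      μ {x | ENNReal.ofReal t < F₃ x}) :
    ∫⁻ x, F₀ x ^ p ∂μ ≤ η * ∫⁻ x, F₁ x ^ p ∂μ + ∫⁻ x, F₂ x ^ p ∂μ + ∫⁻ x, F₃ x ^ p ∂μ := by
  rw [lintegral_rpow_eq_lintegral_meas_lt hF₀ h₀ hp, lintegral_rpow_eq_lintegral_meas_lt hF₁ h₁ hp,
    lintegral_rpow_eq_lintegral_meas_lt hF₂ h₂ hp, lintegral_rpow_eq_lintegral_meas_lt hF₃ h₃ hp]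
  have hm : ∀ F : M → ℝ≥0∞, Measurable fun t : ℝ =>
      μ {x | ENNReal.ofReal t < F x} * ENNReal.ofReal (t ^ (p - 1)) := by
    intro F
    have hanti : Antitone fun t : ℝ => μ {x | ENNReal.ofReal t < F x} := fun s t hst =>
      measure_mono fun x (hx : ENNReal.ofReal t < F x) =>
        (ENNReal.ofReal_le_ofReal hst).trans_lt hx
    exact hanti.measurable.mul (by fun_prop)
  calc _ ≤ ENNReal.ofReal p * ∫⁻ t in Ioi (0 : ℝ),
        (η * (μ {x | ENNReal.ofReal t < F₁ x} * ENNReal.ofReal (t ^ (p - 1))) +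
        μ {x | ENNReal.ofReal t < F₂ x} * ENNReal.ofReal (t ^ (p - 1)) +
        μ {x | ENNReal.ofReal t < F₃ x} * ENNReal.ofReal (t ^ (p - 1))) := by
        refine mul_le_mul' le_rfl (setLIntegral_mono' (measurableSet_Ioi (a := (0 : ℝ)))
          fun t ht => ?_)
        calc _ ≤ (η * μ {x | ENNReal.ofReal t < F₁ x} + μ {x | ENNReal.ofReal t < F₂ x} +
              μ {x | ENNReal.ofReal t < F₃ x}) * ENNReal.ofReal (t ^ (p - 1)) := by
              gcongr
              exact h t ht
          _ = _ := by ring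
    _ = _ := by
        rw [lintegral_add_right _ (hm _), lintegral_add_right _ (hm _),
          lintegral_const_mul _ (hm _)]
        ring

/-- Absorption; finiteness of `I` is indispensable, which is why the sharp inequality is stated for
bounded functions. -/
theorem le_of_le_mul_add_self {I Q : ℝ≥0∞} {γ : ℝ≥0} (hγ : γ < 1) (hI : I ≠ ∞)
    (h : I ≤ γ * I + Q) : I ≤ ((1 - γ)⁻¹ : ℝ≥0) * Q := by
  have h0 : 1 - γ ≠ 0 := (tsub_pos_of_lt hγ).ne'
  have h1 : ((1 - γ : ℝ≥0) : ℝ≥0∞) * I ≤ Q := by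
    have h2 : (γ : ℝ≥0∞) * I + (1 - γ : ℝ≥0) * I ≤ γ * I + Q := by
      rw [← add_mul, ← ENNReal.coe_add, add_tsub_cancel_of_le hγ.le]
      simpa using h
    exact (ENNReal.add_le_add_iff_left (ENNReal.mul_ne_top ENNReal.coe_ne_top hI)).1 h2
  rw [ENNReal.coe_inv h0, mul_comm, ← div_eq_mul_inv, ENNReal.le_div_iff_mul_le
    (Or.inl (by exact_mod_cast h0)) (Or.inl ENNReal.coe_ne_top), mul_comm]
  exact h1

/-- Lebesgue differentiation, which holds along closed balls; passing to open balls costs a factor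
`D` in an error term that tends to zero. -/
theorem ae_enorm_le_maximalFn [IsFiniteMeasure μ] (hμ : 0 < μ univ) (hLD : LocallyDoubling μ)
    {ρ : ℝ} (hρ : 0 < ρ) {g : M → ℝ} (hg : Measurable g) (hi : Integrable g μ) :
    ∀ᵐ x ∂μ, ‖g x‖ₑ ≤ maximalFn μ ρ (fun v => ‖g v‖ₑ) x := by
  have hpos : ∀ (z : M) (s : ℝ), 0 < s → 0 < μ (ball z s) :=
    fun z s hs => hLD.measure_ball_pos hμ z hs
  have := secondCountableTopology_of_measure_ball_pos hpos
  have := hLD.isUnifLocDoublingMeasure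
  obtain ⟨D, hD⟩ := hLD.exists_doublingUpTo hρ
  filter_upwards [IsUnifLocDoublingMeasure.ae_tendsto_average_norm_sub μ hi.locallyIntegrable 1]
    with x hx
  have h1 := hx (l := 𝓝[>] (0 : ℝ)) (fun _ => x) id tendsto_id (by
    filter_upwards [self_mem_nhdsWithin] with δ hδ
    simpa using le_of_lt hδ)
  have h2 : Tendsto (fun δ : ℝ => maximalFn μ ρ (fun v => ‖g v‖ₑ) x +
      D * ENNReal.ofReal (⨍ y in closedBall x δ, ‖g y - g x‖ ∂μ)) (𝓝[>] 0)
      (𝓝 (maximalFn μ ρ (fun v => ‖g v‖ₑ) x + D * ENNReal.ofReal 0)) :=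
    tendsto_const_nhds.add (ENNReal.Tendsto.const_mul ((ENNReal.continuous_ofReal.tendsto 0).comp h1)
      (Or.inr ENNReal.coe_ne_top))
  rw [ENNReal.ofReal_zero, mul_zero, add_zero] at h2
  refine ge_of_tendsto h2 ?_
  filter_upwards [Ioo_mem_nhdsGT hρ] with δ hδ
  refine (enorm_le_ballAvg_add hpos hg x x hδ.1).trans ?_
  gcongr
  · exact ballAvg_le_maximalFn hδ.1 hδ.2.le (mem_ball_self hδ.1)
  · have hcb : μ (closedBall x δ) ≤ D * μ (ball x δ) :=
      (measure_mono (closedBall_subset_ball (by linarith [hδ.1]))).trans (hD.2 x δ hδ.1 hδ.2.le)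
    have hcb0 : μ (closedBall x δ) ≠ 0 :=
      ((hpos x δ hδ.1).trans_le (measure_mono ball_subset_closedBall)).ne'
    have hint : Integrable (fun y => g y - g x) (μ.restrict (closedBall x δ)) :=
      (hi.sub (integrable_const _)).restrict
    have h3 : ENNReal.ofReal (⨍ y in closedBall x δ, ‖g y - g x‖ ∂μ) =
        (μ (closedBall x δ))⁻¹ * ∫⁻ y in closedBall x δ, ‖g y - g x‖ₑ ∂μ := by
      rw [setAverage_eq, smul_eq_mul, ENNReal.ofReal_mul (by positivity),
        ofReal_integral_norm_eq_lintegral_enorm hint, measureReal_def,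
        ENNReal.ofReal_inv_of_pos (ENNReal.toReal_pos hcb0 (measure_ne_top _ _)),
        ENNReal.ofReal_toReal (measure_ne_top _ _)]
    rw [h3, ballAvg]
    have h4 : (μ (ball x δ))⁻¹ ≤ D * (μ (closedBall x δ))⁻¹ := by
      rw [← div_eq_mul_inv, ENNReal.le_div_iff_mul_le (Or.inl hcb0) (Or.inl (measure_ne_top _ _)),
        mul_comm, ← div_eq_mul_inv]
      exact ENNReal.div_le_of_le_mul hcb
    calc _ ≤ D * (μ (closedBall x δ))⁻¹ * ∫⁻ y in closedBall x δ, ‖g y - g x‖ₑ ∂μ := by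
          gcongr ?_ * ?_
          refine (lintegral_mono_set ball_subset_closedBall).trans (lintegral_mono fun y => ?_)
          rw [enorm_sub_rev]
      _ = _ := by ring

theorem ballAvg_le_of_le [IsFiniteMeasure μ]
    (hpos : ∀ (z : M) (s : ℝ), 0 < s → 0 < μ (ball z s)) {F : M → ℝ≥0∞} {N : ℝ≥0∞}
    (hF : ∀ x, F x ≤ N) (z : M) {s : ℝ} (hs : 0 < s) : ballAvg μ F z s ≤ N := by
  refine (ballAvg_mono hF z s).trans ?_
  rw [ballAvg, setLIntegral_const, mul_comm N,
    ENNReal.inv_mul_cancel_left (hpos z s hs).ne' (measure_ne_top μ _)]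

theorem maximalFn_le_of_le [IsFiniteMeasure μ]
    (hpos : ∀ (z : M) (s : ℝ), 0 < s → 0 < μ (ball z s)) {F : M → ℝ≥0∞} {N : ℝ≥0∞}
    (hF : ∀ x, F x ≤ N) (ρ : ℝ) (x : M) : maximalFn μ ρ F x ≤ N :=
  ballSup_le fun z _ hs _ _ => ballAvg_le_of_le hpos hF z hs

theorem ballOsc_eq_ballAvg {E : Type*} [ENorm E] [Sub E] (f : M → E) (z : M) (s : ℝ) (h : μ (ball z s) ≠ 0) :
    ballOsc μ f z s = ballAvg μ (fun x => ballAvg μ (fun y => ‖f x - f y‖ₑ) z s) z s := by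
  simp only [ballOsc, ballAvg]
  rw [lintegral_const_mul' _ _ (ENNReal.inv_ne_top.2 h)]

theorem sharpFn_le_of_le [IsFiniteMeasure μ]
    (hpos : ∀ (z : M) (s : ℝ), 0 < s → 0 < μ (ball z s)) {E : Type*} [NormedAddCommGroup E]
    {f : M → E} {N : ℝ≥0∞}
    (hf : ∀ x, ‖f x‖ₑ ≤ N) (ρ : ℝ) (x : M) : sharpFn μ ρ f x ≤ 2 * N := by
  refine ballSup_le fun z s hs _ _ => ?_
  rw [ballOsc_eq_ballAvg _ _ _ (hpos z s hs).ne']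
  refine ballAvg_le_of_le hpos (fun x => ballAvg_le_of_le hpos (fun y => ?_) z hs) z hs
  calc ‖f x - f y‖ₑ ≤ ‖f x‖ₑ + ‖f y‖ₑ := enorm_sub_le
    _ ≤ N + N := add_le_add (hf x) (hf y)
    _ = 2 * N := by ring

/-- At `τ = δ = 0` the expression equals `(1 + θ)⁻¹ < 1`, so continuity leaves room for small
positive values. -/
theorem exists_gap {θ : ℝ≥0} (hθ : 0 < θ) {p : ℝ} (hp : 0 < p) :
    ∃ τ δ γ : ℝ≥0, 0 < τ ∧ 0 < δ ∧ δ ≤ 1 ∧ γ < 1 ∧ (1 + τ) ^ p * (δ + (1 + θ)⁻¹) ≤ γ := by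
  have hlim : Tendsto (fun u : ℝ≥0 => (1 + u) ^ p * (u + (1 + θ)⁻¹)) (𝓝[>] 0)
      (𝓝 ((1 + 0) ^ p * (0 + (1 + θ)⁻¹))) := by
    refine tendsto_nhdsWithin_of_tendsto_nhds (Continuous.tendsto ?_ 0)
    have : Continuous fun u : ℝ≥0 => (1 + u) ^ p :=
      (NNReal.continuous_rpow_const hp.le).comp (by fun_prop)
    fun_prop
  have hlt : (1 + 0 : ℝ≥0) ^ p * (0 + (1 + θ)⁻¹) < 1 := by
    simp only [add_zero, NNReal.one_rpow, one_mul, zero_add]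
    exact inv_lt_one_of_one_lt₀ (by simpa using hθ)
  have hev := (hlim.eventually (gt_mem_nhds hlt)).and
    (Ioc_mem_nhdsGT (zero_lt_one' ℝ≥0))
  obtain ⟨u, hu, hu2⟩ := hev.exists
  exact ⟨u, u, _, hu2.1, hu2.1, hu2.2, hu, le_rfl⟩

/-- The sharp maximal inequality of Fefferman and Stein at a fixed scale. -/
theorem exists_lintegral_rpow_le_sharpFn [IsFiniteMeasure μ] (hμ : 0 < μ univ)
    (hLD : LocallyDoubling μ) (hI : ComplementaryIsoperimetric μ) {ρ : ℝ} (hρ : 0 < ρ) {p : ℝ}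
    (hp : 0 < p) :
    ∃ C : ℝ≥0∞, C ≠ ∞ ∧ ∀ g : M → ℝ, Measurable g → (∃ N : ℝ≥0, ∀ x, ‖g x‖ₑ ≤ N) →
      ∫⁻ x, ‖g x‖ₑ ^ p ∂μ ≤
        C * (∫⁻ x, sharpFn μ (16 * ρ) g x ^ p ∂μ + (∫⁻ x, ‖g x‖ₑ ∂μ) ^ p) := by
  have hpos : ∀ (z : M) (s : ℝ), 0 < s → 0 < μ (ball z s) :=
    fun z s hs => hLD.measure_ball_pos hμ z hs
  obtain ⟨D, hD⟩ := hLD.exists_doublingUpTo (R := 16 * ρ) (by positivity)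
  obtain ⟨κ, hκ, hκρ, θ, hθ, m, hm, hinner⟩ := exists_measure_innerPart_le hpos hLD hI hρ
  obtain ⟨τ, δ, γ, hτ, hδ, hδ1, hγ, hle⟩ := exists_gap hθ hp
  have hDpos : 0 < D := zero_lt_one.trans_le hD.1
  -- Chosen so that the factor `D ^ 12 * ε` of the good-lambda inequality becomes `τ * δ`; since `δ
  -- ≤ 1`, also `D ^ 9 * ε ≤ τ`.
  set ε : ℝ≥0 := τ * δ / D ^ 12 with hεdef
  have hε : 0 < ε := by positivity
  have hε9 : D ^ 9 * ε ≤ τ := by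
    calc D ^ 9 * ε ≤ D ^ 12 * ε := by gcongr; exacts [hD.1, by norm_num]
      _ = τ * δ := by rw [hεdef]; field_simp
      _ ≤ τ * 1 := by gcongr
      _ = τ := mul_one _
  have hε12 : (D : ℝ≥0∞) ^ 12 * ε = τ * δ := by
    have : D ^ 12 * ε = τ * δ := by rw [hεdef]; field_simp
    exact_mod_cast this
  set η : ℝ≥0 := δ + (1 + θ)⁻¹ with hη
  set a : ℝ≥0 := 1 + τ with ha
  have ha0 : (a : ℝ≥0∞) ≠ 0 := by simp [ha]
  -- For `t ≥ q * G` the weak type bound makes the level set smaller than `m`; the factor 2 makes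
  -- this strict.
  set q : ℝ≥0∞ := 2 * D ^ 3 / m with hq
  have hqt : q ≠ ∞ := ENNReal.div_ne_top
    (ENNReal.mul_ne_top (by simp) (ENNReal.pow_ne_top ENNReal.coe_ne_top)) (by exact_mod_cast hm.ne')
  refine ⟨((1 - γ)⁻¹ : ℝ≥0) * (a ^ p * ((ε : ℝ≥0∞)⁻¹ ^ p + q ^ p * μ univ)), ?_, ?_⟩
  · have h1 : (a : ℝ≥0∞) ^ p ≠ ∞ := ENNReal.rpow_ne_top_of_nonneg hp.le ENNReal.coe_ne_top
    have h2 : (ε : ℝ≥0∞)⁻¹ ^ p ≠ ∞ := ENNReal.rpow_ne_top_of_nonneg hp.le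
      (ENNReal.inv_ne_top.2 (by exact_mod_cast hε.ne'))
    have h3 : q ^ p ≠ ∞ := ENNReal.rpow_ne_top_of_nonneg hp.le hqt
    have h4 := measure_ne_top μ univ
    finiteness
  rintro g hg ⟨N, hN⟩
  have hgi : Integrable g μ := by
    refine Integrable.of_bound hg.aestronglyMeasurable N (ae_of_all _ fun x => ?_)
    have := hN x
    rw [enorm_le_coe] at this
    exact this
  set Mg := maximalFn μ ρ (fun v => ‖g v‖ₑ) with hMg
  set Sg := sharpFn μ (16 * ρ) g with hSg
  set G := ∫⁻ x, ‖g x‖ₑ ∂μ with hG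
  have hGt : G ≠ ∞ := hgi.2.ne
  have hMgm : Measurable Mg := measurable_ballSup _ _
  have hSgm : Measurable Sg := measurable_ballSup _ _
  have hMgt : ∀ x, Mg x ≤ N := fun x => maximalFn_le_of_le hpos hN ρ x
  have hSgt : ∀ x, Sg x ≤ 2 * N := fun x => sharpFn_le_of_le hpos hN _ x
  set I := ∫⁻ x, Mg x ^ p ∂μ with hIdef
  have hIt : I ≠ ∞ := by
    refine ne_top_of_le_ne_top ?_ (lintegral_mono fun x =>
      ENNReal.rpow_le_rpow (hMgt x) hp.le)
    rw [lintegral_const]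
    exact ENNReal.mul_ne_top (ENNReal.rpow_ne_top_of_nonneg hp.le ENNReal.coe_ne_top)
      (measure_ne_top _ _)
  -- The good-lambda inequality becomes a comparison of distribution functions after rescaling `Mg`
  -- by `a⁻¹` and `Sg` by `ε⁻¹`. Levels below `q * G` are paid for by the constant function `q * G`,
  -- whose superlevel set is then the whole space.
  have hmain : ∫⁻ x, ((a : ℝ≥0∞)⁻¹ * Mg x) ^ p ∂μ ≤ η * I +
      ∫⁻ x, ((ε : ℝ≥0∞)⁻¹ * Sg x) ^ p ∂μ + ∫⁻ _, (q * G) ^ p ∂μ := by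
    have hε0 : (ε : ℝ≥0∞) ≠ 0 := by exact_mod_cast hε.ne'
    refine lintegral_rpow_le_of_meas_lt (hMgm.const_mul _) hMgm (hSgm.const_mul _) measurable_const
      (fun x => ENNReal.mul_ne_top (ENNReal.inv_ne_top.2 ha0)
        (ne_top_of_le_ne_top ENNReal.coe_ne_top (hMgt x)))
      (fun x => ne_top_of_le_ne_top ENNReal.coe_ne_top (hMgt x))
      (fun x => ENNReal.mul_ne_top (ENNReal.inv_ne_top.2 hε0)
        (ne_top_of_le_ne_top (ENNReal.mul_ne_top (by simp) ENNReal.coe_ne_top) (hSgt x)))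
      (fun _ => ENNReal.mul_ne_top hqt hGt) hp _ fun t ht => ?_
    set T := ENNReal.ofReal t with hT
    have hT0 : T ≠ 0 := by simpa [hT] using ht
    have hTt : T ≠ ∞ := ENNReal.ofReal_ne_top
    by_cases hTq : T < q * G
    · refine le_add_left ?_
      simp only [hTq, ofPred_true]
      exact measure_mono (subset_univ _)
    · have hset1 : ∀ (c : ℝ≥0∞), c ≠ 0 → c ≠ ∞ → ∀ F : M → ℝ≥0∞,
          {x | T < c⁻¹ * F x} = {x | c * T < F x} := by
        intro c hc hc' F
        ext x
        rw [mem_ofPred_eq, mem_ofPred_eq, mul_comm, ← div_eq_mul_inv,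
          ENNReal.lt_div_iff_mul_lt (Or.inl hc) (Or.inl hc'), mul_comm]
      rw [hset1 a ha0 ENNReal.coe_ne_top, hset1 ε hε0 ENNReal.coe_ne_top]
      set A := {x | T < Mg x} with hA
      have hweak : T * μ A ≤ D ^ 3 * G := maximalFn_weak_type hpos hD (by linarith) _ _
      have hAm : μ A < m := by
        by_contra! hcon
        have h1 : T * m ≤ D ^ 3 * G := by grw [hcon]; exact hweak
        have h2 : 2 * (D ^ 3 * G) ≤ T * m := by
          have := not_lt.1 hTq
          rw [hq, mul_comm, ← mul_div_assoc] at this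
          have := (ENNReal.div_le_iff (by exact_mod_cast hm.ne') ENNReal.coe_ne_top).1 this
          calc _ = G * (2 * D ^ 3) := by ring
            _ ≤ _ := this
        have h3 : (D : ℝ≥0∞) ^ 3 * G ≠ ∞ :=
          ENNReal.mul_ne_top (ENNReal.pow_ne_top ENNReal.coe_ne_top) hGt
        have h4 : T * m ≠ 0 := mul_ne_zero hT0 (by exact_mod_cast hm.ne')
        have h5 : (D : ℝ≥0∞) ^ 3 * G + D ^ 3 * G ≤ 0 + D ^ 3 * G := by
          rw [← two_mul, zero_add]; exact h2.trans h1
        have h6 := (ENNReal.add_le_add_iff_right h3).1 h5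
        exact h4 (le_antisymm (h1.trans h6) zero_le)
      obtain ⟨hne, hin⟩ := hinner A (isOpen_lt_ballSup _ _ _) hAm
      have hrel := relative_distributional hpos hD hg hT0 hTt hε9 hκρ hne
      have hin' : μ (innerPart A κ) ≤ ((1 + θ)⁻¹ : ℝ≥0) * μ A := by
        rw [ENNReal.coe_inv (by positivity), mul_comm, ← div_eq_mul_inv,
          ENNReal.le_div_iff_mul_le (Or.inl (by simp)) (Or.inl ENNReal.coe_ne_top), mul_comm]
        exact_mod_cast hin
      have hτ0 : (τ : ℝ≥0∞) ≠ 0 := by exact_mod_cast hτ.ne'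
      refine le_add_right ?_
      refine (ENNReal.mul_le_mul_iff_right hτ0 ENNReal.coe_ne_top).1 ?_
      calc τ * μ {x | a * T < Mg x} ≤ D ^ 12 * ε * μ A + τ * μ (innerPart A κ) +
            τ * μ {w | ε * T < Sg w} := by simpa [ha] using hrel
        _ ≤ τ * δ * μ A + τ * (((1 + θ)⁻¹ : ℝ≥0) * μ A) + τ * μ {w | ε * T < Sg w} := by
            rw [hε12]
            gcongr
        _ = _ := by
            rw [hη]
            push_cast
            ring
  have hscale : ∀ (c : ℝ≥0∞) (F : M → ℝ≥0∞), Measurable F →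
      ∫⁻ x, (c * F x) ^ p ∂μ = c ^ p * ∫⁻ x, F x ^ p ∂μ := by
    intro c F hF
    simp_rw [ENNReal.mul_rpow_of_nonneg _ _ hp.le]
    exact lintegral_const_mul _ (hF.pow_const p)
  rw [hscale _ _ hMgm, hscale _ _ hSgm, lintegral_const] at hmain
  have hap : (a : ℝ≥0∞) ^ p * (a : ℝ≥0∞)⁻¹ ^ p = 1 := by
    rw [← ENNReal.mul_rpow_of_nonneg _ _ hp.le, ENNReal.mul_inv_cancel ha0 ENNReal.coe_ne_top,
      ENNReal.one_rpow]
  have hstep : I ≤ γ * I +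
      a ^ p * ((ε : ℝ≥0∞)⁻¹ ^ p * ∫⁻ x, Sg x ^ p ∂μ + (q * G) ^ p * μ univ) := by
    calc I = a ^ p * ((a : ℝ≥0∞)⁻¹ ^ p * I) := by rw [← mul_assoc, hap, one_mul]
      _ ≤ a ^ p * (η * I + (ε : ℝ≥0∞)⁻¹ ^ p * ∫⁻ x, Sg x ^ p ∂μ + (q * G) ^ p * μ univ) := by
          gcongr
      _ = (a ^ p * η) * I + a ^ p * ((ε : ℝ≥0∞)⁻¹ ^ p * ∫⁻ x, Sg x ^ p ∂μ +
            (q * G) ^ p * μ univ) := by ring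
      _ ≤ _ := by
          gcongr
          rw [← ENNReal.coe_rpow_of_nonneg _ hp.le]
          exact_mod_cast hle
  have hfin := le_of_le_mul_add_self hγ hIt hstep
  calc ∫⁻ x, ‖g x‖ₑ ^ p ∂μ ≤ I := by
        refine lintegral_mono_ae ?_
        filter_upwards [ae_enorm_le_maximalFn hμ hLD hρ hg hgi] with x hx
        exact ENNReal.rpow_le_rpow hx hp.le
    _ ≤ _ := hfin
    _ ≤ _ := by
        rw [mul_assoc, mul_assoc, ENNReal.mul_rpow_of_nonneg _ _ hp.le]
        refine mul_le_mul' le_rfl (mul_le_mul' le_rfl ?_)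
        rw [add_mul, mul_add, mul_add]
        refine add_le_add le_self_add ?_
        refine le_add_left ?_
        exact le_of_eq (by ring)

/-! ### Oscillations and averages -/

/-- The normalised restriction of `μ` to a ball. -/
noncomputable abbrev ballMeasure (μ : Measure M) (z : M) (s : ℝ) : Measure M :=
  (μ (ball z s))⁻¹ • μ.restrict (ball z s)

theorem ballAvg_eq_lintegral (F : M → ℝ≥0∞) (z : M) (s : ℝ) :
    ballAvg μ F z s = ∫⁻ x, F x ∂ballMeasure μ z s := by
  rw [ballAvg, lintegral_smul_measure, smul_eq_mul]

theorem isProbabilityMeasure_ballMeasure [IsFiniteMeasure μ] {z : M} {s : ℝ}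
    (h : 0 < μ (ball z s)) : IsProbabilityMeasure (ballMeasure μ z s) := by
  refine ⟨?_⟩
  rw [Measure.smul_apply, Measure.restrict_apply_univ, smul_eq_mul,
    ENNReal.inv_mul_cancel h.ne' (measure_ne_top _ _)]

theorem ballMeasure_absolutelyContinuous (z : M) (s : ℝ) : ballMeasure μ z s ≪ μ :=
  (Measure.AbsolutelyContinuous.rfl.smul_left _).trans Measure.restrict_le_self.absolutelyContinuous

theorem ballOsc_le_two_mul_ballAvg [IsFiniteMeasure μ] {f : M → ℂ} (hf : Measurable f) (α : ℂ)
    {z : M} {s : ℝ} (h : 0 < μ (ball z s)) :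
    ballOsc μ f z s ≤ 2 * ballAvg μ (fun x => ‖f x - α‖ₑ) z s := by
  have := isProbabilityMeasure_ballMeasure h
  have hm : Measurable fun x => ‖f x - α‖ₑ := (hf.sub_const α).enorm
  rw [ballOsc_eq_ballAvg _ _ _ h.ne']
  simp only [ballAvg_eq_lintegral]
  calc _ ≤ ∫⁻ x, ∫⁻ y, (‖f x - α‖ₑ + ‖f y - α‖ₑ) ∂ballMeasure μ z s ∂ballMeasure μ z s := by
        gcongr with x y
        calc ‖f x - f y‖ₑ = ‖(f x - α) - (f y - α)‖ₑ := by congr 1; ring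
          _ ≤ _ := enorm_sub_le
    _ = _ := by
        simp only [lintegral_add_left measurable_const, lintegral_const, measure_univ, mul_one]
        rw [lintegral_add_left hm, lintegral_const, measure_univ, mul_one, two_mul]

theorem ballAvg_sq_le [IsFiniteMeasure μ] {f : M → ℂ} (hf : Measurable f) {z : M} {s : ℝ}
    (h : 0 < μ (ball z s)) :
    ballAvg μ (fun x => ‖f x‖ₑ) z s ^ 2 ≤ ballAvg μ (fun x => ‖f x‖ₑ ^ 2) z s := by
  have := isProbabilityMeasure_ballMeasure h
  simp only [ballAvg_eq_lintegral]
  have h1 := eLpNorm_le_eLpNorm_of_exponent_le (μ := ballMeasure μ z s) (p := 1) (q := 2)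
    (by norm_num) hf.aestronglyMeasurable (f := f)
  rw [eLpNorm_one_eq_lintegral_enorm] at h1
  have h2 := eLpNorm_nnreal_pow_eq_lintegral (f := f) (μ := ballMeasure μ z s) (p := 2) (by norm_num)
  simp only [NNReal.coe_ofNat, ENNReal.rpow_ofNat, ENNReal.coe_ofNat] at h2
  rw [← h2]
  gcongr

theorem ballOsc_congr {f g : M → ℂ} (h : f =ᵐ[μ] g) (z : M) (s : ℝ) :
    ballOsc μ f z s = ballOsc μ g z s := by
  rw [ballOsc, ballOsc]
  congr 2
  have h' : ∀ᵐ x ∂μ.restrict (ball z s), f x = g x := ae_restrict_of_ae h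
  refine lintegral_congr_ae ?_
  filter_upwards [h'] with x hx
  refine lintegral_congr_ae ?_
  filter_upwards [h'] with y hy
  rw [hx, hy]

theorem ballOsc_add_le [IsFiniteMeasure μ] {f g : M → ℂ} (hf : Measurable f)
    (z : M) (s : ℝ) : ballOsc μ (f + g) z s ≤ ballOsc μ f z s + ballOsc μ g z s := by
  rw [ballOsc, ballOsc, ballOsc, ← mul_add, ← mul_add]
  gcongr
  have hm : Measurable fun w : M × M => ‖f w.1 - f w.2‖ₑ :=
    ((hf.comp measurable_fst).sub (hf.comp measurable_snd)).enorm
  rw [← lintegral_add_left hm.lintegral_prod_right']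
  refine lintegral_mono fun x => ?_
  simp only
  have hx : Measurable fun y => ‖f x - f y‖ₑ := (hf.const_sub (f x)).enorm
  rw [← lintegral_add_left hx]
  refine lintegral_mono fun y => ?_
  simp only [Pi.add_apply]
  rw [add_sub_add_comm]
  exact enorm_add_le _ _

theorem ballOsc_mono {E F : Type*} [ENorm E] [Sub E] [ENorm F] [Sub F] {f : M → E} {g : M → F}
    (h : ∀ x y, ‖f x - f y‖ₑ ≤ ‖g x - g y‖ₑ) (z : M) (s : ℝ) : ballOsc μ f z s ≤ ballOsc μ g z s := by
  rw [ballOsc, ballOsc]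
  gcongr with x y
  exact h x y

theorem sharpFn_mono {E F : Type*} [ENorm E] [Sub E] [ENorm F] [Sub F] {f : M → E} {g : M → F}
    (h : ∀ x y, ‖f x - f y‖ₑ ≤ ‖g x - g y‖ₑ) (ρ : ℝ) (x : M) : sharpFn μ ρ f x ≤ sharpFn μ ρ g x :=
  ballSup_le fun z s hs hsρ hx => (ballOsc_mono h z s).trans
    (le_ballSup (Φ := ballOsc μ g) hs hsρ hx)

/-- By Cauchy-Schwarz the square of the sharp function is at most four times the maximal function of
`|f|²`, which has weak type (1,1). -/
theorem sharpFn_weak_type_two [IsFiniteMeasure μ]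
    (hpos : ∀ (z : M) (s : ℝ), 0 < s → 0 < μ (ball z s)) {D : ℝ≥0} {b : ℝ}
    (hD : DoublingUpTo μ (4 * b) D) {f : M → ℂ} (hf : Measurable f) (t : ℝ≥0∞) :
    t ^ 2 * μ {x | t < sharpFn μ b f x} ≤ 4 * D ^ 3 * ∫⁻ x, ‖f x‖ₑ ^ 2 ∂μ := by
  have hsub : {x | t < sharpFn μ b f x} ⊆
      {x | t ^ 2 / 4 < maximalFn μ b (fun x => ‖f x‖ₑ ^ 2) x} := by
    intro x hx
    obtain ⟨z, s, ⟨hs, hsb, hxz⟩, hlt⟩ := lt_ballSup_iff.1 hx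
    refine lt_of_lt_of_le ?_ (ballAvg_le_maximalFn hs hsb hxz)
    have h1 := ballOsc_le_two_mul_ballAvg hf 0 (hpos z s hs)
    simp only [sub_zero] at h1
    have h2 := ballAvg_sq_le hf (hpos z s hs)
    rw [ENNReal.div_lt_iff (by norm_num) (by norm_num)]
    calc t ^ 2 < ballOsc μ f z s ^ 2 := by
          rw [← ENNReal.rpow_two, ← ENNReal.rpow_two]
          exact ENNReal.rpow_lt_rpow hlt (by norm_num)
      _ ≤ (2 * ballAvg μ (fun x => ‖f x‖ₑ) z s) ^ 2 := by gcongr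
      _ = ballAvg μ (fun x => ‖f x‖ₑ) z s ^ 2 * 4 := by ring
      _ ≤ _ := by gcongr
  have h1 := maximalFn_weak_type hpos hD (ρ := b) le_rfl (fun x => ‖f x‖ₑ ^ 2) (t ^ 2 / 4)
  calc _ ≤ t ^ 2 * μ {x | t ^ 2 / 4 < maximalFn μ b (fun x => ‖f x‖ₑ ^ 2) x} := by gcongr
    _ = 4 * (t ^ 2 / 4 * μ {x | t ^ 2 / 4 < maximalFn μ b (fun x => ‖f x‖ₑ ^ 2) x}) := by
        rw [← mul_assoc, ENNReal.mul_div_cancel (by norm_num) (by norm_num)]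
    _ ≤ 4 * (D ^ 3 * ∫⁻ x, ‖f x‖ₑ ^ 2 ∂μ) := by gcongr
    _ = _ := by ring

/-! ### Interpolation between `L²` and `L^∞ → BMO` -/

/-- `U` is bounded by `K` on `L²(μ)` and from `L^∞(μ)` to `BMO` at scale `b`. -/
structure OscBounded (U : Lp ℂ 2 μ →L[ℂ] Lp ℂ 2 μ) (b : ℝ) (K : ℝ≥0) : Prop where
  eLpNorm_le : ∀ f : Lp ℂ 2 μ, eLpNorm (U f) 2 μ ≤ K * eLpNorm f 2 μ
  ballOsc_le : ∀ (f : Lp ℂ 2 μ) (m : ℝ≥0), (∀ᵐ x ∂μ, ‖f x‖ₑ ≤ m) → ∀ (z : M) (s : ℝ), 0 < s →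
    s ≤ b → ballOsc μ (U f) z s ≤ K * m

theorem lintegral_enorm_sq_eq (f : M → ℂ) : ∫⁻ x, ‖f x‖ₑ ^ 2 ∂μ = eLpNorm f 2 μ ^ 2 := by
  have h2 := eLpNorm_nnreal_pow_eq_lintegral (f := f) (μ := μ) (p := 2) (by norm_num)
  simp only [NNReal.coe_ofNat, ENNReal.rpow_ofNat, ENNReal.coe_ofNat] at h2
  exact h2.symm

/-- The function is cut at height `t / (2 * K)`. The image of the bounded part has oscillation at
most `t / 2`, so the level `t` forces oscillation above `t / 2` from the image of the large part, to
which the `L²` bound applies. -/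
theorem OscBounded.meas_sharpFn_le [IsFiniteMeasure μ]
    (hpos : ∀ (z : M) (s : ℝ), 0 < s → 0 < μ (ball z s)) {D : ℝ≥0} {b : ℝ}
    (hD : DoublingUpTo μ (4 * b) D) {U : Lp ℂ 2 μ →L[ℂ] Lp ℂ 2 μ} {K : ℝ≥0} (hK : 0 < K)
    (hU : OscBounded U b K) (f : Lp ℂ 2 μ) {t : ℝ≥0∞} (ht : t ≠ ∞) :
    t ^ 2 * μ {x | t < sharpFn μ b (U f) x} ≤
      16 * D ^ 3 * K ^ 2 * ∫⁻ x in {x | t < 2 * K * ‖f x‖ₑ}, ‖f x‖ₑ ^ 2 ∂μ := by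
  have hfm : Measurable f := (Lp.stronglyMeasurable f).measurable
  set S := {x | t < 2 * K * ‖f x‖ₑ} with hS
  have hSm : MeasurableSet S := measurableSet_lt measurable_const (hfm.enorm.const_mul _)
  have h₁ : MemLp (S.indicator f) 2 μ := (Lp.memLp f).indicator hSm
  have h₂ : MemLp (Sᶜ.indicator f) 2 μ := (Lp.memLp f).indicator hSm.compl
  set f₁ := h₁.toLp _
  set f₂ := h₂.toLp _
  have hsum : f = f₁ + f₂ := by
    rw [← MemLp.toLp_add h₁ h₂]
    refine Lp.ext ?_
    refine EventuallyEq.symm ((MemLp.coeFn_toLp _).trans ?_)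
    rw [indicator_self_add_compl]
  have hUsum : U f =ᵐ[μ] U f₁ + U f₂ := by
    rw [hsum, map_add]
    exact Lp.coeFn_add _ _
  have hosc₂ : ∀ (z : M) (s : ℝ), 0 < s → s ≤ b → ballOsc μ (U f₂) z s ≤ t / 2 := by
    intro z s hs hsb
    have h2K : (2 * K : ℝ≥0∞) ≠ 0 := by simp [hK.ne']
    have hm : ((t / (2 * K)).toNNReal : ℝ≥0∞) = t / (2 * K) :=
      ENNReal.coe_toNNReal (ENNReal.div_ne_top ht h2K)
    refine (hU.ballOsc_le f₂ (t / (2 * K)).toNNReal ?_ z s hs hsb).trans ?_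
    · rw [hm]
      filter_upwards [h₂.coeFn_toLp] with x hx
      rw [hx]
      by_cases hxS : x ∈ S
      · simp [hxS]
      · rw [indicator_of_mem (by exact hxS), ENNReal.le_div_iff_mul_le (Or.inl h2K)
          (Or.inl (by finiteness)), mul_comm]
        exact not_lt.1 hxS
    · rw [hm]
      refine le_of_eq ?_
      have hK0 : (K : ℝ≥0∞) ≠ 0 := by simp [hK.ne']
      rw [mul_comm 2 (K : ℝ≥0∞), div_eq_mul_inv, div_eq_mul_inv,
        ENNReal.mul_inv (Or.inl hK0) (Or.inl ENNReal.coe_ne_top)]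
      calc K * (t * ((K : ℝ≥0∞)⁻¹ * 2⁻¹)) = (K * (K : ℝ≥0∞)⁻¹) * (t * 2⁻¹) := by ring
        _ = _ := by rw [ENNReal.mul_inv_cancel hK0 ENNReal.coe_ne_top, one_mul]
  have hm₁ : Measurable (U f₁) := (Lp.stronglyMeasurable _).measurable
  have hsub : {x | t < sharpFn μ b (U f) x} ⊆ {x | t / 2 < sharpFn μ b (U f₁) x} := by
    intro x hx
    obtain ⟨z, s, ⟨hs, hsb, hxz⟩, hlt⟩ := lt_ballSup_iff.1 hx
    refine lt_of_lt_of_le ?_ (le_ballSup (Φ := ballOsc μ (U f₁)) hs hsb hxz)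
    by_contra! hcon
    rw [ballOsc_congr hUsum] at hlt
    have h1 := hlt.trans_le (ballOsc_add_le hm₁ z s)
    have h2 : ballOsc μ (U f₁) z s + ballOsc μ (U f₂) z s ≤ t / 2 + t / 2 :=
      add_le_add hcon (hosc₂ z s hs hsb)
    rw [ENNReal.add_halves] at h2
    exact absurd h2 (not_le.2 h1)
  have hw := sharpFn_weak_type_two hpos hD hm₁ (t / 2)
  have h4 : t ^ 2 = 4 * (t / 2) ^ 2 := by
    have : t = 2 * (t / 2) := (ENNReal.mul_div_cancel (by norm_num) (by norm_num)).symm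
    calc t ^ 2 = (2 * (t / 2)) ^ 2 := by rw [← this]
      _ = _ := by ring
  have hf₁ : eLpNorm f₁ 2 μ ^ 2 = ∫⁻ x in S, ‖f x‖ₑ ^ 2 ∂μ := by
    rw [← lintegral_enorm_sq_eq, ← lintegral_indicator hSm]
    refine lintegral_congr_ae ?_
    filter_upwards [h₁.coeFn_toLp] with x hx
    rw [hx]
    by_cases hxS : x ∈ S <;> simp [hxS]
  calc t ^ 2 * μ {x | t < sharpFn μ b (U f) x}
      ≤ 4 * ((t / 2) ^ 2 * μ {x | t / 2 < sharpFn μ b (U f₁) x}) := by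
        rw [h4, mul_assoc]; gcongr
    _ ≤ 4 * (4 * D ^ 3 * eLpNorm (U f₁) 2 μ ^ 2) := by
        rw [lintegral_enorm_sq_eq] at hw; gcongr
    _ ≤ 4 * (4 * D ^ 3 * (K * eLpNorm f₁ 2 μ) ^ 2) := by grw [hU.eLpNorm_le f₁]
    _ = 16 * D ^ 3 * K ^ 2 * eLpNorm f₁ 2 μ ^ 2 := by ring
    _ = _ := by rw [hf₁]

/-- The preceding bound is integrated against `t ^ (p - 3)`; the right-hand side is the layer-cake
formula for the measure with density `|f|²`. The minorant `G` is there because the formula needs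
finite values and the sharp function of `U f` may be infinite. -/
theorem OscBounded.lintegral_rpow_le [IsFiniteMeasure μ]
    (hpos : ∀ (z : M) (s : ℝ), 0 < s → 0 < μ (ball z s)) {D : ℝ≥0} {b : ℝ}
    (hD : DoublingUpTo μ (4 * b) D) {U : Lp ℂ 2 μ →L[ℂ] Lp ℂ 2 μ} {K : ℝ≥0} (hK : 0 < K)
    (hU : OscBounded U b K) (f : Lp ℂ 2 μ) {G : M → ℝ≥0∞} (hG : Measurable G)
    (hfin : ∀ x, G x ≠ ∞) (hGU : ∀ x, G x ≤ sharpFn μ b (U f) x) {p : ℝ} (hp : 2 < p) :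
    ∫⁻ x, G x ^ p ∂μ ≤ ENNReal.ofReal p * (ENNReal.ofReal (p - 2))⁻¹ *
      (16 * D ^ 3 * 2 ^ (p - 2)) * (K : ℝ≥0∞) ^ p * ∫⁻ x, ‖f x‖ₑ ^ p ∂μ := by
  have hfm : Measurable f := (Lp.stronglyMeasurable f).measurable
  set ν := μ.withDensity fun x => ‖f x‖ₑ ^ 2 with hν
  have hlc := lintegral_rpow_eq_lintegral_meas_lt (μ := ν) (F := fun x => 2 * K * ‖f x‖ₑ)
    (hfm.enorm.const_mul _) (fun x => by finiteness) (p := p - 2) (by linarith)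
  have hlc' : ∫⁻ t in Ioi (0 : ℝ), ν {x | ENNReal.ofReal t < 2 * K * ‖f x‖ₑ} *
      ENNReal.ofReal (t ^ (p - 2 - 1)) =
      (ENNReal.ofReal (p - 2))⁻¹ * ((2 * K) ^ (p - 2) * ∫⁻ x, ‖f x‖ₑ ^ p ∂μ) := by
    have h1 : ∫⁻ x, (2 * K * ‖f x‖ₑ) ^ (p - 2) ∂ν = (2 * K) ^ (p - 2) * ∫⁻ x, ‖f x‖ₑ ^ p ∂μ := by
      rw [hν, lintegral_withDensity_eq_lintegral_mul _ (hfm.enorm.pow_const 2)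
        ((hfm.enorm.const_mul _).pow_const _), ← lintegral_const_mul _ (hfm.enorm.pow_const _)]
      refine lintegral_congr fun x => ?_
      rw [Pi.mul_apply, ENNReal.mul_rpow_of_nonneg _ _ (by linarith)]
      have : ‖f x‖ₑ ^ p = ‖f x‖ₑ ^ 2 * ‖f x‖ₑ ^ (p - 2) := by
        rw [← ENNReal.rpow_ofNat, ← ENNReal.rpow_add_of_nonneg _ _ (by norm_num) (by linarith)]
        congr 1
        norm_num
      rw [this]
      ring
    rw [← h1, hlc, ← mul_assoc, ENNReal.inv_mul_cancel (by simpa using hp) ENNReal.ofReal_ne_top,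
      one_mul]
  rw [lintegral_rpow_eq_lintegral_meas_lt hG hfin (by linarith)]
  calc _ ≤ ENNReal.ofReal p * ∫⁻ t in Ioi (0 : ℝ), 16 * D ^ 3 * K ^ 2 *
        (ν {x | ENNReal.ofReal t < 2 * K * ‖f x‖ₑ} * ENNReal.ofReal (t ^ (p - 2 - 1))) := by
        refine mul_le_mul' le_rfl (setLIntegral_mono' (measurableSet_Ioi (a := (0 : ℝ)))
          fun t ht => ?_)
        have ht' : 0 < t := ht
        have h1 := hU.meas_sharpFn_le hpos hD hK f (ENNReal.ofReal_ne_top (r := t))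
        have hSm : MeasurableSet {x | ENNReal.ofReal t < 2 * K * ‖f x‖ₑ} :=
          measurableSet_lt measurable_const (hfm.enorm.const_mul _)
        have h2 : ENNReal.ofReal (t ^ (p - 1)) =
            ENNReal.ofReal t ^ 2 * ENNReal.ofReal (t ^ (p - 2 - 1)) := by
          rw [← ENNReal.ofReal_pow ht'.le, ← ENNReal.ofReal_mul (by positivity),
            ← Real.rpow_natCast t 2, ← Real.rpow_add ht']
          congr 2
          push_cast
          ring
        have h3 : μ {x | ENNReal.ofReal t < G x} ≤ μ {x | ENNReal.ofReal t < sharpFn μ b (U f) x} :=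
          measure_mono fun x (hx : ENNReal.ofReal t < G x) => hx.trans_le (hGU x)
        rw [hν, withDensity_apply _ hSm, h2]
        calc _ = (ENNReal.ofReal t ^ 2 * μ {x | ENNReal.ofReal t < G x}) *
              ENNReal.ofReal (t ^ (p - 2 - 1)) := by ring
          _ ≤ _ := by
            rw [← mul_assoc]
            refine mul_le_mul' (le_trans ?_ h1) le_rfl
            gcongr
    _ = ENNReal.ofReal p * (16 * D ^ 3 * K ^ 2 *
          ((ENNReal.ofReal (p - 2))⁻¹ * ((2 * K) ^ (p - 2) * ∫⁻ x, ‖f x‖ₑ ^ p ∂μ))) := by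
        rw [lintegral_const_mul' _ _ (by finiteness), hlc']
    _ = _ := by
        have : (K : ℝ≥0∞) ^ p = (K : ℝ≥0∞) ^ 2 * (K : ℝ≥0∞) ^ (p - 2) := by
          rw [← ENNReal.rpow_ofNat, ← ENNReal.rpow_add_of_nonneg _ _ (by norm_num) (by linarith)]
          congr 1
          norm_num
        rw [this, ENNReal.mul_rpow_of_nonneg _ _ (by linarith)]
        ring

theorem eLpNorm_rpow_toReal {E : Type*} [NormedAddCommGroup E] (f : M → E) {p : ℝ≥0∞} (h0 : p ≠ 0)
    (ht : p ≠ ∞) : eLpNorm f p μ ^ p.toReal = ∫⁻ x, ‖f x‖ₑ ^ p.toReal ∂μ := by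
  rw [eLpNorm_eq_lintegral_rpow_enorm_toReal h0 ht, ← ENNReal.rpow_mul, one_div,
    inv_mul_cancel₀ (ENNReal.toReal_pos h0 ht).ne', ENNReal.rpow_one]

/-- Interpolation between `L²` and `L^∞ → BMO`. -/
theorem exists_eLpNorm_le_of_oscBounded [IsFiniteMeasure μ] (hμ : 0 < μ univ)
    (hLD : LocallyDoubling μ) (hI : ComplementaryIsoperimetric μ) {b : ℝ} (hb : 0 < b) {p : ℝ≥0∞}
    (hp : 2 ≤ p) (hp' : p < ∞) :
    ∃ C : ℝ≥0, ∀ (U : Lp ℂ 2 μ →L[ℂ] Lp ℂ 2 μ) (K : ℝ≥0), OscBounded U b K →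
      ∀ f : Lp ℂ 2 μ, eLpNorm (U f) p μ ≤ C * K * eLpNorm f p μ := by
  rcases hp.eq_or_lt with rfl | hp2
  · exact ⟨1, fun U K hU f => by simpa using hU.eLpNorm_le f⟩
  have hpos : ∀ (z : M) (s : ℝ), 0 < s → 0 < μ (ball z s) :=
    fun z s hs => hLD.measure_ball_pos hμ z hs
  obtain ⟨D, hD⟩ := hLD.exists_doublingUpTo (R := 4 * b) (by positivity)
  have hp0 : p ≠ 0 := (zero_lt_two.trans hp2).ne'
  set P := p.toReal with hP
  have hP2 : 2 < P := by
    have := (ENNReal.toReal_lt_toReal (by simp) hp'.ne).2 hp2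
    simpa using this
  have hP0 : 0 < P := by linarith
  obtain ⟨C₁, hC₁, hsharp⟩ := exists_lintegral_rpow_le_sharpFn hμ hLD hI (ρ := b / 16)
    (by positivity) hP0
  have hb16 : 16 * (b / 16) = b := by ring
  rw [hb16] at hsharp
  set C₂ : ℝ≥0∞ := ENNReal.ofReal P * (ENNReal.ofReal (P - 2))⁻¹ *
      (16 * D ^ 3 * 2 ^ (P - 2)) with hC₂
  have hC₂t : C₂ ≠ ∞ := by
    have h1 : (ENNReal.ofReal (P - 2))⁻¹ ≠ ∞ := by simpa using hP2
    have h2 : (2 : ℝ≥0∞) ^ (P - 2) ≠ ∞ := ENNReal.rpow_ne_top_of_nonneg (by linarith) (by simp)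
    finiteness
  set m₁ : ℝ≥0∞ := μ univ ^ (1 / (1 : ℝ≥0∞).toReal - 1 / (2 : ℝ≥0∞).toReal) with hm₁
  set m₂ : ℝ≥0∞ := μ univ ^ (1 / (2 : ℝ≥0∞).toReal - 1 / p.toReal) with hm₂
  have hm₁t : m₁ ≠ ∞ := ENNReal.rpow_ne_top_of_nonneg (by norm_num) (measure_ne_top _ _)
  have hm₂t : m₂ ≠ ∞ := by
    refine ENNReal.rpow_ne_top_of_nonneg ?_ (measure_ne_top _ _)
    rw [← hP, sub_nonneg]
    simpa using one_div_le_one_div_of_le two_pos hP2.le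
  set C₃ : ℝ≥0∞ := C₁ * (C₂ + (m₁ * m₂) ^ P) with hC₃
  have hC₃t : C₃ ≠ ∞ := by
    have : (m₁ * m₂) ^ P ≠ ∞ := ENNReal.rpow_ne_top_of_nonneg hP0.le (ENNReal.mul_ne_top hm₁t hm₂t)
    finiteness
  have hC₄ : C₃ ^ P⁻¹ ≠ ∞ := ENNReal.rpow_ne_top_of_nonneg (by positivity) hC₃t
  refine ⟨(C₃ ^ P⁻¹).toNNReal, fun U K hU f => ?_⟩
  -- The cut at height `t / (2 * K)` needs `K > 0`; for `K = 0` the image vanishes.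
  rcases eq_zero_or_pos K with rfl | hK
  · have h0 := hU.eLpNorm_le f
    rw [ENNReal.coe_zero, zero_mul, nonpos_iff_eq_zero,
      eLpNorm_eq_zero_iff (Lp.aestronglyMeasurable _) two_ne_zero] at h0
    rw [eLpNorm_congr_ae h0, eLpNorm_zero]
    exact zero_le
  rw [ENNReal.coe_toNNReal hC₄]
  set h : M → ℂ := ⇑(U f) with hh
  have hhm : Measurable h := (Lp.stronglyMeasurable _).measurable
  set I := ∫⁻ x, ‖f x‖ₑ ^ P ∂μ with hIdef
  have hI' : eLpNorm f p μ ^ P = I := eLpNorm_rpow_toReal _ hp0 hp'.ne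
  have hL1 : ∫⁻ x, ‖h x‖ₑ ∂μ ≤ K * (m₁ * m₂) * eLpNorm f p μ := by
    rw [← eLpNorm_one_eq_lintegral_enorm]
    calc eLpNorm h 1 μ ≤ eLpNorm h 2 μ * m₁ :=
          eLpNorm_le_eLpNorm_mul_rpow_measure_univ (by norm_num) (Lp.aestronglyMeasurable _)
      _ ≤ (K * eLpNorm f 2 μ) * m₁ := by gcongr; exact hU.eLpNorm_le f
      _ ≤ (K * (eLpNorm f p μ * m₂)) * m₁ := by
          gcongr
          exact eLpNorm_le_eLpNorm_mul_rpow_measure_univ hp (Lp.aestronglyMeasurable _)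
      _ = _ := by ring
  -- The sharp inequality wants a bounded real function. The map `w ↦ min ‖w‖ N` is 1-Lipschitz, so
  -- oscillations do not grow; Fatou's lemma then removes `N`.
  have hN : ∀ N : ℕ, ∫⁻ x, ‖min ‖h x‖ (N : ℝ)‖ₑ ^ P ∂μ ≤ C₃ * ((K : ℝ≥0∞) ^ P * I) := by
    intro N
    set g : M → ℝ := fun x => min ‖h x‖ N with hg
    have hgm : Measurable g := hhm.norm.min measurable_const
    have hg0 : ∀ x, 0 ≤ g x := fun x => le_min (norm_nonneg _) (Nat.cast_nonneg _)
    have hgN : ∀ x, ‖g x‖ₑ ≤ (N : ℝ≥0) := fun x => by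
      rw [enorm_le_coe, ← NNReal.coe_le_coe, coe_nnnorm, Real.norm_of_nonneg (hg0 x)]
      exact min_le_right ‖h x‖ (N : ℝ)
    have hgh : ∀ x, ‖g x‖ₑ ≤ ‖h x‖ₑ := fun x => by
      rw [enorm_le_iff_norm_le, Real.norm_of_nonneg (hg0 x)]
      exact min_le_left _ _
    have hlip : ∀ x y, ‖g x - g y‖ₑ ≤ ‖h x - h y‖ₑ := fun x y => by
      rw [enorm_le_iff_norm_le, Real.norm_eq_abs]
      refine (abs_min_sub_min_le_max _ _ _ _).trans ?_
      rw [sub_self, abs_zero, max_eq_left (abs_nonneg _)]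
      exact abs_norm_sub_norm_le _ _
    refine (hsharp g hgm ⟨N, hgN⟩).trans ?_
    have h1 := hU.lintegral_rpow_le hpos hD hK f (measurable_ballSup b (ballOsc μ g))
      (fun x => ne_top_of_le_ne_top (by finiteness) (sharpFn_le_of_le hpos hgN b x))
      (fun x => sharpFn_mono hlip b x) hP2
    have h2 : ∫⁻ x, ‖g x‖ₑ ∂μ ≤ K * (m₁ * m₂) * eLpNorm f p μ :=
      (lintegral_mono hgh).trans hL1
    calc _ ≤ C₁ * (C₂ * (K : ℝ≥0∞) ^ P * I + (K * (m₁ * m₂) * eLpNorm f p μ) ^ P) := by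
          gcongr
          exact h1
      _ = _ := by
          rw [ENNReal.mul_rpow_of_nonneg _ _ hP0.le, ENNReal.mul_rpow_of_nonneg _ _ hP0.le, hI', hC₃]
          ring
  have hlim : ∫⁻ x, ‖h x‖ₑ ^ P ∂μ ≤ C₃ * ((K : ℝ≥0∞) ^ P * I) := by
    have hle : ∀ x, ‖h x‖ₑ ^ P ≤ liminf (fun N : ℕ => ‖min ‖h x‖ (N : ℝ)‖ₑ ^ P) atTop := by
      intro x
      refine le_liminf_of_le (by isBoundedDefault) ?_
      obtain ⟨N₀, hN₀⟩ := exists_nat_ge ‖h x‖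
      filter_upwards [eventually_ge_atTop N₀] with N hN
      have : (N₀ : ℝ) ≤ N := by exact_mod_cast hN
      rw [min_eq_left (by linarith), enorm_norm]
    refine (lintegral_mono hle).trans ((lintegral_liminf_le fun N => ?_).trans ?_)
    · exact ((hhm.norm.min measurable_const).enorm).pow_const _
    · exact liminf_le_of_le (by isBoundedDefault)
        fun b hb => by
          obtain ⟨N, hN'⟩ := hb.exists
          exact hN'.trans (hN N)
  have hfin : eLpNorm h p μ ^ P ≤ (C₃ ^ P⁻¹ * K * eLpNorm f p μ) ^ P := by
    rw [eLpNorm_rpow_toReal _ hp0 hp'.ne, ENNReal.mul_rpow_of_nonneg _ _ hP0.le,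
      ENNReal.mul_rpow_of_nonneg _ _ hP0.le, hI', ENNReal.rpow_inv_rpow hP0.ne', mul_assoc]
    exact hlim
  exact (ENNReal.rpow_le_rpow_iff hP0).1 hfin

/-! ### Change of scale for mean oscillation -/

/-- The `L^q`-mean oscillation of `h` over the balls of radius at most `c` is at most `A`. -/
def OscLe (μ : Measure M) (q : ℝ≥0∞) (c : ℝ) (A : ℝ≥0∞) (h : M → ℂ) : Prop :=
  ∀ (z : M) (s : ℝ), 0 < s → s ≤ c →
    ∃ α : ℂ, eLpNorm (fun x => h x - α) q (ballMeasure μ z s) ≤ A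

theorem eLpNorm_ballMeasure_le [IsFiniteMeasure μ]
    (hpos : ∀ (z : M) (s : ℝ), 0 < s → 0 < μ (ball z s)) {q : ℝ≥0∞} (hq : 1 ≤ q) (f : M → ℂ)
    {x y : M} {r s : ℝ} (hr : 0 < r) (hsub : ball x r ⊆ ball y s) {E : ℝ≥0} (hE : 1 ≤ E)
    (hle : μ (ball y s) ≤ E * μ (ball x r)) :
    eLpNorm f q (ballMeasure μ x r) ≤ E * eLpNorm f q (ballMeasure μ y s) := by
  have hx := (hpos x r hr).ne'
  have hy : μ (ball y s) ≠ 0 := ((hpos x r hr).trans_le (measure_mono hsub)).ne'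
  have hmeas : ballMeasure μ x r ≤ (E : ℝ≥0∞) • ballMeasure μ y s := by
    rw [ballMeasure, ballMeasure, smul_smul]
    have h1 : (μ (ball x r))⁻¹ ≤ E * (μ (ball y s))⁻¹ := by
      rw [← div_eq_mul_inv, ENNReal.le_div_iff_mul_le (Or.inl hy) (Or.inl (measure_ne_top _ _)),
        mul_comm, ← div_eq_mul_inv]
      exact ENNReal.div_le_of_le_mul hle
    refine Measure.le_iff.2 fun t _ => ?_
    simp only [Measure.smul_apply, smul_eq_mul]
    gcongr
  refine (eLpNorm_mono_measure f hmeas).trans ?_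
  have hE0 : (E : ℝ≥0∞) ≠ 0 := by exact_mod_cast (zero_lt_one.trans_le hE).ne'
  rw [eLpNorm_smul_measure_of_ne_zero hE0, smul_eq_mul]
  gcongr
  calc (E : ℝ≥0∞) ^ (1 / q).toReal ≤ (E : ℝ≥0∞) ^ (1 : ℝ) := by
        refine ENNReal.rpow_le_rpow_of_exponent_le (by exact_mod_cast hE) ?_
        refine ENNReal.toReal_le_of_le_ofReal zero_le_one ?_
        rw [ENNReal.ofReal_one, one_div]
        exact ENNReal.inv_le_one.2 hq
    _ = E := ENNReal.rpow_one _

theorem eLpNorm_ballMeasure_rpow {q : ℝ≥0∞} (h0 : q ≠ 0) (ht : q ≠ ∞) (f : M → ℂ) (z : M) (s : ℝ) :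
    eLpNorm f q (ballMeasure μ z s) ^ q.toReal =
      (μ (ball z s))⁻¹ * ∫⁻ x in ball z s, ‖f x‖ₑ ^ q.toReal ∂μ := by
  rw [eLpNorm_rpow_toReal f h0 ht, lintegral_smul_measure, smul_eq_mul]

theorem enorm_sub_le_eLpNorm_add [IsFiniteMeasure μ] {q : ℝ≥0∞} (hq : 1 ≤ q) {h : M → ℂ}
    (hh : AEStronglyMeasurable h μ) {z : M} {s : ℝ} (hz : 0 < μ (ball z s)) (α α' : ℂ) :
    ‖α - α'‖ₑ ≤ eLpNorm (fun x => h x - α) q (ballMeasure μ z s) +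
      eLpNorm (fun x => h x - α') q (ballMeasure μ z s) := by
  have := isProbabilityMeasure_ballMeasure hz
  have hh' := hh.mono_ac (ballMeasure_absolutelyContinuous z s)
  have h1 : ‖α - α'‖ₑ = eLpNorm (fun _ : M => α - α') q (ballMeasure μ z s) := by
    rw [eLpNorm_const _ (zero_lt_one.trans_le hq).ne' (IsProbabilityMeasure.ne_zero _)]
    simp
  have h2 : (fun _ : M => α - α') = (fun x => h x - α') - fun x => h x - α := by
    ext x; simp
  rw [h1, h2, add_comm]
  exact eLpNorm_sub_le (hh'.sub aestronglyMeasurable_const) (hh'.sub aestronglyMeasurable_const) hq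

theorem eLpNorm_sub_const_le [IsFiniteMeasure μ] {q : ℝ≥0∞} (hq : 1 ≤ q) {h : M → ℂ}
    (hh : AEStronglyMeasurable h μ) {z : M} {s : ℝ} (hz : 0 < μ (ball z s)) (α α' : ℂ) :
    eLpNorm (fun x => h x - α') q (ballMeasure μ z s) ≤
      eLpNorm (fun x => h x - α) q (ballMeasure μ z s) + ‖α - α'‖ₑ := by
  have := isProbabilityMeasure_ballMeasure hz
  have hh' := hh.mono_ac (ballMeasure_absolutelyContinuous z s)
  have h1 : ‖α - α'‖ₑ = eLpNorm (fun _ : M => α - α') q (ballMeasure μ z s) := by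
    rw [eLpNorm_const _ (zero_lt_one.trans_le hq).ne' (IsProbabilityMeasure.ne_zero _)]
    simp
  have h2 : (fun x => h x - α') = (fun x => h x - α) + fun _ : M => α - α' := by
    ext x; simp
  rw [h1, h2]
  exact eLpNorm_add_le (hh'.sub aestronglyMeasurable_const) aestronglyMeasurable_const hq

/-- One enlargement of the scale, by the factor `(1 + β) / (2 * β) > 1`. In a ball about `z`, the
approximate constants `a x` and `a z` on small balls about `x` and `z` are compared through a ball
of radius `b` about an approximate midpoint that contains both. Covering the large ball by small
ones gives the `L^q` estimate. -/
theorem OscLe.exists_enlarge [IsFiniteMeasure μ] (hμ : 0 < μ univ) (hLD : LocallyDoubling μ)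
    {R₀ β : ℝ} (hAM : ApproximateMidpoint M R₀ β) {b : ℝ} (hb : R₀ / (1 - β) < b) {q : ℝ≥0∞}
    (hq : 1 ≤ q) (hq' : q < ∞) :
    ∃ C : ℝ≥0, ∀ (h : M → ℂ) (A : ℝ≥0∞), AEStronglyMeasurable h μ → OscLe μ q b A h →
      OscLe μ q ((1 + β) / (2 * β) * b) (C * A) h := by
  obtain ⟨hR₀, hβ, hβ1, hmid⟩ := hAM
  have hpos : ∀ (z : M) (s : ℝ), 0 < s → 0 < μ (ball z s) :=
    fun z s hs => hLD.measure_ball_pos hμ z hs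
  have hβ' : 0 < 1 - β := by linarith
  have hbR : R₀ < (1 - β) * b := by rwa [div_lt_iff₀' hβ'] at hb
  have hb0 : 0 < b := by
    by_contra! hcon
    have := mul_nonpos_of_nonneg_of_nonpos hβ'.le hcon
    linarith
  -- With this `δ`, points closer than the enlarged scale have a midpoint within `b - δ` of each,
  -- leaving room for balls of radius `δ`. The condition on `b` gives `R₀ + δ ≤ b`, so points at
  -- distance at most `R₀` need no midpoint.
  set δ := (1 - β) * b / 2 with hδ
  have hδ0 : 0 < δ := by positivity
  have hδb : R₀ + δ ≤ b := by nlinarith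
  have hγ : β * ((1 + β) / (2 * β) * b) = b - δ := by
    rw [hδ]; field_simp; ring
  obtain ⟨n, hn⟩ := pow_unbounded_of_one_lt (2 * b / δ) (one_lt_two (α := ℝ))
  rw [div_lt_iff₀ hδ0] at hn
  obtain ⟨D, hD⟩ := hLD.exists_doublingUpTo
    (R := max (2 ^ n * δ) (8 * ((1 + β) / (2 * β) * b) + 8 * δ))
    (lt_max_of_lt_left (by positivity))
  have hR1 := le_max_left (2 ^ n * δ) (8 * ((1 + β) / (2 * β) * b) + 8 * δ)
  have hR2 := le_max_right (2 ^ n * δ) (8 * ((1 + β) / (2 * β) * b) + 8 * δ)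
  set R := max (2 ^ n * δ) (8 * ((1 + β) / (2 * β) * b) + 8 * δ)
  have hR0 : 0 < 2 ^ n * δ := by positivity
  have hE : ∀ x y, ball x δ ⊆ ball y b → dist y x < b →
      μ (ball y b) ≤ ((D ^ n : ℝ≥0) : ℝ≥0∞) * μ (ball x δ) := by
    intro x y _ hxy
    rw [ENNReal.coe_pow]
    exact hD.measure_ball_le n hδ0 (by linarith) (by linarith)
  have hD1 : 1 ≤ D ^ n := one_le_pow₀ hD.1
  refine ⟨D ^ 4 * (3 + 2 * D ^ n), fun h A hh hosc z s hs hsγ => ?_⟩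
  have hC1 : (1 : ℝ≥0∞) ≤ (D ^ 4 * (3 + 2 * D ^ n) : ℝ≥0) := by
    have : (1 : ℝ≥0) ≤ D ^ 4 * (3 + 2 * D ^ n) :=
      one_le_mul (one_le_pow₀ hD.1) (le_add_of_le_left (by norm_num))
    exact_mod_cast this
  rcases le_or_gt s b with hsb | hsb
  · obtain ⟨α, hα⟩ := hosc z s hs hsb
    refine ⟨α, hα.trans ?_⟩
    calc A = 1 * A := (one_mul A).symm
      _ ≤ _ := by gcongr
  choose a ha using fun x => hosc x δ hδ0 (by linarith)
  have hcmp : ∀ x y, dist x y + δ ≤ b → ∀ α, eLpNorm (fun u => h u - α) q (ballMeasure μ y b) ≤ A →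
      ‖a x - α‖ₑ ≤ (1 + D ^ n) * A := by
    intro x y hxy α hα
    have hsub : ball x δ ⊆ ball y b := ball_subset_ball' (by linarith)
    refine (enorm_sub_le_eLpNorm_add hq hh (hpos x δ hδ0) (a x) α).trans ?_
    have h1 := eLpNorm_ballMeasure_le hpos hq (fun u => h u - α) hδ0 hsub hD1
      (hE x y hsub (by rw [dist_comm]; linarith))
    rw [ENNReal.coe_pow] at h1
    calc _ ≤ A + D ^ n * A := add_le_add (ha x) (h1.trans (by gcongr))
      _ = _ := by ring
  have hchain : ∀ x ∈ ball z s, ‖a x - a z‖ₑ ≤ 2 * (1 + D ^ n) * A := by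
    intro x hx
    rw [mem_ball] at hx
    obtain ⟨m, hm1, hm2⟩ : ∃ m, dist x m + δ ≤ b ∧ dist z m + δ ≤ b := by
      rcases le_or_gt (dist x z) R₀ with h1 | h1
      · exact ⟨z, by linarith, by rw [dist_self]; linarith⟩
      · obtain ⟨m, h2, h3⟩ := hmid x z h1
        have h4 : β * dist x z ≤ b - δ := by rw [← hγ]; gcongr; linarith
        exact ⟨m, by linarith, by linarith⟩
    obtain ⟨α, hα⟩ := hosc m b hb0 le_rfl
    have h1 := hcmp x m hm1 α hα
    have h2 := hcmp z m hm2 α hα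
    calc ‖a x - a z‖ₑ = ‖(a x - α) - (a z - α)‖ₑ := by congr 1; ring
      _ ≤ ‖a x - α‖ₑ + ‖a z - α‖ₑ := enorm_sub_le
      _ ≤ (1 + D ^ n) * A + (1 + D ^ n) * A := add_le_add h1 h2
      _ = _ := by ring
  set Q : ℝ≥0∞ := (3 + 2 * D ^ n) * A with hQ
  have hloc : ∀ x ∈ ball z s, eLpNorm (fun u => h u - a z) q (ballMeasure μ x δ) ≤ Q := by
    intro x hx
    refine (eLpNorm_sub_const_le hq hh (hpos x δ hδ0) (a x) (a z)).trans ?_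
    calc _ ≤ A + 2 * (1 + D ^ n) * A := add_le_add (ha x) (hchain x hx)
      _ = _ := by rw [hQ]; ring
  have hq0 : q ≠ 0 := (zero_lt_one.trans_le hq).ne'
  have hqp : 0 < q.toReal := ENNReal.toReal_pos hq0 hq'.ne
  have hq1 : 1 ≤ q.toReal := by
    have := (ENNReal.toReal_le_toReal (by simp) hq'.ne).2 hq
    simpa using this
  have hlocI : ∀ x ∈ ball z s,
      ∫⁻ u in ball x δ, ‖h u - a z‖ₑ ^ q.toReal ∂μ ≤ Q ^ q.toReal * μ (ball x δ) := by
    intro x hx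
    have h1 := ENNReal.rpow_le_rpow (hloc x hx) hqp.le
    rw [eLpNorm_ballMeasure_rpow hq0 hq'.ne, mul_comm, ← div_eq_mul_inv] at h1
    exact (ENNReal.div_le_iff (hpos x δ hδ0).ne' (measure_ne_top _ _)).1 h1
  obtain ⟨u, huB, hu, hd, hc⟩ := exists_vitali_covering hpos (ball z s) id (fun _ => δ / 6) (δ / 6)
    (fun _ _ => ⟨by positivity, le_rfl⟩)
  have := hu.to_subtype
  have hmeas : ∑' x : u, μ (ball x.1 δ) ≤ D ^ 4 * μ (ball z s) := by
    calc _ ≤ ∑' x : u, (D : ℝ≥0∞) ^ 3 * μ (ball x.1 (δ / 6)) :=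
          ENNReal.tsum_le_tsum fun x => hD.measure_ball_le 3 (by positivity)
            (by linarith) (by rw [dist_self]; linarith)
      _ = D ^ 3 * μ (⋃ x ∈ u, ball x (δ / 6)) := by
          rw [ENNReal.tsum_mul_left]
          congr 1
          exact (measure_biUnion hu hd (fun _ _ => measurableSet_ball)).symm
      _ ≤ D ^ 3 * μ (ball z (2 * s)) := by
          gcongr
          refine iUnion₂_subset fun x hx => ball_subset_ball' ?_
          have := mem_ball.1 (huB hx)
          linarith
      _ ≤ D ^ 3 * (D * μ (ball z s)) := by
          gcongr
          exact hD.2 z s hs (by linarith)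
      _ = _ := by ring
  have hcov : ball z s ⊆ ⋃ x ∈ u, ball x δ := by
    intro x hx
    obtain ⟨y, hy, hxy⟩ := hc x hx
    refine mem_biUnion hy ?_
    have := hxy (mem_ball_self (by positivity))
    rwa [mul_div_cancel₀ _ (by norm_num : (6 : ℝ) ≠ 0)] at this
  have hI : ∫⁻ x in ball z s, ‖h x - a z‖ₑ ^ q.toReal ∂μ ≤
      Q ^ q.toReal * (D ^ 4 * μ (ball z s)) := by
    calc _ ≤ ∫⁻ x in ⋃ x ∈ u, ball x δ, ‖h x - a z‖ₑ ^ q.toReal ∂μ := lintegral_mono_set hcov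
      _ = ∫⁻ x in ⋃ y : u, ball y.1 δ, ‖h x - a z‖ₑ ^ q.toReal ∂μ := by rw [biUnion_eq_iUnion]
      _ ≤ ∑' x : u, ∫⁻ w in ball x.1 δ, ‖h w - a z‖ₑ ^ q.toReal ∂μ := lintegral_iUnion_le _ _
      _ ≤ ∑' x : u, Q ^ q.toReal * μ (ball x.1 δ) :=
          ENNReal.tsum_le_tsum fun x => hlocI x (huB x.2)
      _ = Q ^ q.toReal * ∑' x : u, μ (ball x.1 δ) := ENNReal.tsum_mul_left
      _ ≤ _ := by gcongr
  refine ⟨a z, (ENNReal.rpow_le_rpow_iff hqp).1 ?_⟩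
  rw [eLpNorm_ballMeasure_rpow hq0 hq'.ne]
  calc _ ≤ (μ (ball z s))⁻¹ * (Q ^ q.toReal * (D ^ 4 * μ (ball z s))) := by gcongr
    _ = (μ (ball z s))⁻¹ * (μ (ball z s) * (D ^ 4 * Q ^ q.toReal)) := by ring
    _ = D ^ 4 * Q ^ q.toReal :=
        ENNReal.inv_mul_cancel_left (hpos z s hs).ne' (measure_ne_top _ _)
    _ ≤ (D ^ 4 : ℝ≥0∞) ^ q.toReal * Q ^ q.toReal := by
        gcongr
        have h1 : (1 : ℝ≥0∞) ≤ D ^ 4 := by exact_mod_cast one_le_pow₀ hD.1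
        calc (D : ℝ≥0∞) ^ 4 = ((D : ℝ≥0∞) ^ 4) ^ (1 : ℝ) := (ENNReal.rpow_one _).symm
          _ ≤ _ := ENNReal.rpow_le_rpow_of_exponent_le h1 hq1
    _ = _ := by
        rw [← ENNReal.mul_rpow_of_nonneg _ _ hqp.le, hQ]
        congr 1
        push_cast
        ring

/-- The enlargement factor depends on `β` alone and the lower bound on the scale persists, so
iteration reaches every `c`. -/
theorem OscLe.exists_scale [IsFiniteMeasure μ] (hμ : 0 < μ univ) (hLD : LocallyDoubling μ)
    {R₀ β : ℝ} (hAM : ApproximateMidpoint M R₀ β) {b : ℝ} (hb : R₀ / (1 - β) < b) (c : ℝ) {q : ℝ≥0∞}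
    (hq : 1 ≤ q) (hq' : q < ∞) :
    ∃ C : ℝ≥0, ∀ (h : M → ℂ) (A : ℝ≥0∞), AEStronglyMeasurable h μ → OscLe μ q b A h →
      OscLe μ q c (C * A) h := by
  have hβ0 : 0 < β := by linarith [hAM.2.1]
  have hβ1 : 0 < 1 - β := by linarith [hAM.2.2.1]
  have hb0 : 0 < b := (div_nonneg hAM.1 hβ1.le).trans_lt hb
  have hγ : 1 < (1 + β) / (2 * β) := by rw [one_lt_div (by positivity)]; linarith
  set γ := (1 + β) / (2 * β) with hγdef
  have hiter : ∀ n : ℕ, ∃ C : ℝ≥0, ∀ (h : M → ℂ) (A : ℝ≥0∞), AEStronglyMeasurable h μ →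
      OscLe μ q b A h → OscLe μ q (γ ^ n * b) (C * A) h := by
    intro n
    induction n with
    | zero => exact ⟨1, fun h A _ hA => by simpa using hA⟩
    | succ n ih =>
      obtain ⟨C, hC⟩ := ih
      have hbn : R₀ / (1 - β) < γ ^ n * b :=
        hb.trans_le (le_mul_of_one_le_left hb0.le (one_le_pow₀ hγ.le))
      obtain ⟨C', hC'⟩ := OscLe.exists_enlarge hμ hLD hAM hbn hq hq'
      refine ⟨C' * C, fun h A hh hA => ?_⟩
      have := hC' h _ hh (hC h A hh hA)
      rw [← mul_assoc, ← hγdef, ← mul_assoc, ← pow_succ'] at this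
      rwa [ENNReal.coe_mul]
  obtain ⟨n, hn⟩ := pow_unbounded_of_one_lt (c / b) hγ
  rw [div_lt_iff₀ hb0] at hn
  obtain ⟨C, hC⟩ := hiter n
  exact ⟨C, fun h A hh hA z s hs hsc => hC h A hh hA z s hs (by linarith)⟩

/-! ### Operators with regular kernels -/

/-- The functions `U f`, with `f` bounded and vanishing on `2B`, are nearly constant on `B`. -/
def OffDiagonalOsc (U : Lp ℂ 2 μ →L[ℂ] Lp ℂ 2 μ) (b : ℝ) (K : ℝ≥0) : Prop :=
  ∀ (f : Lp ℂ 2 μ) (m : ℝ≥0), (∀ᵐ x ∂μ, ‖f x‖ₑ ≤ m) → ∀ (z : M) (s : ℝ), 0 < s → s ≤ b →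
    (∀ᵐ x ∂μ, x ∈ ball z (2 * s) → f x = 0) →
      ∃ α : ℂ, ∀ᵐ x ∂μ, x ∈ ball z s → ‖U f x - α‖ₑ ≤ K * m

theorem OffDiagonalOsc.mono {U : Lp ℂ 2 μ →L[ℂ] Lp ℂ 2 μ} {b : ℝ} {K K' : ℝ≥0}
    (h : OffDiagonalOsc U b K) (hK : K ≤ K') : OffDiagonalOsc U b K' := by
  intro f m hm z s hs hsb hf
  obtain ⟨α, hα⟩ := h f m hm z s hs hsb hf
  refine ⟨α, hα.mono fun x hx hxB => (hx hxB).trans ?_⟩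
  gcongr

theorem ae_imp_of_ae_ballMeasure [IsFiniteMeasure μ] {z : M} {s : ℝ} {P : M → Prop}
    (h : ∀ᵐ x ∂μ, x ∈ ball z s → P x) : ∀ᵐ x ∂ballMeasure μ z s, P x :=
  Measure.ae_smul_measure ((ae_restrict_iff' measurableSet_ball).2 h) _

/-- The function is split along `2B`: the inner part is handled by the `L^q` bound and doubling, and
the image of the outer part is nearly constant on `B`. -/
theorem OffDiagonalOsc.oscLe [IsFiniteMeasure μ]
    (hpos : ∀ (z : M) (s : ℝ), 0 < s → 0 < μ (ball z s)) {D : ℝ≥0} {b : ℝ}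
    (hD : DoublingUpTo μ b D) {U : Lp ℂ 2 μ →L[ℂ] Lp ℂ 2 μ} {K N : ℝ≥0} (hU : OffDiagonalOsc U b K)
    {q : ℝ≥0∞} (hq : 1 ≤ q) (hN : ∀ f : Lp ℂ 2 μ, eLpNorm (U f) q μ ≤ N * eLpNorm f q μ)
    (hq' : q < ∞) (f : Lp ℂ 2 μ) (m : ℝ≥0) (hm : ∀ᵐ x ∂μ, ‖f x‖ₑ ≤ m) :
    OscLe μ q b ((K + D * N : ℝ≥0) * m) (U f) := by
  intro z s hs hsb
  have hB := hpos z s hs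
  have := isProbabilityMeasure_ballMeasure hB
  have hSm : MeasurableSet (ball z (2 * s)) := measurableSet_ball
  have h₁ : MemLp ((ball z (2 * s)).indicator f) 2 μ := (Lp.memLp f).indicator hSm
  have h₂ : MemLp ((ball z (2 * s))ᶜ.indicator f) 2 μ := (Lp.memLp f).indicator hSm.compl
  set f₁ := h₁.toLp _
  set f₂ := h₂.toLp _
  have hsum : f = f₁ + f₂ := by
    rw [← MemLp.toLp_add h₁ h₂]
    refine Lp.ext ?_
    refine EventuallyEq.symm ((MemLp.coeFn_toLp _).trans ?_)
    rw [indicator_self_add_compl]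
  have hUsum : U f =ᵐ[μ] U f₁ + U f₂ := by
    rw [hsum, map_add]
    exact Lp.coeFn_add _ _
  obtain ⟨α, hα⟩ := hU f₂ m (by
      filter_upwards [h₂.coeFn_toLp, hm] with x hx hxm
      rw [hx]
      by_cases hxS : x ∈ ball z (2 * s) <;> simp [hxS, hxm]) z s hs hsb (by
      filter_upwards [h₂.coeFn_toLp] with x hx hxS
      rw [hx]
      simp [hxS])
  refine ⟨α, ?_⟩
  have hac := ballMeasure_absolutelyContinuous (μ := μ) z s
  have hm₁ := (Lp.aestronglyMeasurable (U f₁)).mono_ac hac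
  have hm₂ := (Lp.aestronglyMeasurable (U f₂)).mono_ac hac
  have hcongr : (fun x => U f x - α) =ᵐ[ballMeasure μ z s] U f₁ + fun x => U f₂ x - α := by
    filter_upwards [hac.ae_le hUsum] with x hx
    rw [hx, Pi.add_apply, Pi.add_apply, add_sub_assoc]
  have hpart₂ : eLpNorm (fun x => U f₂ x - α) q (ballMeasure μ z s) ≤ K * m := by
    refine (eLpNorm_le_of_ae_enorm_bound (ae_imp_of_ae_ballMeasure hα)).trans ?_
    simp
  have hq0 : q ≠ 0 := (zero_lt_one.trans_le hq).ne'
  have hqp : 0 < q.toReal := ENNReal.toReal_pos hq0 hq'.ne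
  have hq1 : 1 ≤ q.toReal := by
    have := (ENNReal.toReal_le_toReal (by simp) hq'.ne).2 hq
    simpa using this
  have hpart₁ : eLpNorm (U f₁) q (ballMeasure μ z s) ≤ D * N * m := by
    have hf₁ : eLpNorm f₁ q μ ^ q.toReal ≤ (m : ℝ≥0∞) ^ q.toReal * (D * μ (ball z s)) := by
      rw [eLpNorm_rpow_toReal _ hq0 hq'.ne]
      calc ∫⁻ x, ‖f₁ x‖ₑ ^ q.toReal ∂μ ≤ ∫⁻ x, (ball z (2 * s)).indicator
            (fun _ => (m : ℝ≥0∞) ^ q.toReal) x ∂μ := by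
            refine lintegral_mono_ae ?_
            filter_upwards [h₁.coeFn_toLp, hm] with x hx hxm
            rw [hx]
            by_cases hxS : x ∈ ball z (2 * s)
            · simp only [indicator_of_mem hxS]
              gcongr
            · simp [indicator_of_notMem hxS, hqp]
        _ = (m : ℝ≥0∞) ^ q.toReal * μ (ball z (2 * s)) := by
            rw [lintegral_indicator hSm, setLIntegral_const]
        _ ≤ _ := by gcongr; exact hD.2 z s hs hsb
    refine (ENNReal.rpow_le_rpow_iff hqp).1 ?_
    rw [eLpNorm_ballMeasure_rpow hq0 hq'.ne]
    calc _ ≤ (μ (ball z s))⁻¹ * ∫⁻ x, ‖U f₁ x‖ₑ ^ q.toReal ∂μ := by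
          gcongr; exact Measure.restrict_le_self
      _ = (μ (ball z s))⁻¹ * eLpNorm (U f₁) q μ ^ q.toReal := by
          rw [eLpNorm_rpow_toReal _ hq0 hq'.ne]
      _ ≤ (μ (ball z s))⁻¹ * (N * eLpNorm f₁ q μ) ^ q.toReal := by grw [hN f₁]
      _ ≤ (μ (ball z s))⁻¹ * ((N : ℝ≥0∞) ^ q.toReal * ((m : ℝ≥0∞) ^ q.toReal * (D * μ (ball z s)))) := by
          rw [ENNReal.mul_rpow_of_nonneg _ _ hqp.le]; gcongr
      _ = (μ (ball z s))⁻¹ * (μ (ball z s) * (D * (N : ℝ≥0∞) ^ q.toReal * (m : ℝ≥0∞) ^ q.toReal)) := by ring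
      _ = D * (N : ℝ≥0∞) ^ q.toReal * (m : ℝ≥0∞) ^ q.toReal :=
          ENNReal.inv_mul_cancel_left hB.ne' (measure_ne_top _ _)
      _ ≤ (D : ℝ≥0∞) ^ q.toReal * (N : ℝ≥0∞) ^ q.toReal * (m : ℝ≥0∞) ^ q.toReal := by
          gcongr
          have h1 : (1 : ℝ≥0∞) ≤ D := by exact_mod_cast hD.1
          calc (D : ℝ≥0∞) = (D : ℝ≥0∞) ^ (1 : ℝ) := (ENNReal.rpow_one _).symm
            _ ≤ _ := ENNReal.rpow_le_rpow_of_exponent_le h1 hq1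
      _ = _ := by
          rw [ENNReal.mul_rpow_of_nonneg _ _ hqp.le, ENNReal.mul_rpow_of_nonneg _ _ hqp.le]
  rw [eLpNorm_congr_ae hcongr]
  refine (eLpNorm_add_le hm₁ (hm₂.sub aestronglyMeasurable_const) hq).trans ?_
  refine (add_le_add hpart₁ hpart₂).trans (le_of_eq ?_)
  push_cast
  ring

theorem OscLe.mono_exponent [IsFiniteMeasure μ]
    (hpos : ∀ (z : M) (s : ℝ), 0 < s → 0 < μ (ball z s)) {p q : ℝ≥0∞} (hpq : p ≤ q) {c : ℝ}
    {A : ℝ≥0∞} {h : M → ℂ} (hh : AEStronglyMeasurable h μ) (hosc : OscLe μ q c A h) :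
    OscLe μ p c A h := by
  intro z s hs hsc
  have := isProbabilityMeasure_ballMeasure (hpos z s hs)
  obtain ⟨α, hα⟩ := hosc z s hs hsc
  exact ⟨α, (eLpNorm_le_eLpNorm_of_exponent_le hpq ((hh.mono_ac
    (ballMeasure_absolutelyContinuous z s)).sub aestronglyMeasurable_const)).trans hα⟩

theorem OscLe.ballOsc_le [IsFiniteMeasure μ]
    (hpos : ∀ (z : M) (s : ℝ), 0 < s → 0 < μ (ball z s)) {q : ℝ≥0∞} (hq : 1 ≤ q) {c : ℝ}
    {A : ℝ≥0∞} {h : M → ℂ} (hh : Measurable h) (hosc : OscLe μ q c A h) {z : M} {s : ℝ} (hs : 0 < s)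
    (hsc : s ≤ c) : ballOsc μ h z s ≤ 2 * A := by
  obtain ⟨α, hα⟩ := hosc.mono_exponent hpos hq hh.aestronglyMeasurable z s hs hsc
  refine (ballOsc_le_two_mul_ballAvg hh α (hpos z s hs)).trans ?_
  rw [ballAvg_eq_lintegral, ← eLpNorm_one_eq_lintegral_enorm]
  gcongr

/-- Operators with regular kernels are bounded on `L^q`, `2 ≤ q < ∞`, and map `L^∞` into `BMO`. -/
theorem exists_eLpNorm_le_and_oscLe [IsFiniteMeasure μ] (hμ : 0 < μ univ)
    (hLD : LocallyDoubling μ) (hI : ComplementaryIsoperimetric μ) {b : ℝ} (hb : 0 < b) {q : ℝ≥0∞}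
    (hq : 2 ≤ q) (hq' : q < ∞) :
    ∃ C : ℝ≥0, ∀ (U : Lp ℂ 2 μ →L[ℂ] Lp ℂ 2 μ) (K : ℝ≥0), ‖U‖ ≤ K → OffDiagonalOsc U b K →
      (∀ f : Lp ℂ 2 μ, eLpNorm (U f) q μ ≤ (C * K : ℝ≥0) * eLpNorm f q μ) ∧
      ∀ (f : Lp ℂ 2 μ) (m : ℝ≥0), (∀ᵐ x ∂μ, ‖f x‖ₑ ≤ m) →
        OscLe μ q b ((C * K : ℝ≥0) * m) (U f) := by
  have hpos : ∀ (z : M) (s : ℝ), 0 < s → 0 < μ (ball z s) :=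
    fun z s hs => hLD.measure_ball_pos hμ z hs
  obtain ⟨D, hD⟩ := hLD.exists_doublingUpTo hb
  obtain ⟨C, hC⟩ := exists_eLpNorm_le_of_oscBounded hμ hLD hI hb hq hq'
  set C' : ℝ≥0 := C * (2 * (1 + D)) with hC'
  have hq1 : 1 ≤ q := le_trans (by norm_num) hq
  refine ⟨max C' (1 + D * C'), fun U K hUK hU => ?_⟩
  have hN₂ : ∀ f : Lp ℂ 2 μ, eLpNorm (U f) 2 μ ≤ K * eLpNorm f 2 μ := by
    intro f
    rw [← Lp.enorm_def, ← Lp.enorm_def, ← ofReal_norm, ← ofReal_norm,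
      ← ENNReal.ofReal_coe_nnreal (p := K), ← ENNReal.ofReal_mul K.coe_nonneg]
    exact ENNReal.ofReal_le_ofReal (U.le_of_opNorm_le hUK f)
  -- Bootstrap: the `L²` bound gives oscillation bounds, interpolation turns them into an `L^q`
  -- bound, and that in turn gives oscillation bounds with exponent `q`.
  have hosc : OscBounded U b (2 * (1 + D) * K) := by
    refine ⟨fun f => (hN₂ f).trans ?_, fun f m hm z s hs hsb => ?_⟩
    · gcongr
      exact le_mul_of_one_le_left zero_le (le_mul_of_one_le_of_le (by norm_num) le_self_add)
    · have h1 := hU.oscLe hpos hD (by norm_num) hN₂ (by simp) f m hm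
      refine (h1.ballOsc_le hpos (by norm_num) (Lp.stronglyMeasurable _).measurable hs hsb).trans ?_
      refine le_of_eq ?_
      push_cast
      ring
  have hq₁ : ∀ f : Lp ℂ 2 μ, eLpNorm (U f) q μ ≤ (C' * K : ℝ≥0) * eLpNorm f q μ := by
    intro f
    refine (hC U _ hosc f).trans (le_of_eq ?_)
    rw [hC']
    push_cast
    ring
  refine ⟨fun f => (hq₁ f).trans ?_, fun f m hm z s hs hsb => ?_⟩
  · gcongr
    exact le_max_left _ _
  · obtain ⟨α, hα⟩ := hU.oscLe hpos hD hq1 hq₁ hq' f m hm z s hs hsb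
    refine ⟨α, hα.trans ?_⟩
    gcongr
    calc K + D * (C' * K) = (1 + D * C') * K := by ring
      _ ≤ _ := by gcongr; exact le_max_right _ _

/-! ### Kernel estimates -/

/-- The constant is the value of `T f` at a point `x₀` of the ball where the kernel formula holds;
the difference of two values is an integral of `k x y - k x₀ y` over the complement of `2B`. -/
theorem IsKernelOf.offDiagonalOsc [IsFiniteMeasure μ]
    (hpos : ∀ (z : M) (s : ℝ), 0 < s → 0 < μ (ball z s)) {T : Lp ℂ 2 μ →L[ℂ] Lp ℂ 2 μ}
    {k : M → M → ℂ} (hk : IsKernelOf T k) {b : ℝ} (hυ : upsilonConst μ b k < ∞) :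
    OffDiagonalOsc T b (upsilonConst μ b k).toNNReal := by
  intro f m hm z s hs hsb hf
  rw [ENNReal.coe_toNNReal hυ.ne]
  -- The kernel formula refers to the topological support, so a representative vanishing everywhere
  -- on `2B` is needed.
  set g : M → ℂ := (ball z (2 * s))ᶜ.indicator f with hg
  have hfg : g =ᵐ[μ] f := by
    filter_upwards [hf] with x hx
    by_cases hxS : x ∈ ball z (2 * s)
    · simp [hg, hxS, hx hxS]
    · simp [hg, hxS]
  have hgL : MemLp g 2 μ := (Lp.memLp f).indicator measurableSet_ball.compl
  have hgf : hgL.toLp g = f := by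
    rw [← Lp.toLp_coeFn f (Lp.memLp f)]
    exact MemLp.toLp_congr _ _ hfg
  have hsupp : tsupport g ⊆ (ball z (2 * s))ᶜ :=
    closure_minimal (fun x hx => by
      by_contra hcon
      exact hx (indicator_of_notMem hcon _)) isOpen_ball.isClosed_compl
  have hker := hk.2 g hgL
  rw [hgf] at hker
  have hker' : ∀ᵐ x ∂μ, x ∈ ball z s →
      Integrable (fun y => k x y * g y) μ ∧ T f x = ∫ y, k x y * g y ∂μ := by
    filter_upwards [hker] with x hx hxB
    exact hx fun h => hsupp h (ball_subset_ball (by linarith) hxB)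
  have hne : ∃ x₀, x₀ ∈ ball z s ∧ (x₀ ∈ ball z s →
      Integrable (fun y => k x₀ y * g y) μ ∧ T f x₀ = ∫ y, k x₀ y * g y ∂μ) := by
    have h0 : ∃ᵐ x ∂μ, x ∈ ball z s := by
      rw [frequently_ae_mem_iff]
      exact (hpos z s hs).ne'
    exact (h0.and_eventually hker').exists
  obtain ⟨x₀, hx₀, hx₀'⟩ := hne
  obtain ⟨hi₀, he₀⟩ := hx₀' hx₀
  refine ⟨T f x₀, ?_⟩
  filter_upwards [hker'] with x hx hxB
  obtain ⟨hi, he⟩ := hx hxB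
  rw [he, he₀, ← integral_sub hi hi₀]
  refine (enorm_integral_le_lintegral_enorm _).trans ?_
  calc _ ≤ ∫⁻ y, (ball z (2 * s))ᶜ.indicator (fun y => ‖k x y - k x₀ y‖ₑ * m) y ∂μ := by
        refine lintegral_mono_ae ?_
        filter_upwards [hm] with y hy
        by_cases hyS : y ∈ ball z (2 * s)
        · simp [hg, hyS]
        · rw [← sub_mul, enorm_mul, hg, indicator_of_mem (by exact hyS),
            indicator_of_mem (by exact hyS)]
          gcongr
    _ ≤ ∫⁻ y in (ball z (2 * s))ᶜ, ‖k x y - k x₀ y‖ₑ * m ∂μ := lintegral_indicator_le _ _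
    _ ≤ (∫⁻ y in (ball z (2 * s))ᶜ, ‖k x y - k x₀ y‖ₑ ∂μ) * m := by
        rw [lintegral_mul_const' _ _ ENNReal.coe_ne_top]
    _ ≤ _ := by
        gcongr
        refine le_iSup_of_le z (le_iSup_of_le s (le_iSup_of_le ⟨hs, hsb⟩ ?_))
        exact le_iSup_of_le x (le_iSup_of_le hxB (le_iSup_of_le x₀ (le_iSup_of_le hx₀ le_rfl)))

/-- Since `a` has mean zero, `k x y₀` may be subtracted from the kernel for a fixed `y₀` in `B`;
Tonelli's theorem then leaves the integrals bounded by `ν_k`. -/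
theorem IsKernelOf.lintegral_compl_ball_le [IsFiniteMeasure μ]
    (hpos : ∀ (z : M) (s : ℝ), 0 < s → 0 < μ (ball z s)) {T : Lp ℂ 2 μ →L[ℂ] Lp ℂ 2 μ}
    {k : M → M → ℂ} (hk : IsKernelOf T k) {b : ℝ} {z : M} {s : ℝ} (hs : 0 < s) (hsb : s ≤ b)
    {a : M → ℂ} (ha : MemLp a 2 μ) (hsupp : ∀ x, x ∉ ball z s → a x = 0) (ha0 : ∫ x, a x ∂μ = 0) :
    ∫⁻ x in (ball z (2 * s))ᶜ, ‖T (ha.toLp a) x‖ₑ ∂μ ≤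
      nuConst μ b k * ∫⁻ x, ‖a x‖ₑ ∂μ := by
  have := secondCountableTopology_of_measure_ball_pos hpos
  set B := ball z s with hB
  set W := (ball z (2 * s))ᶜ with hW
  have hBm : MeasurableSet B := measurableSet_ball
  have hWm : MeasurableSet W := measurableSet_ball.compl
  have hai : Integrable a μ := ha.integrable (by norm_num)
  have htsupp : tsupport a ⊆ closedBall z s :=
    closure_minimal (fun x hx => by
      by_contra hcon
      exact hx (hsupp x fun h => hcon (ball_subset_closedBall h))) isClosed_closedBall
  have hkm : AEStronglyMeasurable (fun w : M × M => k w.1 w.2)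
      ((μ.restrict W).prod (μ.restrict B)) := by
    rw [Measure.prod_restrict]
    refine hk.1.aestronglyMeasurable.mono_measure (Measure.restrict_mono ?_ le_rfl)
    rintro ⟨x, y⟩ ⟨hx, hy⟩ hxy
    have hxy' : x = y := hxy
    subst hxy'
    exact hx (ball_subset_ball (by linarith) hy)
  have hsec : ∀ᵐ y ∂μ.restrict B, AEStronglyMeasurable (fun x => k x y) (μ.restrict W) :=
    hkm.prod_swap.prodMk_left
  rw [ae_restrict_iff' hBm] at hsec
  -- Only almost every section of the kernel is known to be measurable, so `y₀` is chosen among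
  -- those; such points exist because `B` has positive measure.
  obtain ⟨y₀, hy₀, hy₀'⟩ : ∃ y₀, y₀ ∈ B ∧ (y₀ ∈ B →
      AEStronglyMeasurable (fun x => k x y₀) (μ.restrict W)) := by
    have h0 : ∃ᵐ x ∂μ, x ∈ B := by
      rw [frequently_ae_mem_iff]
      exact (hpos z s hs).ne'
    exact (h0.and_eventually hsec).exists
  have hk₀ := hy₀' hy₀
  have hΦ : AEMeasurable (Function.uncurry fun x y => ‖k x y - k x y₀‖ₑ * ‖a y‖ₑ)
      ((μ.restrict W).prod (μ.restrict B)) := by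
    have h1 : AEStronglyMeasurable (fun w : M × M => k w.1 y₀)
      ((μ.restrict W).prod (μ.restrict B)) := hk₀.comp_fst
    have h2 : AEStronglyMeasurable (fun w : M × M => a w.2)
      ((μ.restrict W).prod (μ.restrict B)) := ha.1.restrict.comp_snd
    exact (hkm.sub h1).enorm.mul h2.enorm
  have hpt : ∀ᵐ x ∂μ, x ∈ W →
      ‖T (ha.toLp a) x‖ₑ ≤ ∫⁻ y in B, ‖k x y - k x y₀‖ₑ * ‖a y‖ₑ ∂μ := by
    filter_upwards [hk.2 a ha] with x hx hxW
    obtain ⟨hi, he⟩ := hx fun h => hxW (closedBall_subset_ball (by linarith) (htsupp h))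
    have h1 : ∫ y, k x y * a y ∂μ = ∫ y, (k x y - k x y₀) * a y ∂μ := by
      simp_rw [sub_mul]
      rw [integral_sub hi (hai.const_mul _), integral_const_mul, ha0, mul_zero, sub_zero]
    rw [he, h1]
    refine (enorm_integral_le_lintegral_enorm _).trans ?_
    rw [← lintegral_indicator hBm]
    refine lintegral_mono fun y => ?_
    by_cases hy : y ∈ B
    · simp [hy, enorm_mul]
    · simp [hsupp y hy]
  calc _ ≤ ∫⁻ x in W, ∫⁻ y in B, ‖k x y - k x y₀‖ₑ * ‖a y‖ₑ ∂μ ∂μ :=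
        lintegral_mono_ae ((ae_restrict_iff' hWm).2 hpt)
    _ = ∫⁻ y in B, ∫⁻ x in W, ‖k x y - k x y₀‖ₑ * ‖a y‖ₑ ∂μ ∂μ := lintegral_lintegral_swap hΦ
    _ ≤ ∫⁻ y in B, nuConst μ b k * ‖a y‖ₑ ∂μ := by
        refine setLIntegral_mono' hBm fun y hy => ?_
        rw [lintegral_mul_const' _ _ enorm_ne_top]
        gcongr
        refine le_iSup_of_le z (le_iSup_of_le s (le_iSup_of_le ⟨hs, hsb⟩ ?_))
        exact le_iSup_of_le y (le_iSup_of_le hy (le_iSup_of_le y₀ (le_iSup_of_le hy₀ le_rfl)))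
    _ = nuConst μ b k * ∫⁻ y in B, ‖a y‖ₑ ∂μ := lintegral_const_mul'' _ ha.1.enorm.restrict
    _ ≤ _ := by gcongr; exact Measure.restrict_le_self

theorem integral_adjoint_mul (T : Lp ℂ 2 μ →L[ℂ] Lp ℂ 2 μ) (f g : Lp ℂ 2 μ) :
    ∫ x, conj (adjoint T f x) * g x ∂μ = ∫ x, conj (f x) * T g x ∂μ := by
  have h := adjoint_inner_left T g f
  rw [L2.inner_def, L2.inner_def] at h
  simpa only [RCLike.inner_apply, mul_comm] using h

theorem integrable_conj_mul {p q : ℝ≥0∞} [hpq : ENNReal.HolderConjugate p q] {f g : M → ℂ}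
    (hf : MemLp f p μ) (hg : MemLp g q μ) : Integrable (fun x => conj (f x) * g x) μ :=
  hf.star.integrable_mul hg

/-- The phase of a complex number. -/
noncomputable def phase (w : ℂ) : ℂ := w / ‖w‖

theorem measurable_phase : Measurable phase := by
  unfold phase
  fun_prop

theorem enorm_phase_le (w : ℂ) : ‖phase w‖ₑ ≤ 1 := by
  rw [← ofReal_norm, ENNReal.ofReal_le_one, phase, norm_div, Complex.norm_real, norm_norm]
  exact div_self_le_one _

theorem conj_mul_phase (w : ℂ) : conj w * phase w = ‖w‖ := by
  rw [phase, ← mul_div_assoc, Complex.conj_mul', sq, mul_self_div_self]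

/-- No kernel of the adjoint is used. If `T* f` deviated from its mean on `B` by more than `2 * ν *
m` on a set `E` of positive measure, pairing it with the phase of the deviation on `E`, corrected to
mean zero, would contradict the bound for `T a` off `2B`. -/
theorem IsKernelOf.offDiagonalOsc_adjoint [IsFiniteMeasure μ]
    (hpos : ∀ (z : M) (s : ℝ), 0 < s → 0 < μ (ball z s)) {T : Lp ℂ 2 μ →L[ℂ] Lp ℂ 2 μ}
    {k : M → M → ℂ} (hk : IsKernelOf T k) {b : ℝ} (hν : nuConst μ b k < ∞) :
    OffDiagonalOsc (adjoint T) b (2 * (nuConst μ b k).toNNReal) := by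
  intro f m hm z s hs hsb hf
  set ν := (nuConst μ b k).toNNReal with hνdef
  have hν' : (ν : ℝ≥0∞) = nuConst μ b k := ENNReal.coe_toNNReal hν.ne
  set B := ball z s with hB
  have hBm : MeasurableSet B := measurableSet_ball
  have hBpos : 0 < μ B := hpos z s hs
  set g : M → ℂ := ⇑(adjoint T f) with hg
  have hgm : Measurable g := (Lp.stronglyMeasurable _).measurable
  have hg2 : MemLp g 2 μ := Lp.memLp _
  have hgi : Integrable g μ := hg2.integrable (by norm_num)
  set α : ℂ := ⨍ x in B, g x ∂μ with hα
  have hGi : Integrable (fun x => g x - α) μ := hgi.sub (integrable_const _)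
  have hG0 : ∫ x in B, (g x - α) ∂μ = 0 := by
    rw [integral_sub hgi.integrableOn (integrable_const _), setIntegral_const, hα, setAverage_eq,
      smul_smul, mul_inv_cancel₀, one_smul, sub_self]
    rw [measureReal_def]
    exact (ENNReal.toReal_pos hBpos.ne' (measure_ne_top _ _)).ne'
  set E := {x | x ∈ B ∧ 2 * ν * m < ‖g x - α‖ₑ} with hE
  have hEm : MeasurableSet E :=
    hBm.inter (measurableSet_lt measurable_const (hgm.sub_const α).enorm)
  set w : M → ℂ := E.indicator fun x => phase (g x - α) with hw
  have hwm : Measurable w := (measurable_phase.comp (hgm.sub_const α)).indicator hEm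
  have hwle : ∀ x, ‖w x‖ₑ ≤ E.indicator 1 x := fun x => by
    by_cases hx : x ∈ E
    · simpa [hw, hx] using enorm_phase_le _
    · simp [hw, hx]
  have hwI : ∫⁻ x, ‖w x‖ₑ ∂μ ≤ μ E := by
    refine (lintegral_mono hwle).trans ?_
    rw [lintegral_indicator_one hEm]
  have hwB : MemLp w ∞ μ := by
    refine memLp_top_of_bound hwm.aestronglyMeasurable 1 (ae_of_all _ fun x => ?_)
    have h1 := (hwle x).trans (indicator_le_self' (fun _ _ => zero_le) x)
    rw [← ofReal_norm, Pi.one_apply, ENNReal.ofReal_le_one] at h1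
    exact h1
  have hwi : Integrable w μ := hwB.integrable le_top
  set γ : ℂ := ⨍ x in B, w x ∂μ with hγ
  -- The mean-zero correction doubles the `L¹` norm at most, whence the factor 2. It does not change
  -- the pairing with `g - α`, which has mean zero on `B`.
  set a : M → ℂ := fun x => w x - B.indicator (fun _ => γ) x with ha
  have haL : MemLp a 2 μ :=
    (hwB.mono_exponent le_top).sub ((memLp_const γ).indicator hBm)
  have hw0 : ∀ x, x ∉ B → w x = 0 := fun x hx => indicator_of_notMem (fun h => hx h.1) _
  have hasupp : ∀ x, x ∉ ball z s → a x = 0 := fun x hx => by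
    have hx' : x ∉ B := hx
    simp [ha, hw0 x hx', hx']
  have hwB' : ∫ x in B, w x ∂μ = ∫ x, w x ∂μ :=
    setIntegral_eq_integral_of_forall_compl_eq_zero hw0
  have hBr : μ.real B ≠ 0 := (ENNReal.toReal_pos hBpos.ne' (measure_ne_top _ _)).ne'
  have hγB : μ.real B • γ = ∫ x, w x ∂μ := by
    rw [hγ, setAverage_eq, smul_smul, mul_inv_cancel₀ hBr, one_smul, hwB']
  have ha0 : ∫ x, a x ∂μ = 0 := by
    rw [ha, integral_sub hwi ((integrable_const γ).indicator hBm), integral_indicator hBm,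
      setIntegral_const, hγB, sub_self]
  have haI : ∫⁻ x, ‖a x‖ₑ ∂μ ≤ 2 * μ E := by
    calc _ ≤ ∫⁻ x, (‖w x‖ₑ + B.indicator (fun _ => ‖γ‖ₑ) x) ∂μ := by
          refine lintegral_mono fun x => ?_
          refine enorm_sub_le.trans (le_of_eq ?_)
          by_cases hx : x ∈ B <;> simp [hx]
      _ = ∫⁻ x, ‖w x‖ₑ ∂μ + ‖γ‖ₑ * μ B := by
          rw [lintegral_add_left hwm.enorm, lintegral_indicator hBm, setLIntegral_const]
      _ ≤ μ E + μ E := by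
          gcongr
          have h1 : ‖γ‖ₑ * μ B = ‖∫ x, w x ∂μ‖ₑ := by
            rw [← hγB, enorm_smul, mul_comm, Real.enorm_of_nonneg measureReal_nonneg,
              ofReal_measureReal]
          rw [h1]
          exact (enorm_integral_le_lintegral_enorm _).trans hwI
      _ = _ := by ring
  have hTa := hk.lintegral_compl_ball_le hpos hs hsb haL hasupp ha0
  have hpair : ∫ x, conj (g x) * a x ∂μ = ∫ x, conj (f x) * T (haL.toLp a) x ∂μ := by
    rw [← integral_adjoint_mul]
    refine integral_congr_ae ?_
    filter_upwards [haL.coeFn_toLp] with x hx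
    rw [hx]
  have hup : ‖∫ x, conj (g x) * a x ∂μ‖ₑ ≤ 2 * ν * m * μ E := by
    rw [hpair]
    refine (enorm_integral_le_lintegral_enorm _).trans ?_
    calc _ ≤ ∫⁻ x, (ball z (2 * s))ᶜ.indicator (fun x => m * ‖T (haL.toLp a) x‖ₑ) x ∂μ := by
          refine lintegral_mono_ae ?_
          filter_upwards [hm, hf] with x hx hx'
          by_cases hxS : x ∈ ball z (2 * s)
          · simp [hx' hxS]
          · rw [indicator_of_mem (by exact hxS), enorm_mul, RCLike.enorm_conj]
            gcongr
      _ = m * ∫⁻ x in (ball z (2 * s))ᶜ, ‖T (haL.toLp a) x‖ₑ ∂μ := by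
          rw [lintegral_indicator measurableSet_ball.compl,
            lintegral_const_mul' _ _ ENNReal.coe_ne_top]
      _ ≤ m * (ν * (2 * μ E)) := by rw [← hν'] at hTa; grw [hTa, haI]
      _ = _ := by ring
  have hlow : ∫ x, conj (g x) * a x ∂μ = ∫ x in E, ((‖g x - α‖ : ℝ) : ℂ) ∂μ := by
    have h1 : ∫ x, conj (g x) * a x ∂μ = ∫ x, conj (g x - α) * a x ∂μ := by
      simp_rw [map_sub, sub_mul]
      rw [integral_sub (integrable_conj_mul hg2 haL) ((haL.integrable (by norm_num)).const_mul _),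
        integral_const_mul, ha0, mul_zero, sub_zero]
    have hGw : Integrable (fun x => conj (g x - α) * w x) μ :=
      integrable_conj_mul (p := 1) (q := ∞) (memLp_one_iff_integrable.2 hGi) hwB
    have hGB : Integrable (fun x => conj (g x - α) * B.indicator (fun _ => γ) x) μ :=
      integrable_conj_mul (p := 1) (q := ∞) (memLp_one_iff_integrable.2 hGi)
        ((memLp_const γ).indicator hBm)
    have h2 : ∫ x, conj (g x - α) * B.indicator (fun _ => γ) x ∂μ = 0 := by
      have h3 : (fun x => conj (g x - α) * B.indicator (fun _ => γ) x) =
          B.indicator fun x => conj (g x - α) * γ := by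
        ext x
        by_cases hx : x ∈ B <;> simp [hx]
      rw [h3, integral_indicator hBm, integral_mul_const, integral_conj, hG0]
      simp
    rw [h1]
    simp only [ha, mul_sub]
    rw [integral_sub hGw hGB, h2, sub_zero, ← integral_indicator hEm]
    refine integral_congr_ae (ae_of_all _ fun x => ?_)
    by_cases hx : x ∈ E
    · simp only [hw, indicator_of_mem hx, conj_mul_phase]
    · simp [hw, hx]
  have hlow' : ‖∫ x, conj (g x) * a x ∂μ‖ₑ = ∫⁻ x in E, ‖g x - α‖ₑ ∂μ := by
    rw [hlow, integral_complex_ofReal, ← ofReal_norm, Complex.norm_real,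
      Real.norm_of_nonneg (integral_nonneg fun _ => norm_nonneg _),
      ofReal_integral_norm_eq_lintegral_enorm hGi.integrableOn]
  rw [hlow'] at hup
  have hE0 : μ E = 0 := by
    by_contra hne
    have h1 : ∫⁻ _ in E, 2 * ν * m ∂μ < ∫⁻ x in E, ‖g x - α‖ₑ ∂μ := by
      refine setLIntegral_strict_mono hEm hne (hgm.sub_const α).enorm ?_
        (ae_of_all _ fun x hx => hx.2)
      rw [setLIntegral_const]
      have := measure_ne_top μ E
      finiteness
    rw [setLIntegral_const] at h1
    exact absurd hup (not_le.2 h1)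
  refine ⟨α, ?_⟩
  filter_upwards [measure_eq_zero_iff_ae_notMem.1 hE0] with x hx hxB
  push_cast
  by_contra hcon
  exact hx ⟨hxB, not_le.1 hcon⟩

/-! ### Extension to `L^p` -/

theorem lintegral_conj_mul_le {p q : ℝ≥0∞} [ENNReal.HolderConjugate p q] {f g : M → ℂ}
    (hf : AEStronglyMeasurable f μ) (hg : AEStronglyMeasurable g μ) :
    ∫⁻ x, ‖conj (f x) * g x‖ₑ ∂μ ≤ eLpNorm f p μ * eLpNorm g q μ := by
  have h := eLpNorm_smul_le_mul_eLpNorm (p := p) (q := q) (r := 1) hg hf.star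
  rw [eLpNorm_one_eq_lintegral_enorm] at h
  have h2 : eLpNorm (star f) p μ = eLpNorm f p μ :=
    eLpNorm_congr_norm_ae (ae_of_all _ fun x => norm_star (f x))
  rw [h2] at h
  exact h

theorem enorm_integral_conj_mul_le {p q : ℝ≥0∞} [ENNReal.HolderConjugate p q] {f g : M → ℂ}
    (hf : AEStronglyMeasurable f μ) (hg : AEStronglyMeasurable g μ) :
    ‖∫ x, conj (f x) * g x ∂μ‖ₑ ≤ eLpNorm f p μ * eLpNorm g q μ :=
  (enorm_integral_le_lintegral_enorm _).trans (lintegral_conj_mul_le hf hg)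

theorem enorm_phase {w : ℂ} (hw : w ≠ 0) : ‖phase w‖ₑ = 1 := by
  rw [← ofReal_norm, phase, norm_div, Complex.norm_real, norm_norm, div_self (norm_ne_zero_iff.2 hw),
    ENNReal.ofReal_one]

/-- Bounds on `L^q` for the adjoint give bounds on the dual space. -/
theorem eLpNorm_le_of_adjoint [IsFiniteMeasure μ] {T : Lp ℂ 2 μ →L[ℂ] Lp ℂ 2 μ} {p q : ℝ≥0∞}
    (hpq : ENNReal.HolderConjugate p q) (hp1 : 1 < p) (hp : p ≤ 2) (hq : 2 ≤ q) (hq' : q < ∞)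
    {N : ℝ≥0}
    (hN : ∀ f : Lp ℂ 2 μ, eLpNorm (adjoint T f) q μ ≤ N * eLpNorm f q μ) (g : Lp ℂ 2 μ) :
    eLpNorm (T g) p μ ≤ N * eLpNorm g p μ := by
  have hpt : p ≠ ∞ := ne_top_of_le_ne_top (by simp) hp
  have hp0 : p ≠ 0 := (zero_lt_one.trans hp1).ne'
  have hq0 : q ≠ 0 := (zero_lt_two.trans_le hq).ne'
  have hR : Real.HolderConjugate p.toReal q.toReal :=
    ENNReal.HolderConjugate.toReal_of_ne_top hpt hq'.ne
  set P := p.toReal with hP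
  set Q := q.toReal with hQ
  have hP1 : 0 < P - 1 := hR.sub_one_pos
  have hP0 : 0 < P := hR.pos
  have hQ0 : 0 < Q := hR.symm.pos
  set F : M → ℂ := ⇑(T g) with hF
  have hFm : Measurable F := (Lp.stronglyMeasurable _).measurable
  have hFp : MemLp F p μ := (Lp.memLp (T g)).mono_exponent hp
  -- The extremal function in Hölder's inequality. Its `L^q` norm is finite because `F` lies in `L²
  -- ⊆ L^p`; this permits the final division by `X ^ Q⁻¹`.
  set h : M → ℂ := fun x => ((‖F x‖ ^ (P - 1) : ℝ) : ℂ) * phase (F x) with hh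
  have hhm : Measurable h := by
    refine Measurable.mul ?_ (measurable_phase.comp hFm)
    exact Complex.measurable_ofReal.comp (hFm.norm.pow_const _)
  have hnorm : ∀ x, ‖h x‖ₑ ^ Q = ‖F x‖ₑ ^ P := by
    intro x
    by_cases hx : F x = 0
    · simp [hh, hx, phase, hQ0, hP0]
    · rw [hh]
      simp only
      rw [enorm_mul, enorm_phase hx, mul_one, ← ofReal_norm, Complex.norm_real,
        Real.norm_of_nonneg (by positivity), ← ENNReal.ofReal_rpow_of_nonneg (norm_nonneg _) hP1.le,
        ofReal_norm, ← ENNReal.rpow_mul, hR.sub_one_mul_conj]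
  set X := ∫⁻ x, ‖F x‖ₑ ^ P ∂μ with hX
  have hXt : X ≠ ∞ := by
    rw [hX, ← eLpNorm_rpow_toReal _ hp0 hpt]
    exact ENNReal.rpow_ne_top_of_nonneg hP0.le hFp.eLpNorm_ne_top
  have hhq : eLpNorm h q μ ^ Q = X := by
    rw [eLpNorm_rpow_toReal _ hq0 hq'.ne]
    exact lintegral_congr hnorm
  have hhL : MemLp h q μ := by
    refine ⟨hhm.aestronglyMeasurable, ?_⟩
    have : eLpNorm h q μ ^ Q < ∞ := by rw [hhq]; exact hXt.lt_top
    exact (ENNReal.rpow_lt_top_iff_of_pos hQ0).1 this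
  have hh2 : MemLp h 2 μ := hhL.mono_exponent hq
  have hpair : ∫ x, conj (adjoint T (hh2.toLp h) x) * g x ∂μ = ∫ x, ((‖F x‖ ^ P : ℝ) : ℂ) ∂μ := by
    rw [integral_adjoint_mul]
    refine integral_congr_ae ?_
    filter_upwards [hh2.coeFn_toLp] with x hx
    rw [hx]
    simp only [hh, map_mul, Complex.conj_ofReal]
    have h1 : conj (phase (F x)) * F x = (‖F x‖ : ℂ) := by
      have := congrArg conj (conj_mul_phase (F x))
      rw [map_mul, Complex.conj_conj, Complex.conj_ofReal, mul_comm] at this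
      exact this
    rw [← hF, mul_assoc, h1, ← Complex.ofReal_mul]
    congr 1
    rcases eq_or_ne (‖F x‖) 0 with h0 | h0
    · rw [h0, mul_zero, Real.zero_rpow hP0.ne']
    · rw [← Real.rpow_add_one h0]
      congr 1
      ring
  have hXeq : ‖∫ x, conj (adjoint T (hh2.toLp h) x) * g x ∂μ‖ₑ = X := by
    have hint : Integrable (fun x => ‖F x‖ ^ P) μ := hFp.integrable_norm_rpow hp0 hpt
    rw [hpair, integral_complex_ofReal, ← ofReal_norm, Complex.norm_real,
      Real.norm_of_nonneg (integral_nonneg fun _ => by positivity),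
      ofReal_integral_eq_lintegral_ofReal hint (ae_of_all _ fun _ => by positivity), hX]
    refine lintegral_congr fun x => ?_
    rw [← ENNReal.ofReal_rpow_of_nonneg (norm_nonneg _) hP0.le, ofReal_norm]
  have hle : X ≤ N * X ^ Q⁻¹ * eLpNorm g p μ := by
    have h1 := enorm_integral_conj_mul_le (p := q) (q := p) (μ := μ)
      (Lp.aestronglyMeasurable (adjoint T (hh2.toLp h))) (Lp.aestronglyMeasurable g)
    rw [hXeq] at h1
    refine h1.trans ?_
    gcongr
    refine (hN _).trans ?_
    rw [eLpNorm_congr_ae hh2.coeFn_toLp, ← hhq, ENNReal.rpow_rpow_inv hQ0.ne']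
  have hFX : eLpNorm F p μ = X ^ P⁻¹ := by
    rw [hX, ← eLpNorm_rpow_toReal _ hp0 hpt, ENNReal.rpow_rpow_inv hP0.ne']
  rw [hFX]
  rcases eq_or_ne X 0 with hX0 | hX0
  · rw [hX0, ENNReal.zero_rpow_of_pos (by positivity)]
    exact zero_le
  · have hXQ0 : X ^ Q⁻¹ ≠ 0 := by
      rw [Ne, ENNReal.rpow_eq_zero_iff_of_pos (by positivity)]
      exact hX0
    have hXQt : X ^ Q⁻¹ ≠ ∞ := ENNReal.rpow_ne_top_of_nonneg (by positivity) hXt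
    refine (ENNReal.mul_le_mul_iff_right hXQ0 hXQt).1 ?_
    rw [← ENNReal.rpow_add _ _ hX0 hXt, add_comm, hR.inv_add_inv_eq_one, ENNReal.rpow_one]
    refine hle.trans (le_of_eq ?_)
    ring

/-- The inclusion of `L^q(μ)` into `L^p(μ)` for `p ≤ q` and a finite measure. -/
noncomputable def lpInclusion (μ : Measure M) [IsFiniteMeasure μ] {p q : ℝ≥0∞} (h : p ≤ q) :
    Lp ℂ q μ →ₗ[ℂ] Lp ℂ p μ where
  toFun f := ((Lp.memLp f).mono_exponent h).toLp f
  map_add' f g := by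
    refine Lp.ext ?_
    filter_upwards [MemLp.coeFn_toLp ((Lp.memLp (f + g)).mono_exponent h),
      Lp.coeFn_add (((Lp.memLp f).mono_exponent h).toLp f) (((Lp.memLp g).mono_exponent h).toLp g),
      MemLp.coeFn_toLp ((Lp.memLp f).mono_exponent h),
      MemLp.coeFn_toLp ((Lp.memLp g).mono_exponent h), Lp.coeFn_add f g] with x h1 h2 h3 h4 h5
    rw [h1, h2, h5, Pi.add_apply, Pi.add_apply, h3, h4]
  map_smul' c f := by
    refine Lp.ext ?_
    filter_upwards [MemLp.coeFn_toLp ((Lp.memLp (c • f)).mono_exponent h),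
      Lp.coeFn_smul c (((Lp.memLp f).mono_exponent h).toLp f),
      MemLp.coeFn_toLp ((Lp.memLp f).mono_exponent h), Lp.coeFn_smul c f] with x h1 h2 h3 h5
    rw [h1, RingHom.id_apply, h2, h5, Pi.smul_apply, Pi.smul_apply, h3]

theorem coeFn_lpInclusion [IsFiniteMeasure μ] {p q : ℝ≥0∞} (h : p ≤ q) (f : Lp ℂ q μ) :
    lpInclusion μ h f =ᵐ[μ] f :=
  MemLp.coeFn_toLp ((Lp.memLp f).mono_exponent h)

theorem lpInclusion_toLp [IsFiniteMeasure μ] {p q : ℝ≥0∞} (h : p ≤ q) {f : M → ℂ}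
    (hq : MemLp f q μ) (hp : MemLp f p μ) : lpInclusion μ h (hq.toLp f) = hp.toLp f :=
  Lp.ext ((coeFn_lpInclusion h _).trans (hq.coeFn_toLp.trans hp.coeFn_toLp.symm))

theorem denseRange_lpInclusion [IsFiniteMeasure μ] {p q : ℝ≥0∞} [Fact (1 ≤ p)] (h : p ≤ q)
    (hp : p < ∞) : DenseRange (lpInclusion μ h) := by
  refine Metric.denseRange_iff.2 fun f ε hε => ?_
  obtain ⟨g, hg, -⟩ := (Lp.memLp f).exists_simpleFunc_eLpNorm_sub_lt hp.ne
    (ε := ENNReal.ofReal ε) (by simpa using hε)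
  have hgq : MemLp g q μ := g.memLp_of_isFiniteMeasure q μ
  have hgp : MemLp g p μ := g.memLp_of_isFiniteMeasure p μ
  refine ⟨hgq.toLp g, ?_⟩
  rw [lpInclusion_toLp h hgq hgp, Lp.dist_def]
  refine (ENNReal.lt_ofReal_iff_toReal_lt ?_).1 ?_
  · exact ((Lp.memLp f).sub (Lp.memLp _)).eLpNorm_ne_top
  · refine lt_of_eq_of_lt (eLpNorm_congr_ae ?_) hg
    filter_upwards [hgp.coeFn_toLp] with x hx
    rw [Pi.sub_apply, hx, Pi.sub_apply]

theorem extendsToLp_of_two_le [IsFiniteMeasure μ] {T : Lp ℂ 2 μ →L[ℂ] Lp ℂ 2 μ} {p : ℝ≥0∞}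
    [Fact (1 ≤ p)] (hp : 2 ≤ p) {N : ℝ≥0}
    (hN : ∀ f : Lp ℂ 2 μ, eLpNorm (T f) p μ ≤ N * eLpNorm f p μ) : ExtendsToLp T p := by
  have hmem : ∀ f : Lp ℂ p μ, MemLp (T (lpInclusion μ hp f)) p μ := by
    intro f
    refine ⟨Lp.aestronglyMeasurable _, (hN _).trans_lt ?_⟩
    rw [eLpNorm_congr_ae (coeFn_lpInclusion hp f)]
    exact ENNReal.mul_lt_top ENNReal.coe_lt_top (Lp.eLpNorm_lt_top f)
  let S₀ : Lp ℂ p μ →ₗ[ℂ] Lp ℂ p μ :=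
    { toFun := fun f => (hmem f).toLp _
      map_add' := fun f g => by
        rw [← MemLp.toLp_add]
        refine MemLp.toLp_congr _ _ ?_
        rw [map_add, map_add]
        exact Lp.coeFn_add _ _
      map_smul' := fun c f => by
        rw [RingHom.id_apply, ← MemLp.toLp_const_smul]
        refine MemLp.toLp_congr _ _ ?_
        rw [map_smul, map_smul]
        exact Lp.coeFn_smul _ _ }
  refine ⟨S₀.mkContinuous N fun f => ?_, fun f h₂ hp' => ?_⟩
  · change ‖(hmem f).toLp _‖ ≤ _
    rw [Lp.norm_toLp, Lp.norm_def, ← ENNReal.coe_toReal, ← ENNReal.toReal_mul]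
    refine ENNReal.toReal_mono (ENNReal.mul_ne_top ENNReal.coe_ne_top (Lp.eLpNorm_ne_top f)) ?_
    refine (hN _).trans (le_of_eq ?_)
    rw [eLpNorm_congr_ae (coeFn_lpInclusion hp f)]
  · change (hmem (hp'.toLp f)).toLp _ =ᵐ[μ] _
    refine (MemLp.coeFn_toLp _).trans ?_
    rw [lpInclusion_toLp hp hp' h₂]

/-- Here `L²` is a dense subspace of `L^p`, so the extension is by continuity; for `p ≥ 2` it is a
restriction. -/
theorem extendsToLp_of_le_two [IsFiniteMeasure μ] {T : Lp ℂ 2 μ →L[ℂ] Lp ℂ 2 μ} {p : ℝ≥0∞}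
    [Fact (1 ≤ p)] (hp : p ≤ 2) {N : ℝ≥0}
    (hN : ∀ f : Lp ℂ 2 μ, eLpNorm (T f) p μ ≤ N * eLpNorm f p μ) : ExtendsToLp T p := by
  have hpt : p < ∞ := hp.trans_lt (by simp)
  have hbound : ∀ f : Lp ℂ 2 μ, ‖(lpInclusion μ hp ∘ₗ (T : Lp ℂ 2 μ →ₗ[ℂ] Lp ℂ 2 μ)) f‖ ≤
      N * ‖lpInclusion μ hp f‖ := by
    intro f
    change ‖lpInclusion μ hp (T f)‖ ≤ _
    rw [Lp.norm_def, Lp.norm_def, ← ENNReal.coe_toReal, ← ENNReal.toReal_mul]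
    refine ENNReal.toReal_mono (ENNReal.mul_ne_top ENNReal.coe_ne_top (Lp.eLpNorm_ne_top _)) ?_
    rw [eLpNorm_congr_ae (coeFn_lpInclusion hp f), eLpNorm_congr_ae (coeFn_lpInclusion hp (T f))]
    exact hN f
  refine ⟨(lpInclusion μ hp ∘ₗ (T : Lp ℂ 2 μ →ₗ[ℂ] Lp ℂ 2 μ)).extendOfNorm (lpInclusion μ hp),
    fun f h₂ hp' => ?_⟩
  rw [← lpInclusion_toLp hp h₂ hp',
    LinearMap.extendOfNorm_eq (denseRange_lpInclusion hp hpt) ⟨N, hbound⟩]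
  exact coeFn_lpInclusion hp _

/-! ### Boundedness from `L^∞` to `BMO` -/

theorem eLpNorm_one_le_of_bounded [IsFiniteMeasure μ] {U : Lp ℂ 2 μ →L[ℂ] Lp ℂ 2 μ} {K : ℝ≥0}
    (hU : ‖U‖ ≤ K) {f : Lp ℂ 2 μ} {m : ℝ≥0} (hm : ∀ᵐ x ∂μ, ‖f x‖ₑ ≤ m) :
    eLpNorm (U f) 1 μ ≤ K * m * μ univ := by
  have h1 : eLpNorm (U f) 2 μ ≤ K * eLpNorm f 2 μ := by
    rw [← Lp.enorm_def, ← Lp.enorm_def, ← ofReal_norm, ← ofReal_norm,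
      ← ENNReal.ofReal_coe_nnreal (p := K), ← ENNReal.ofReal_mul K.coe_nonneg]
    exact ENNReal.ofReal_le_ofReal (U.le_of_opNorm_le hU f)
  have h2 : eLpNorm f 2 μ ≤ μ univ ^ (2⁻¹ : ℝ) * m := by
    have h := eLpNorm_le_of_ae_enorm_bound (p := 2) hm
    simpa [mul_comm] using h
  have h3 : eLpNorm (U f) 1 μ ≤ eLpNorm (U f) 2 μ * μ univ ^ (2⁻¹ : ℝ) := by
    have h := eLpNorm_le_eLpNorm_mul_rpow_measure_univ (p := 1) (q := 2) (by norm_num)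
      (Lp.aestronglyMeasurable (U f))
    have e : 1 / (1 : ℝ≥0∞).toReal - 1 / (2 : ℝ≥0∞).toReal = 2⁻¹ := by norm_num
    rwa [e] at h
  have h4 : μ univ ^ (2⁻¹ : ℝ) * μ univ ^ (2⁻¹ : ℝ) = μ univ := by
    rw [← ENNReal.rpow_add_of_nonneg _ _ (by norm_num) (by norm_num)]
    norm_num
  calc _ ≤ K * (μ univ ^ (2⁻¹ : ℝ) * m) * μ univ ^ (2⁻¹ : ℝ) := by grw [h3, h1, h2]
    _ = K * m * (μ univ ^ (2⁻¹ : ℝ) * μ univ ^ (2⁻¹ : ℝ)) := by ring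
    _ = _ := by rw [h4]

/-- The average differs from any constant `α` by at most the mean deviation from `α`, hence the
factor 2. -/
theorem OscLe.meanOscillation_le [IsFiniteMeasure μ]
    (hpos : ∀ (z : M) (s : ℝ), 0 < s → 0 < μ (ball z s)) {q : ℝ≥0∞} (hq : 1 ≤ q) {c : ℝ}
    {A : ℝ≥0∞} {h : M → ℂ} (hh : Integrable h μ) (hosc : OscLe μ q c A h) :
    meanOscillation μ q c h ≤ 2 * A := by
  refine iSup_le fun z => iSup_le fun s => iSup_le fun hs => ?_
  have := isProbabilityMeasure_ballMeasure (hpos z s hs.1)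
  obtain ⟨α, hα⟩ := hosc z s hs.1 hs.2
  refine (eLpNorm_sub_const_le hq hh.1 (hpos z s hs.1) α _).trans ?_
  rw [two_mul]
  refine add_le_add hα (le_trans ?_ hα)
  have hh' := hh.1.mono_ac (ballMeasure_absolutelyContinuous z s)
  have hint : Integrable h (ballMeasure μ z s) :=
    hh.integrableOn.smul_measure (ENNReal.inv_ne_top.2 (hpos z s hs.1).ne')
  have h1 : ⨍ y in ball z s, h y ∂μ = ∫ y, h y ∂(ballMeasure μ z s) := by
    rw [average, Measure.restrict_apply_univ]
  have h2 : α - ⨍ y in ball z s, h y ∂μ = -∫ y, (h y - α) ∂(ballMeasure μ z s) := by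
    rw [integral_sub hint (integrable_const _), h1]
    simp
  rw [h2, enorm_neg]
  refine (enorm_integral_le_lintegral_enorm _).trans ?_
  rw [← eLpNorm_one_eq_lintegral_enorm]
  exact eLpNorm_le_eLpNorm_of_exponent_le hq (hh'.sub aestronglyMeasurable_const)

/-- A bound for `‖U f‖₁` and the mean oscillation of `U f` in terms of `‖f‖_∞`, at every scale. -/
theorem exists_oscLe_and_eLpNorm_one_le [IsFiniteMeasure μ] (hμ : 0 < μ univ)
    (hLD : LocallyDoubling μ) {R₀ β : ℝ} (hAM : ApproximateMidpoint M R₀ β)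
    (hI : ComplementaryIsoperimetric μ) {b : ℝ} (hb : R₀ / (1 - β) < b) (c : ℝ) {q : ℝ≥0∞}
    (hq : 1 ≤ q) (hq' : q < ∞) :
    ∃ C : ℝ≥0, ∀ (U : Lp ℂ 2 μ →L[ℂ] Lp ℂ 2 μ) (K : ℝ≥0), ‖U‖ ≤ K → OffDiagonalOsc U b K →
      ∀ (f : Lp ℂ 2 μ) (m : ℝ≥0), (∀ᵐ x ∂μ, ‖f x‖ₑ ≤ m) →
        OscLe μ q c ((C * K : ℝ≥0) * m) (U f) ∧
        eLpNorm (U f) 1 μ ≤ (C * K : ℝ≥0) * m * μ univ := by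
  have hb0 : 0 < b := (div_nonneg hAM.1 (by linarith [hAM.2.2.1])).trans_lt hb
  have hpos : ∀ (z : M) (s : ℝ), 0 < s → 0 < μ (ball z s) :=
    fun z s hs => hLD.measure_ball_pos hμ z hs
  obtain ⟨C, hC⟩ := exists_eLpNorm_le_and_oscLe hμ hLD hI hb0 (le_max_right q 2)
    (max_lt hq' (by simp))
  obtain ⟨E, hE⟩ := OscLe.exists_scale hμ hLD hAM hb c hq hq'
  refine ⟨max (E * C) 1, fun U K hUK hU f m hm => ⟨fun z s hs hsc => ?_, ?_⟩⟩
  · have h1 := ((hC U K hUK hU).2 f m hm).mono_exponent hpos (le_max_left q 2)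
      (Lp.aestronglyMeasurable _)
    obtain ⟨α, hα⟩ := hE _ _ (Lp.aestronglyMeasurable _) h1 z s hs hsc
    refine ⟨α, hα.trans ?_⟩
    rw [← mul_assoc, ← ENNReal.coe_mul, ← mul_assoc]
    gcongr
    exact le_max_left _ _
  · refine (eLpNorm_one_le_of_bounded hUK hm).trans ?_
    gcongr
    exact le_mul_of_one_le_left zero_le (le_max_right _ _)

theorem boundedLinftyToBMO_of_oscLe [IsFiniteMeasure μ]
    (hpos : ∀ (z : M) (s : ℝ), 0 < s → 0 < μ (ball z s)) {T : Lp ℂ 2 μ →L[ℂ] Lp ℂ 2 μ}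
    {q : ℝ≥0∞} (hq : 1 ≤ q) {c : ℝ} {A : ℝ≥0}
    (hT : ∀ (f : Lp ℂ 2 μ) (m : ℝ≥0), (∀ᵐ x ∂μ, ‖f x‖ₑ ≤ m) →
      OscLe μ q c (A * m) (T f) ∧ eLpNorm (T f) 1 μ ≤ A * m * μ univ) :
    BoundedLinftyToBMO T q c ((μ.real univ + 2) * A) := by
  intro f h₂ hf
  set m := (eLpNorm f ∞ μ).toNNReal with hm
  have hm' : (m : ℝ≥0∞) = eLpNorm f ∞ μ := ENNReal.coe_toNNReal hf.eLpNorm_ne_top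
  have hbd : ∀ᵐ x ∂μ, ‖h₂.toLp f x‖ₑ ≤ m := by
    filter_upwards [h₂.coeFn_toLp, ae_le_eLpNormEssSup (f := f) (μ := μ)] with x hx hx'
    rw [hx, hm', eLpNorm_exponent_top]
    exact hx'
  obtain ⟨hosc, h1⟩ := hT _ m hbd
  have hmem : MemLp (T (h₂.toLp f)) 1 μ := (Lp.memLp _).mono_exponent (by norm_num)
  have hosc' := hosc.meanOscillation_le hpos hq (memLp_one_iff_integrable.1 hmem)
  refine ⟨⟨hmem, hosc'.trans_lt (by finiteness)⟩, (add_le_add h1 hosc').trans (le_of_eq ?_)⟩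
  rw [← hm', ENNReal.ofReal_mul (by positivity), ENNReal.ofReal_add (by positivity) (by norm_num),
    ofReal_measureReal, ENNReal.ofReal_coe_nnreal]
  simp only [ENNReal.ofReal_ofNat]
  ring

/-! ### Truncation -/

/-- Truncation of the real and imaginary parts at level `N`. -/
noncomputable def truncation (N : ℕ) (w : ℂ) : ℂ :=
  ((max (-(N : ℝ)) (min N w.re) : ℝ) : ℂ) + ((max (-(N : ℝ)) (min N w.im) : ℝ) : ℂ) * Complex.I

theorem measurable_truncation (N : ℕ) : Measurable (truncation N) := by
  unfold truncation
  fun_prop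

theorem abs_clamp_sub_le (N : ℕ) (x y : ℝ) :
    |max (-(N : ℝ)) (min N x) - max (-(N : ℝ)) (min N y)| ≤ |x - y| := by
  have h := ((LipschitzWith.id (α := ℝ)).const_min (N : ℝ)).const_max (-(N : ℝ))
  simpa [Real.dist_eq] using h.dist_le_mul x y

theorem enorm_truncation_sub_le (N : ℕ) (w w' : ℂ) :
    ‖truncation N w - truncation N w'‖ₑ ≤ 2 * ‖w - w'‖ₑ := by
  rw [← ofReal_norm, ← ofReal_norm, ← ENNReal.ofReal_ofNat, ← ENNReal.ofReal_mul (by norm_num)]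
  refine ENNReal.ofReal_le_ofReal ?_
  have h : truncation N w - truncation N w' =
      ((max (-(N : ℝ)) (min N w.re) - max (-(N : ℝ)) (min N w'.re) : ℝ) : ℂ) +
      ((max (-(N : ℝ)) (min N w.im) - max (-(N : ℝ)) (min N w'.im) : ℝ) : ℂ) * Complex.I := by
    rw [truncation, truncation]
    push_cast
    ring
  rw [h]
  refine (norm_add_le _ _).trans ?_
  rw [norm_mul, Complex.norm_I, mul_one, Complex.norm_real, Complex.norm_real, two_mul]
  refine add_le_add ((abs_clamp_sub_le _ _ _).trans ?_) ((abs_clamp_sub_le _ _ _).trans ?_)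
  · exact Complex.abs_re_le_norm (w - w')
  · exact Complex.abs_im_le_norm (w - w')

theorem truncation_zero (N : ℕ) : truncation N 0 = 0 := by
  simp [truncation]

theorem enorm_truncation_le (N : ℕ) (w : ℂ) : ‖truncation N w‖ₑ ≤ 2 * ‖w‖ₑ := by
  simpa [truncation_zero] using enorm_truncation_sub_le N w 0

theorem norm_truncation_le_two_mul (N : ℕ) (w : ℂ) : ‖truncation N w‖ ≤ 2 * ‖w‖ := by
  have h := enorm_truncation_le N w
  rwa [← ofReal_norm, ← ofReal_norm, ← ENNReal.ofReal_ofNat, ← ENNReal.ofReal_mul (by norm_num),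
    ENNReal.ofReal_le_ofReal_iff (by positivity)] at h

theorem norm_truncation_le (N : ℕ) (w : ℂ) : ‖truncation N w‖ ≤ 2 * N := by
  have h : ∀ x : ℝ, |max (-(N : ℝ)) (min N x)| ≤ N := fun x =>
    abs_le.2 ⟨le_max_left _ _, max_le (by linarith [N.cast_nonneg (α := ℝ)]) (min_le_left _ _)⟩
  refine (norm_add_le _ _).trans ?_
  rw [norm_mul, Complex.norm_I, mul_one, Complex.norm_real, Complex.norm_real, two_mul]
  exact add_le_add (h _) (h _)

theorem tendsto_truncation (w : ℂ) : Tendsto (fun N => truncation N w) atTop (𝓝 w) := by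
  refine tendsto_const_nhds.congr' ?_
  obtain ⟨n, hn⟩ := exists_nat_ge ‖w‖
  filter_upwards [eventually_ge_atTop n] with N hN
  have hN' : ‖w‖ ≤ N := hn.trans (by exact_mod_cast hN)
  have h : ∀ x : ℝ, |x| ≤ ‖w‖ → max (-(N : ℝ)) (min N x) = x := fun x hx => by
    have := abs_le.1 (hx.trans hN')
    rw [min_eq_right this.2, max_eq_right this.1]
  rw [truncation, h _ (Complex.abs_re_le_norm w), h _ (Complex.abs_im_le_norm w), Complex.re_add_im]

theorem memLp_truncation [IsFiniteMeasure μ] (N : ℕ) {h : M → ℂ} (hh : AEStronglyMeasurable h μ)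
    (p : ℝ≥0∞) : MemLp (fun x => truncation N (h x)) p μ :=
  (memLp_top_of_bound ((measurable_truncation N).comp_aemeasurable hh.aemeasurable).aestronglyMeasurable
    (2 * N) (ae_of_all _ fun _ => norm_truncation_le N _)).mono_exponent le_top

/-- Truncation is 2-Lipschitz, so the truncated constant serves, with a bound independent of `N`. -/
theorem OscLe.truncation {q : ℝ≥0∞} {c : ℝ} {A : ℝ≥0∞} {h : M → ℂ} (hosc : OscLe μ q c A h)
    (N : ℕ) : OscLe μ q c (2 * A) fun x => truncation N (h x) := by
  intro z s hs hsc
  obtain ⟨α, hα⟩ := hosc z s hs hsc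
  refine ⟨MetricHardy.truncation N α, ?_⟩
  have h1 := eLpNorm_le_nnreal_smul_eLpNorm_of_ae_le_mul (μ := ballMeasure μ z s)
    (f := fun x => MetricHardy.truncation N (h x) - MetricHardy.truncation N α)
    (g := fun x => h x - α) (c := 2) (p := q) (ae_of_all _ fun x => ?_)
  · refine h1.trans ?_
    rw [ENNReal.smul_def, smul_eq_mul]
    push_cast
    gcongr
  · have := enorm_truncation_sub_le N (h x) α
    rw [enorm_eq_nnnorm, enorm_eq_nnnorm] at this
    exact_mod_cast this

/-! ### Duality and atoms -/

/-- A function in the dual space as a functional on `L^p(μ)`. -/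
noncomputable def lpPairing {p q : ℝ≥0∞} [ENNReal.HolderConjugate q p] [Fact (1 ≤ p)] {F : M → ℂ}
    (hF : MemLp F q μ) : Lp ℂ p μ →L[ℂ] ℂ :=
  LinearMap.mkContinuous
    { toFun := fun g => ∫ x, conj (F x) * g x ∂μ
      map_add' := fun g h => by
        rw [← integral_add (integrable_conj_mul hF (Lp.memLp g))
          (integrable_conj_mul hF (Lp.memLp h))]
        refine integral_congr_ae ?_
        filter_upwards [Lp.coeFn_add g h] with x hx
        rw [hx, Pi.add_apply, mul_add]
      map_smul' := fun c g => by
        rw [RingHom.id_apply, smul_eq_mul, ← integral_const_mul]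
        refine integral_congr_ae ?_
        filter_upwards [Lp.coeFn_smul c g] with x hx
        rw [hx, Pi.smul_apply, smul_eq_mul, mul_left_comm] }
    (eLpNorm F q μ).toReal fun g => by
      rw [Lp.norm_def, ← ENNReal.toReal_mul, ← toReal_enorm]
      exact ENNReal.toReal_mono (ENNReal.mul_ne_top hF.eLpNorm_ne_top (Lp.eLpNorm_ne_top g))
        (enorm_integral_conj_mul_le hF.1 (Lp.aestronglyMeasurable g))

theorem lpPairing_apply {p q : ℝ≥0∞} [ENNReal.HolderConjugate q p] [Fact (1 ≤ p)] {F : M → ℂ}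
    (hF : MemLp F q μ) (g : Lp ℂ p μ) : lpPairing hF g = ∫ x, conj (F x) * g x ∂μ :=
  rfl

/-- The norm of `L¹(μ)` by duality. -/
theorem norm_le_of_enorm_integral_conj_mul_le [IsFiniteMeasure μ] {h : Lp ℂ 1 μ} {B : ℝ≥0}
    (H : ∀ f : Lp ℂ 2 μ, (∀ᵐ x ∂μ, ‖f x‖ₑ ≤ (1 : ℝ≥0)) → ‖∫ x, conj (f x) * h x ∂μ‖ₑ ≤ B) :
    ‖h‖ ≤ B := by
  have hhm : Measurable h := (Lp.stronglyMeasurable h).measurable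
  have hf : MemLp (fun x => phase (h x)) 2 μ := by
    refine (memLp_top_of_bound (measurable_phase.comp hhm).aestronglyMeasurable 1
      (ae_of_all _ fun x => ?_)).mono_exponent le_top
    have h1 := enorm_phase_le (h x)
    rw [← ofReal_norm, ENNReal.ofReal_le_one] at h1
    exact h1
  have h1 := H (hf.toLp _) (by
    filter_upwards [hf.coeFn_toLp] with x hx
    rw [hx]
    rw [ENNReal.coe_one]
    exact enorm_phase_le (h x))
  have h2 : ∫ x, conj (hf.toLp _ x) * h x ∂μ = ∫ x, ((‖h x‖ : ℝ) : ℂ) ∂μ := by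
    refine integral_congr_ae ?_
    filter_upwards [hf.coeFn_toLp] with x hx
    rw [hx]
    have := congrArg conj (conj_mul_phase (h x))
    rw [map_mul, Complex.conj_conj, Complex.conj_ofReal, mul_comm] at this
    exact this
  rw [h2, integral_complex_ofReal, ← ofReal_norm, Complex.norm_real,
    Real.norm_of_nonneg (integral_nonneg fun _ => norm_nonneg _), ← L1.norm_eq_integral_norm,
    ← ENNReal.ofReal_coe_nnreal, ENNReal.ofReal_le_ofReal_iff B.coe_nonneg] at h1
  exact h1

theorem IsStandardAtom.ae_eq_indicator {r : ℝ≥0∞} {z : M} {s : ℝ} {a : Lp ℂ 1 μ}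
    (ha : IsStandardAtom μ r z s a) : a =ᵐ[μ] (ball z s).indicator a := by
  filter_upwards [ha.1] with x hx
  by_cases hxB : x ∈ ball z s
  · rw [indicator_of_mem hxB]
  · rw [indicator_of_notMem hxB, hx hxB]

theorem IsStandardAtom.eLpNorm_le [IsFiniteMeasure μ] {p r : ℝ≥0∞} (hpr : p ≤ r) {z : M} {s : ℝ}
    (hz : 0 < μ (ball z s)) {a : Lp ℂ 1 μ} (ha : IsStandardAtom μ r z s a) :
    eLpNorm a p (ballMeasure μ z s) ≤ (μ (ball z s))⁻¹ := by
  have := isProbabilityMeasure_ballMeasure hz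
  exact (eLpNorm_le_eLpNorm_of_exponent_le hpr ((Lp.aestronglyMeasurable a).mono_ac
    (ballMeasure_absolutelyContinuous z s))).trans ha.2.1

theorem smul_ballMeasure [IsFiniteMeasure μ] {z : M} {s : ℝ} (hz : 0 < μ (ball z s)) :
    μ (ball z s) • ballMeasure μ z s = μ.restrict (ball z s) := by
  rw [smul_smul, ENNReal.mul_inv_cancel hz.ne' (measure_ne_top _ _), one_smul]

theorem IsAtomAtScale.memLp [IsFiniteMeasure μ]
    (hpos : ∀ (z : M) (s : ℝ), 0 < s → 0 < μ (ball z s)) {p r : ℝ≥0∞} (hpr : p ≤ r) {c : ℝ}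
    {a : Lp ℂ 1 μ} (ha : IsAtomAtScale μ r c a) : MemLp a p μ := by
  rcases ha with ⟨z, s, hs, -, ha⟩ | ha
  · refine (memLp_congr_ae ha.ae_eq_indicator).2 ?_
    rw [memLp_indicator_iff_restrict measurableSet_ball, ← smul_ballMeasure (hpos z s hs)]
    refine MemLp.smul_measure ⟨(Lp.aestronglyMeasurable a).mono_ac
      (ballMeasure_absolutelyContinuous z s), ?_⟩ (measure_ne_top _ _)
    exact (ha.eLpNorm_le hpr (hpos z s hs)).trans_lt
      (ENNReal.inv_lt_top.2 (hpos z s hs))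
  · exact (memLp_congr_ae ha).2 (memLp_const _)

/-- Functions of bounded mean oscillation define bounded functionals on atoms. -/
theorem IsAtomAtScale.enorm_integral_conj_mul_le [IsFiniteMeasure μ] (hμ : 0 < μ univ)
    (hpos : ∀ (z : M) (s : ℝ), 0 < s → 0 < μ (ball z s)) {p q r : ℝ≥0∞}
    [ENNReal.HolderConjugate q p] (hpr : p ≤ r) {c : ℝ} {a : Lp ℂ 1 μ}
    (ha : IsAtomAtScale μ r c a) {h : M → ℂ} (hh : MemLp h q μ) {B : ℝ≥0∞}
    (hosc : OscLe μ q c B h) (h1 : eLpNorm h 1 μ ≤ B * μ univ) :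
    ‖∫ x, conj (h x) * a x ∂μ‖ₑ ≤ B := by
  have hap : MemLp a p μ := ha.memLp hpos hpr
  have hai : Integrable a μ := memLp_one_iff_integrable.1 (Lp.memLp a)
  rcases ha with ⟨z, s, hs, hsc, ha⟩ | ha
  · have hB := hpos z s hs
    obtain ⟨α, hα⟩ := hosc z s hs hsc
    -- Cancellation of the atom permits subtracting `α`. The exceptional atom has no cancellation
    -- and uses the `L¹` bound instead.
    have e1 : ∫ x, conj (h x) * a x ∂μ = ∫ x in ball z s, conj (h x - α) * a x ∂μ := by
      simp_rw [map_sub, sub_mul]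
      rw [integral_sub (integrable_conj_mul hh hap).integrableOn
        (hai.integrableOn.const_mul _), integral_const_mul, ha.2.2, mul_zero, sub_zero,
        ← integral_indicator measurableSet_ball]
      refine integral_congr_ae ?_
      filter_upwards [ha.1] with x hx
      by_cases hxB : x ∈ ball z s
      · rw [indicator_of_mem hxB]
      · rw [indicator_of_notMem hxB, hx hxB, mul_zero]
    rw [e1]
    refine (enorm_integral_le_lintegral_enorm _).trans ?_
    rw [← smul_ballMeasure hB, lintegral_smul_measure, smul_eq_mul]
    have h2 := lintegral_conj_mul_le (p := q) (q := p) (μ := ballMeasure μ z s)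
      (f := fun x => h x - α) (g := a)
      ((hh.1.mono_ac (ballMeasure_absolutelyContinuous z s)).sub aestronglyMeasurable_const)
      ((Lp.aestronglyMeasurable a).mono_ac (ballMeasure_absolutelyContinuous z s))
    grw [h2, hα, ha.eLpNorm_le hpr hB]
    rw [mul_left_comm, ENNReal.mul_inv_cancel hB.ne' (measure_ne_top _ _), mul_one]
  · have e1 : ∫ x, conj (h x) * a x ∂μ = ∫ x, conj (h x) * (((μ.real univ)⁻¹ : ℝ) : ℂ) ∂μ := by
      refine integral_congr_ae ?_
      filter_upwards [ha] with x hx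
      rw [hx]
    have e2 : ‖(((μ.real univ)⁻¹ : ℝ) : ℂ)‖ₑ = (μ univ)⁻¹ := by
      rw [← ofReal_norm, Complex.norm_real, Real.norm_of_nonneg (by positivity), measureReal_def,
        ENNReal.ofReal_inv_of_pos (ENNReal.toReal_pos hμ.ne' (measure_ne_top _ _)),
        ENNReal.ofReal_toReal (measure_ne_top _ _)]
    rw [e1, integral_mul_const, enorm_mul, e2]
    have e3 : ‖∫ x, conj (h x) ∂μ‖ₑ ≤ B * μ univ := by
      refine (enorm_integral_le_lintegral_enorm _).trans ?_
      simp_rw [RCLike.enorm_conj]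
      rwa [← eLpNorm_one_eq_lintegral_enorm]
    grw [e3]
    rw [mul_assoc, ENNReal.mul_inv_cancel hμ.ne' (measure_ne_top _ _), mul_one]

/-! ### Boundedness from `H¹` to `L¹` -/

/-- `h` is the image of `g` under `T` in the sense of duality with bounded functions. -/
def IsWeakImage (T : Lp ℂ 2 μ →L[ℂ] Lp ℂ 2 μ) (g h : Lp ℂ 1 μ) : Prop :=
  ∀ (f : Lp ℂ 2 μ) (m : ℝ≥0), (∀ᵐ x ∂μ, ‖f x‖ₑ ≤ m) →
    Tendsto (fun N => ∫ x, conj (truncation N (adjoint T f x)) * g x ∂μ) atTop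
      (𝓝 (∫ x, conj (f x) * h x ∂μ))

theorem memLp_top_of_enorm_le {f : Lp ℂ 2 μ} {m : ℝ≥0} (hm : ∀ᵐ x ∂μ, ‖f x‖ₑ ≤ m) :
    MemLp f ∞ μ := by
  refine memLp_top_of_bound (Lp.aestronglyMeasurable f) m ?_
  filter_upwards [hm] with x hx
  rw [← ofReal_norm, ← ENNReal.ofReal_coe_nnreal, ENNReal.ofReal_le_ofReal_iff m.coe_nonneg] at hx
  exact hx

section WeakImage

variable [IsFiniteMeasure μ] {T : Lp ℂ 2 μ →L[ℂ] Lp ℂ 2 μ}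

theorem memLp_top_truncation_adjoint (T : Lp ℂ 2 μ →L[ℂ] Lp ℂ 2 μ) (f : Lp ℂ 2 μ) (N : ℕ) :
    MemLp (fun x => truncation N (adjoint T f x)) ∞ μ :=
  memLp_truncation N (Lp.aestronglyMeasurable _) ∞

theorem isWeakImage_iff {g h : Lp ℂ 1 μ} : IsWeakImage T g h ↔
    ∀ (f : Lp ℂ 2 μ) (m : ℝ≥0) (hm : ∀ᵐ x ∂μ, ‖f x‖ₑ ≤ m),
      Tendsto (fun N => lpPairing (p := 1) (memLp_top_truncation_adjoint T f N) g) atTop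
        (𝓝 (lpPairing (p := 1) (memLp_top_of_enorm_le hm) h)) :=
  Iff.rfl

theorem IsWeakImage.add {g h g' h' : Lp ℂ 1 μ} (H : IsWeakImage T g h) (H' : IsWeakImage T g' h') :
    IsWeakImage T (g + g') (h + h') := by
  rw [isWeakImage_iff] at *
  intro f m hm
  simp only [map_add]
  exact (H f m hm).add (H' f m hm)

theorem IsWeakImage.smul {g h : Lp ℂ 1 μ} (H : IsWeakImage T g h) (c : ℂ) :
    IsWeakImage T (c • g) (c • h) := by
  rw [isWeakImage_iff] at *
  intro f m hm
  simp only [map_smul]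
  exact (H f m hm).const_smul c

theorem IsWeakImage.norm_le {g h : Lp ℂ 1 μ} (H : IsWeakImage T g h) {B : ℝ≥0}
    (hB : ∀ (f : Lp ℂ 2 μ) (N : ℕ), (∀ᵐ x ∂μ, ‖f x‖ₑ ≤ (1 : ℝ≥0)) →
      ‖∫ x, conj (truncation N (adjoint T f x)) * g x ∂μ‖ₑ ≤ B) : ‖h‖ ≤ B :=
  norm_le_of_enorm_integral_conj_mul_le fun f hf =>
    le_of_tendsto' (H f 1 hf).enorm fun N => hB f N hf

/-- Bounded functions determine the `L¹` norm. This uniqueness makes the extension to `H¹`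
independent of the atomic decomposition. -/
theorem IsWeakImage.unique {g h h' : Lp ℂ 1 μ} (H : IsWeakImage T g h) (H' : IsWeakImage T g h') :
    h = h' := by
  have h0 : IsWeakImage T 0 (h - h') := by
    have := H.add (H'.smul (-1))
    simpa [sub_eq_add_neg] using this
  have h1 := h0.norm_le (B := 0) fun f N _ => by
    have : ∫ x, conj (truncation N (adjoint T f x)) * (0 : Lp ℂ 1 μ) x ∂μ = 0 :=
      map_zero (lpPairing (p := 1) (memLp_top_truncation_adjoint T f N))
    rw [this]
    simp
  exact sub_eq_zero.1 (norm_le_zero_iff.1 (by simpa using h1))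

/-- The adjoint identity extends from `L²` to `L^p` by density. As `T* f` lies in `L^q`, its
truncations converge under the integral by domination. -/
theorem isWeakImage_of_memLp {p q : ℝ≥0∞} [ENNReal.HolderConjugate q p] [Fact (1 ≤ p)] (hp2 : p ≤ 2)
    {S : Lp ℂ p μ →L[ℂ] Lp ℂ p μ}
    (hS : ∀ (f : M → ℂ) (h₂ : MemLp f 2 μ) (hp : MemLp f p μ), S (hp.toLp f) =ᵐ[μ] T (h₂.toLp f))
    (hq : ∀ (f : Lp ℂ 2 μ) (m : ℝ≥0), (∀ᵐ x ∂μ, ‖f x‖ₑ ≤ m) → MemLp (adjoint T f) q μ)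
    {g h : Lp ℂ 1 μ} (hg : MemLp g p μ) (hh : h =ᵐ[μ] S (hg.toLp g)) : IsWeakImage T g h := by
  intro f m hm
  have hUq := hq f m hm
  have hfq : MemLp f q μ := (memLp_top_of_enorm_le hm).mono_exponent le_top
  have hpair : ∀ u : Lp ℂ p μ, lpPairing hfq (S u) = lpPairing hUq u := by
    have h1 : (lpPairing hfq ∘L S) = lpPairing hUq := by
      refine ContinuousLinearMap.coeFn_injective ?_
      refine (denseRange_lpInclusion (μ := μ) hp2 (hp2.trans_lt (by simp))).equalizer
        (by fun_prop) (by fun_prop) ?_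
      ext u
      change lpPairing hfq (S (lpInclusion μ hp2 u)) = lpPairing hUq (lpInclusion μ hp2 u)
      rw [lpPairing_apply, lpPairing_apply]
      have e1 : S (lpInclusion μ hp2 u) =ᵐ[μ] T u := by
        have := hS u (Lp.memLp u) ((Lp.memLp u).mono_exponent hp2)
        rwa [Lp.toLp_coeFn] at this
      calc _ = ∫ x, conj (f x) * T u x ∂μ := by
            refine integral_congr_ae ?_
            filter_upwards [e1] with x hx
            rw [hx]
        _ = ∫ x, conj (adjoint T f x) * u x ∂μ := (integral_adjoint_mul T f u).symm
        _ = _ := by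
            refine integral_congr_ae ?_
            filter_upwards [coeFn_lpInclusion hp2 u] with x hx
            rw [hx]
    exact fun u => DFunLike.congr_fun h1 u
  have hlim : ∫ x, conj (f x) * h x ∂μ = ∫ x, conj (adjoint T f x) * g x ∂μ := by
    have e1 := hpair (hg.toLp g)
    rw [lpPairing_apply, lpPairing_apply] at e1
    refine Eq.trans (integral_congr_ae ?_) (e1.trans (integral_congr_ae ?_))
    · filter_upwards [hh] with x hx
      rw [hx]
    · filter_upwards [hg.coeFn_toLp] with x hx
      rw [hx]
  rw [hlim]
  refine tendsto_integral_of_dominated_convergence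
    (fun x => 2 * ‖conj (adjoint T f x) * g x‖) (fun N => ?_)
    ((integrable_conj_mul hUq hg).norm.const_mul 2) (fun N => ae_of_all _ fun x => ?_)
    (ae_of_all _ fun x => ?_)
  · exact (integrable_conj_mul (memLp_top_truncation_adjoint T f N) (Lp.memLp g)).1
  · rw [norm_mul, norm_mul, RCLike.norm_conj, RCLike.norm_conj, ← mul_assoc]
    gcongr
    exact norm_truncation_le_two_mul N _
  · exact ((Complex.continuous_conj.tendsto _).comp (tendsto_truncation _)).mul_const _

/-- For fixed `N` the truncated adjoint is bounded, so its pairing passes through the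
`L¹`-convergent series. The bound uniform in `N` and `j` dominates the sum over `j` as `N` grows. -/
theorem IsWeakImage.hasSum {lam : ℕ → ℂ} (hlam : Summable fun j => ‖lam j‖) {a h : ℕ → Lp ℂ 1 μ}
    (H : ∀ j, IsWeakImage T (a j) (h j)) {B : ℝ≥0}
    (hB : ∀ (f : Lp ℂ 2 μ) (m : ℝ≥0) (N j : ℕ), (∀ᵐ x ∂μ, ‖f x‖ₑ ≤ m) →
      ‖∫ x, conj (truncation N (adjoint T f x)) * a j x ∂μ‖ₑ ≤ B * m)
    {g : Lp ℂ 1 μ} (hg : HasSum (fun j => lam j • a j) g) :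
    ∃ k, IsWeakImage T g k ∧ ‖k‖ ≤ B * ∑' j, ‖lam j‖ := by
  have hh : ∀ j, ‖h j‖ ≤ B := fun j => (H j).norm_le fun f N hf => by
    simpa using hB f 1 N j hf
  have hle : ∀ j, ‖lam j • h j‖ ≤ B * ‖lam j‖ := fun j => by
    rw [norm_smul, mul_comm]
    gcongr
    exact hh j
  have hsum : Summable fun j => lam j • h j := Summable.of_norm_bounded (hlam.mul_left _) hle
  refine ⟨∑' j, lam j • h j, ?_, ?_⟩
  · rw [isWeakImage_iff]
    intro f m hm
    have e1 : ∀ N, lpPairing (p := 1) (memLp_top_truncation_adjoint T f N) g =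
        ∑' j, lam j • lpPairing (p := 1) (memLp_top_truncation_adjoint T f N) (a j) := fun N => by
      have := hg.mapL (lpPairing (p := 1) (memLp_top_truncation_adjoint T f N))
      simp only [map_smul] at this
      exact this.tsum_eq.symm
    have e2 : lpPairing (p := 1) (memLp_top_of_enorm_le hm) (∑' j, lam j • h j) =
        ∑' j, lam j • lpPairing (p := 1) (memLp_top_of_enorm_le hm) (h j) := by
      rw [ContinuousLinearMap.map_tsum _ hsum]
      simp only [map_smul]
    rw [e2]
    simp only [e1]
    refine tendsto_tsum_of_dominated_convergence (bound := fun j => ‖lam j‖ * (B * m))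
      (hlam.mul_right _) (fun j => ?_) (Eventually.of_forall fun N j => ?_)
    · exact ((isWeakImage_iff.1 (H j)) f m hm).const_smul _
    · rw [norm_smul]
      gcongr
      have h1 := hB f m N j hm
      rw [← ofReal_norm, ← ENNReal.coe_mul, ← ENNReal.ofReal_coe_nnreal,
        ENNReal.ofReal_le_ofReal_iff (by positivity)] at h1
      exact h1
  · rw [← tsum_mul_left]
    exact tsum_of_norm_bounded (hlam.mul_left _).hasSum hle

end WeakImage

/-- An operator on `L²(μ)` with bounded extension to `L^p(μ)`, `1 < p ≤ 2`, whose adjoint maps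
`L^∞(μ)` into `BMO`, is bounded from `H¹` to `L¹`. -/
theorem extendsHardyToL1_of_oscLe [IsFiniteMeasure μ] (hμ : 0 < μ univ)
    (hpos : ∀ (z : M) (s : ℝ), 0 < s → 0 < μ (ball z s)) {T : Lp ℂ 2 μ →L[ℂ] Lp ℂ 2 μ}
    {p q r : ℝ≥0∞} [ENNReal.HolderConjugate q p] [Fact (1 ≤ p)] (hp2 : p ≤ 2) (hpr : p ≤ r)
    (hTp : ExtendsToLp T p) {c : ℝ} {A : ℝ≥0}
    (hq : ∀ (f : Lp ℂ 2 μ) (m : ℝ≥0), (∀ᵐ x ∂μ, ‖f x‖ₑ ≤ m) → MemLp (adjoint T f) q μ)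
    (hU : ∀ (f : Lp ℂ 2 μ) (m : ℝ≥0), (∀ᵐ x ∂μ, ‖f x‖ₑ ≤ m) →
      OscLe μ q c (A * m) (adjoint T f) ∧ eLpNorm (adjoint T f) 1 μ ≤ A * m * μ univ) :
    ExtendsHardyToL1 T r c (2 * A) := by
  obtain ⟨S₀, hS₀⟩ := hTp
  have hS₁ : ∀ u : Lp ℂ p μ, MemLp (S₀ u) 1 μ := fun u => (Lp.memLp _).mono_exponent Fact.out
  have hweak : ∀ (g : Lp ℂ 1 μ) (hg : MemLp g p μ),
      IsWeakImage T g ((hS₁ (hg.toLp g)).toLp _) := fun g hg =>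
    isWeakImage_of_memLp (q := q) hp2 hS₀ hq hg (MemLp.coeFn_toLp _)
  have hbound : ∀ a, IsAtomAtScale μ r c a → ∀ (f : Lp ℂ 2 μ) (m : ℝ≥0) (N : ℕ),
      (∀ᵐ x ∂μ, ‖f x‖ₑ ≤ m) →
      ‖∫ x, conj (truncation N (adjoint T f x)) * a x ∂μ‖ₑ ≤ (2 * A : ℝ≥0) * m := by
    intro a ha f m N hm
    obtain ⟨h1, h2⟩ := hU f m hm
    refine ha.enorm_integral_conj_mul_le (p := p) (q := q) hμ hpos hpr
      (memLp_truncation N (Lp.aestronglyMeasurable _) q) ?_ ?_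
    · rw [ENNReal.coe_mul, mul_assoc]
      exact h1.truncation N
    · calc _ ≤ 2 * eLpNorm (adjoint T f) 1 μ := by
            rw [eLpNorm_one_eq_lintegral_enorm, eLpNorm_one_eq_lintegral_enorm,
              ← lintegral_const_mul' _ _ (by simp)]
            exact lintegral_mono fun x => enorm_truncation_le N _
        _ ≤ _ := by
            grw [h2]
            refine le_of_eq ?_
            push_cast
            ring
  have hdec : ∀ (g : Lp ℂ 1 μ) (lam : ℕ → ℂ) (a : ℕ → Lp ℂ 1 μ),
      IsAtomicDecomposition μ r c g lam a →
      ∃ k, IsWeakImage T g k ∧ ‖k‖ ≤ (2 * A : ℝ≥0) * ∑' j, ‖lam j‖ := fun g lam a ha =>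
    IsWeakImage.hasSum ha.2.1 (fun j => hweak (a j) ((ha.1 j).memLp hpos hpr))
      (fun f m N j hm => hbound (a j) (ha.1 j) f m N hm) ha.2.2
  have hex : ∀ g : hardySpace μ r c, ∃ k, IsWeakImage T (g : Lp ℂ 1 μ) k := by
    rintro ⟨g, lam, a, ha⟩
    obtain ⟨k, hk, -⟩ := hdec g lam a ha
    exact ⟨k, hk⟩
  -- Uniqueness of weak images makes the chosen map linear, bounds it by every decomposition, and
  -- identifies it with `T` on `L²`.
  choose S hS using hex
  refine ⟨{ toFun := S
            map_add' := fun g g' => (hS (g + g')).unique ((hS g).add (hS g'))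
            map_smul' := fun t g => (hS (t • g)).unique ((hS g).smul t) }, fun g => ?_,
    fun g h₂ => ?_⟩
  · change ‖S g‖ ≤ _
    have hle : ∀ t ∈ {t | ∃ lam a, IsAtomicDecomposition μ r c (g : Lp ℂ 1 μ) lam a ∧
        t = ∑' j, ‖lam j‖}, ‖S g‖ ≤ 2 * A * t := by
      rintro t ⟨lam, a, ha, rfl⟩
      obtain ⟨k, hk, hk'⟩ := hdec _ lam a ha
      rw [(hS g).unique hk]
      simpa using hk'
    obtain ⟨lam, a, ha⟩ := g.2
    -- Passing to the infimum divides by `2 * A`, so `A = 0` is separate.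
    rcases eq_or_lt_of_le A.coe_nonneg with hA | hA
    · have := hle _ ⟨lam, a, ha, rfl⟩
      rw [← hA] at this ⊢
      simpa using this
    · rw [← div_le_iff₀' (by positivity)]
      refine le_csInf ⟨_, lam, a, ha, rfl⟩ fun t ht => ?_
      rw [div_le_iff₀' (by positivity)]
      exact hle t ht
  · change S g =ᵐ[μ] _
    have hgp : MemLp (g : Lp ℂ 1 μ) p μ := h₂.mono_exponent hp2
    rw [(hS g).unique (hweak g hgp)]
    exact (MemLp.coeFn_toLp _).trans (hS₀ _ h₂ hgp)

/-! ### Singular integrals -/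

theorem exists_holderConjugate_of_le_two {p : ℝ≥0∞} (hp1 : 1 < p) (hp2 : p ≤ 2) :
    ∃ q : ℝ≥0∞, ENNReal.HolderConjugate p q ∧ 2 ≤ q ∧ q < ∞ := by
  have hpq := ENNReal.HolderConjugate.conjExponent hp1.le
  refine ⟨_, hpq, ?_, (ENNReal.HolderConjugate.lt_top_iff_one_lt _ p).2 hp1⟩
  rw [hpq.conj_eq, ← one_add_one_eq_two]
  refine add_le_add_right ?_ 1
  rw [ENNReal.one_le_inv, tsub_le_iff_right, one_add_one_eq_two]
  exact hp2

theorem ExtendsHardyToL1.mono [IsFiniteMeasure μ] {T : Lp ℂ 2 μ →L[ℂ] Lp ℂ 2 μ} {r : ℝ≥0∞}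
    {c A A' : ℝ} (hT : ExtendsHardyToL1 T r c A) (h : A ≤ A') : ExtendsHardyToL1 T r c A' := by
  obtain ⟨S, hS, hS'⟩ := hT
  refine ⟨S, fun g => (hS g).trans ?_, hS'⟩
  gcongr
  refine Real.sInf_nonneg ?_
  rintro t ⟨lam, a, -, rfl⟩
  exact tsum_nonneg fun j => norm_nonneg _

theorem BoundedLinftyToBMO.mono {T : Lp ℂ 2 μ →L[ℂ] Lp ℂ 2 μ} {q : ℝ≥0∞} {c A A' : ℝ}
    (hT : BoundedLinftyToBMO T q c A) (h : A ≤ A') : BoundedLinftyToBMO T q c A' := by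
  intro f h₂ hf
  refine ⟨(hT f h₂ hf).1, (hT f h₂ hf).2.trans ?_⟩
  gcongr

section

variable [IsFiniteMeasure μ] (hμ : 0 < μ univ) (hLD : LocallyDoubling μ)
  (hI : ComplementaryIsoperimetric μ) {b : ℝ}
include hμ hLD hI

theorem OffDiagonalOsc.extendsToLp (hb : 0 < b) {T : Lp ℂ 2 μ →L[ℂ] Lp ℂ 2 μ} {K : ℝ≥0}
    (hTK : ‖T‖ ≤ K) (hT : OffDiagonalOsc T b K) {p : ℝ≥0∞} [Fact (1 ≤ p)] (hp : 2 ≤ p)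
    (hp' : p < ∞) : ExtendsToLp T p := by
  obtain ⟨C, hC⟩ := exists_eLpNorm_le_and_oscLe hμ hLD hI hb hp hp'
  exact extendsToLp_of_two_le hp (hC T K hTK hT).1

theorem OffDiagonalOsc.extendsToLp_of_adjoint (hb : 0 < b) {T : Lp ℂ 2 μ →L[ℂ] Lp ℂ 2 μ} {K : ℝ≥0}
    (hTK : ‖adjoint T‖ ≤ K) (hT : OffDiagonalOsc (adjoint T) b K) {p : ℝ≥0∞} [Fact (1 ≤ p)]
    (hp : 1 < p) (hp' : p ≤ 2) : ExtendsToLp T p := by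
  obtain ⟨q, hpq, hq, hq'⟩ := exists_holderConjugate_of_le_two hp hp'
  obtain ⟨C, hC⟩ := exists_eLpNorm_le_and_oscLe hμ hLD hI hb hq hq'
  exact extendsToLp_of_le_two hp' (eLpNorm_le_of_adjoint hpq hp hp' hq hq' (hC _ K hTK hT).1)

variable {R₀ β : ℝ} (hAM : ApproximateMidpoint M R₀ β) (hb : R₀ / (1 - β) < b) (c : ℝ)
include hAM hb

theorem exists_boundedLinftyToBMO {q : ℝ≥0∞} (hq : 1 ≤ q) (hq' : q < ∞) :
    ∃ C : ℝ≥0, ∀ (T : Lp ℂ 2 μ →L[ℂ] Lp ℂ 2 μ) (K : ℝ≥0), ‖T‖ ≤ K → OffDiagonalOsc T b K →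
      BoundedLinftyToBMO T q c (C * K) := by
  obtain ⟨C, hC⟩ := exists_oscLe_and_eLpNorm_one_le hμ hLD hAM hI hb c hq hq'
  refine ⟨(μ univ).toNNReal * C + 2 * C, fun T K hTK hT => ?_⟩
  refine (boundedLinftyToBMO_of_oscLe (fun z s hs => hLD.measure_ball_pos hμ z hs) hq
    (hC T K hTK hT)).mono (le_of_eq ?_)
  rw [measureReal_def, ENNReal.toReal]
  push_cast
  ring

theorem exists_extendsHardyToL1 {r : ℝ≥0∞} (hr : 1 < r) :
    ∃ C : ℝ≥0, ∀ (T : Lp ℂ 2 μ →L[ℂ] Lp ℂ 2 μ) (K : ℝ≥0), ‖adjoint T‖ ≤ K →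
      OffDiagonalOsc (adjoint T) b K → ExtendsHardyToL1 T r c (C * K) := by
  have hb0 : 0 < b := (div_nonneg hAM.1 (by linarith [hAM.2.2.1])).trans_lt hb
  -- With `p = min r 2`, atoms lie in `L^p` because `p ≤ r`, and `p ≤ 2` makes the `L^p` extension
  -- available.
  have hp1 : 1 < min r 2 := lt_min hr (by norm_num)
  have hp2 : min r 2 ≤ 2 := min_le_right _ _
  obtain ⟨q, hpq, hq, hq'⟩ := exists_holderConjugate_of_le_two hp1 hp2
  have : Fact (1 ≤ min r 2) := ⟨hp1.le⟩
  have hqp : ENNReal.HolderConjugate q (min r 2) := hpq.symm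
  obtain ⟨C, hC⟩ := exists_oscLe_and_eLpNorm_one_le hμ hLD hAM hI hb c
    ((by norm_num : (1 : ℝ≥0∞) ≤ 2).trans hq) hq'
  obtain ⟨C', hC'⟩ := exists_eLpNorm_le_and_oscLe hμ hLD hI hb0 hq hq'
  refine ⟨2 * C, fun T K hTK hT => ?_⟩
  refine (extendsHardyToL1_of_oscLe (q := q) hμ (fun z s hs => hLD.measure_ball_pos hμ z hs) hp2
    (min_le_left r 2) (hT.extendsToLp_of_adjoint hμ hLD hI hb0 hTK hp1 hp2) (fun f m hm => ?_)
    (hC _ K hTK hT)).mono (le_of_eq ?_)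
  · refine ⟨Lp.aestronglyMeasurable _, ((hC' _ K hTK hT).1 f).trans_lt ?_⟩
    exact ENNReal.mul_lt_top ENNReal.coe_lt_top
      ((memLp_top_of_enorm_le hm).mono_exponent le_top).eLpNorm_lt_top
  · push_cast
    ring

end

end MetricHardy

/-! ### Proof of the theorem on singular integrals. -/

theorem theoremt {M : Type*} [MetricSpace M] [MeasurableSpace M] [BorelSpace M]
    (μ : Measure M) [IsFiniteMeasure μ] (hμ : 0 < μ univ)
    (hunb : ¬ Bornology.IsBounded (univ : Set M))
    (hLD : MetricHardy.LocallyDoubling μ)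
    (R₀ β : ℝ) (hAM : MetricHardy.ApproximateMidpoint M R₀ β)
    (hIc : MetricHardy.ComplementaryIsoperimetric μ)
    (b : ℝ) (hb : R₀ / (1 - β) < b)
    -- the scale `c` and the exponents `r`, `q` of the norms on the Hardy space and on `BMO`
    (c : ℝ) (hc : R₀ / (1 - β) < c)
    (r : ℝ≥0∞) (hr : 1 < r) (q : ℝ≥0∞) (hq : 1 ≤ q) (hq' : q < ∞) :
    ∃ C : ℝ, 0 < C ∧
      ∀ (T : Lp ℂ 2 μ →L[ℂ] Lp ℂ 2 μ) (k : M → M → ℂ), MetricHardy.IsKernelOf T k →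
        (MetricHardy.nuConst μ b k < ∞ →
          (∀ (p : ℝ≥0∞) [Fact (1 ≤ p)], 1 < p → p ≤ 2 → MetricHardy.ExtendsToLp T p) ∧
          MetricHardy.ExtendsHardyToL1 T r c
            (C * ((MetricHardy.nuConst μ b k).toReal + ‖T‖))) ∧
        (MetricHardy.upsilonConst μ b k < ∞ →
          (∀ (p : ℝ≥0∞) [Fact (1 ≤ p)], 2 ≤ p → p < ∞ → MetricHardy.ExtendsToLp T p) ∧
          MetricHardy.BoundedLinftyToBMO T q c
            (C * ((MetricHardy.upsilonConst μ b k).toReal + ‖T‖))) ∧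
        (IsSelfAdjoint T → MetricHardy.nuConst μ b k < ∞ →
          (∀ (p : ℝ≥0∞) [Fact (1 ≤ p)], 1 < p → p < ∞ → MetricHardy.ExtendsToLp T p) ∧
          (∃ A : ℝ, MetricHardy.ExtendsHardyToL1 T r c A) ∧
          (∃ A : ℝ, MetricHardy.BoundedLinftyToBMO T q c A)) := by
  have hb0 : 0 < b := (div_nonneg hAM.1 (by linarith [hAM.2.2.1])).trans_lt hb
  have hpos : ∀ (z : M) (s : ℝ), 0 < s → 0 < μ (ball z s) :=
    fun z s hs => hLD.measure_ball_pos hμ z hs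
  obtain ⟨C₁, hC₁⟩ := MetricHardy.exists_extendsHardyToL1 hμ hLD hIc hAM hb c hr
  obtain ⟨C₂, hC₂⟩ := MetricHardy.exists_boundedLinftyToBMO hμ hLD hIc hAM hb c hq hq'
  refine ⟨2 * C₁ + C₂ + 1, by positivity, fun T k hk => ?_⟩
  have hadj : ‖ContinuousLinearMap.adjoint T‖ = ‖T‖ := LinearIsometryEquiv.norm_map _ T
  set ν := (MetricHardy.nuConst μ b k).toNNReal
  set υ := (MetricHardy.upsilonConst μ b k).toNNReal
  -- A single constant must bound both the norm and the off-diagonal oscillation. For the adjoint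
  -- the latter is `2 * ν`, which explains the `2 * C₁` above.
  have hT₁ : ‖ContinuousLinearMap.adjoint T‖ ≤ (2 * (ν + ‖T‖₊) : ℝ≥0) := by
    rw [hadj]
    push_cast
    linarith [norm_nonneg T, ν.coe_nonneg]
  have hT₂ : ‖T‖ ≤ (υ + ‖T‖₊ : ℝ≥0) := by
    push_cast
    linarith [υ.coe_nonneg]
  have hK₁ : MetricHardy.nuConst μ b k < ∞ →
      MetricHardy.OffDiagonalOsc (ContinuousLinearMap.adjoint T) b (2 * (ν + ‖T‖₊)) := fun h =>
    (hk.offDiagonalOsc_adjoint hpos h).mono (by gcongr; exact le_self_add)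
  have hK₂ : MetricHardy.upsilonConst μ b k < ∞ →
      MetricHardy.OffDiagonalOsc T b (υ + ‖T‖₊) := fun h =>
    (hk.offDiagonalOsc hpos h).mono le_self_add
  refine ⟨fun h => ⟨fun p _ hp hp' => ?_, ?_⟩, fun h => ⟨fun p _ hp hp' => ?_, ?_⟩,
    fun hsa h => ⟨fun p _ hp hp' => ?_, ?_, ?_⟩⟩
  · exact (hK₁ h).extendsToLp_of_adjoint hμ hLD hIc hb0 hT₁ hp hp'
  · refine (hC₁ T _ hT₁ (hK₁ h)).mono ?_
    change _ ≤ (2 * (C₁ : ℝ) + C₂ + 1) * ((ν : ℝ) + ‖T‖)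
    push_cast
    nlinarith [mul_nonneg (C₂.coe_nonneg) (add_nonneg ν.coe_nonneg (norm_nonneg T)),
      norm_nonneg T, ν.coe_nonneg]
  · exact (hK₂ h).extendsToLp hμ hLD hIc hb0 hT₂ hp hp'
  · refine (hC₂ T _ hT₂ (hK₂ h)).mono ?_
    change _ ≤ (2 * (C₁ : ℝ) + C₂ + 1) * ((υ : ℝ) + ‖T‖)
    push_cast
    nlinarith [mul_nonneg (C₁.coe_nonneg) (add_nonneg υ.coe_nonneg (norm_nonneg T)),
      norm_nonneg T, υ.coe_nonneg]
  -- As `T` is its own adjoint, the regularity obtained for the adjoint from `ν_k` also holds for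
  -- `T`, giving the range `p ≥ 2` and below the `BMO` bound.
  · have hT₃ := hT₁
    have hK₃ := hK₁ h
    rw [ContinuousLinearMap.isSelfAdjoint_iff'.1 hsa] at hT₃ hK₃
    rcases le_total p 2 with h2 | h2
    · exact (hK₁ h).extendsToLp_of_adjoint hμ hLD hIc hb0 hT₁ hp h2
    · exact hK₃.extendsToLp hμ hLD hIc hb0 hT₃ h2 hp'
  · exact ⟨_, hC₁ T _ hT₁ (hK₁ h)⟩
  · have hT₃ := hT₁
    have hK₃ := hK₁ h
    rw [ContinuousLinearMap.isSelfAdjoint_iff'.1 hsa] at hT₃ hK₃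
    exact ⟨_, hC₂ T _ hT₃ hK₃⟩
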